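/- Let $M$ be a monoid, regarded as discrete. An $M$-space is a topological space with a continuous left $M$-action. An $M$-set $P$ is free if it has a basis (a subset $B$ such that every element is uniquely $mb$ with $m\in M$, $b\in B$), and projective if every $M$-equivariant surjection of $M$-sets onto $P$ has an $M$-equivariant section. A projective (free) $M$-CW complex is an $M$-space $X=\varinjlim X_n$, where $X_{-1}=\varnothing$ and, for each $n\ge 0$, $X_n$ is obtained as a pushout of $M$-spaces from $X_{n-1}$ by attaching $P_n\times B^n$ along an $M$-equivariant continuous map $P_n\times S^{n-1}\to X_{n-1}$, with $P_n$ a projective (free) discrete $M$-set and $M$ acting trivially on the ball $B^n$. An equivariant classifying space for $M$ is a contractible projective $M$-CW complex. An $M$-homotopy is a homotopy through $M$-equivariant maps, and an $M$-homotopy equivalence is an $M$-equivariant map with an $M$-equivariant inverse up to $M$-homotopy. Write $M\backslash X$ for the quotient space of $X$ by the equivalence relation generated by $x\sim mx$ ($x\in X$, $m\in M$). Let $|BM|$ be the geometric realization of the nerve of the one-object category with arrows $M$ in which $m$ followed by $n$ is $mn$. Let $|\overrightarrow{EM}|$ be the geometric realization of the nerve of the right Cayley graph category of $M$, which has object set $M$,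 arrows $(x,m)\colon x\to xm$ and composition $(xm,n)\circ(x,m)=(x,mn)$, with $M$ acting by left multiplication. 1. There exists a contractible free $M$-CW complex, and it is an equivariant classifying space for $M$; for example, $|\overrightarrow{EM}|$ is one. 2. If $X$ and $Y$ are equivariant classifying spaces for $M$, then there are mutually inverse $M$-homotopy equivalences $f\colon X\to Y$ and $g\colon Y\to X$ which are cellular, that is, $f(X_n)\subseteq Y_n$ and $g(Y_n)\subseteq X_n$ for all $n$. 3. If $X$ and $Y$ are equivariant classifying spaces for $M$, then $M\backslash X$ and $M\backslash Y$ are homotopy equivalent. In particular, $M\backslash X$ is homotopy equivalent to $|BM|$. 4. Let $G$ be a group. If $X$ is an equivariant classifying space for $G$, then $G\backslash X$ is an Eilenberg--Mac Lane space for $G$, that is, a connected CW complex with fundamental group isomorphic to $G$ and with trivial higher homotopy groups. Conversely, let $p\colon E\to K$ be a universal (that is, simply connected) covering of an Eilenberg--Mac Lane space $K$ for $G$. Then there is an action of $G$ on $E$ that identifies $G$ with the group of deck transformations of $p$, and with any such action $E$ is an equivariant classifying space for $G$. -/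

import Mathlib

open CategoryTheory Topology

universe u v w

/-- An `M`-set is free if it has a basis `B`: every element is uniquely of the form `m • b`
with `m : M` and `b ∈ B`. -/
def IsFreeMSet (M : Type u) [Monoid M] (P : Type v) [MulAction M P] : Prop :=
  ∃ B : Set P, Function.Bijective (fun q : M × B => q.1 • (q.2 : P))

/-- An `M`-set is projective if every equivariant surjection onto it has an equivariant section.
(The free `M`-set `M × P` lives in the universe `max u v`, so surjections from `M`-sets
in this universe suffice.) -/
def IsProjectiveMSet (M : Type u) [Monoid M] (P : Type v) [MulAction M P] : Prop :=
  ∀ (Q : Type (max u v)) [MulAction M Q] (f : Q →[M] P), Function.Surjective f →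
    ∃ s : P →[M] Q, ∀ p, f (s p) = p

/-- The closed unit ball `B^n` in Euclidean `n`-space. -/
abbrev Ball (n : ℕ) : Type :=
  Metric.closedBall (0 : EuclideanSpace ℝ (Fin n)) 1

/-- The structure of an `M`-CW complex on an `M`-space `X`, where `M` is discrete: for every `n`
an `M`-set `cell n` and an equivariant map `char n : cell n × B^n → X`, where `B^n` has the
trivial action, such that `X` is the colimit of its skeleta and each skeleton is the pushout of
the preceding one along `cell n × S^(n-1) → cell n × B^n`.
The set `skel n` is the `(n-1)`-skeleton of `X`; in particular `skel 0` is empty. -/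
structure MCWComplex (M : Type u) [Monoid M] (X : Type v) [TopologicalSpace X]
    [MulAction M X] where
  cell : ℕ → Type v
  [cellAction : ∀ n, MulAction M (cell n)]
  skel : ℕ → Set X
  char : ∀ n, cell n → Ball n → X
  continuous_char : ∀ n p, Continuous (char n p)
  char_smul : ∀ n (m : M) p y, char n (m • p) y = m • char n p y
  skel_zero : skel 0 = ∅
  skel_succ : ∀ n, skel (n + 1) = skel n ∪ ⋃ p, Set.range (char n p)
  /-- The boundary spheres are attached to the preceding skeleton. -/
  char_sphere : ∀ n p (y : Ball n), ‖y.1‖ = 1 → char n p y ∈ skel n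
  /-- The open cells do not meet the preceding skeleton. -/
  char_interior : ∀ n p (y : Ball n), ‖y.1‖ < 1 → char n p y ∉ skel n
  /-- No points of open cells are identified. -/
  char_injective : ∀ n p p' (y y' : Ball n), ‖y.1‖ < 1 → ‖y'.1‖ < 1 →
    char n p y = char n p' y' → p = p' ∧ y = y'
  /-- Each skeleton is closed and has the topology of the pushout. -/
  isClosed_skel_succ : ∀ n (K : Set X), K ⊆ skel (n + 1) →
    (IsClosed K ↔ IsClosed (K ∩ skel n) ∧ ∀ p, IsClosed (char n p ⁻¹' K))
  iUnion_skel : ⋃ n, skel n = Set.univ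
  /-- `X` has the colimit topology of its skeleta. -/
  isClosed_iff : ∀ K : Set X, IsClosed K ↔ ∀ n, IsClosed (K ∩ skel n)

attribute [instance] MCWComplex.cellAction

namespace MCWComplex

variable {M : Type u} [Monoid M] {X : Type v} [TopologicalSpace X] [MulAction M X]
  {Y : Type w} [TopologicalSpace Y] [MulAction M Y]

/-- A free `M`-CW complex is one built from free `M`-cells. -/
def IsFree (C : MCWComplex M X) : Prop := ∀ n, IsFreeMSet M (C.cell n)

/-- A projective `M`-CW complex is one built from projective `M`-cells. -/
def IsProjective (C : MCWComplex M X) : Prop := ∀ n, IsProjectiveMSet M (C.cell n)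

/-- A (left) equivariant classifying space for `M` is a contractible projective
`M`-CW complex. -/
def IsEquivariantClassifyingSpace (C : MCWComplex M X) : Prop :=
  C.IsProjective ∧ ContractibleSpace X

/-- A map of `M`-CW complexes is cellular if it maps the `n`-skeleton to the `n`-skeleton,
for every `n`. -/
def IsCellular (C : MCWComplex M X) (D : MCWComplex M Y) (f : X → Y) : Prop :=
  ∀ n, Set.MapsTo f (C.skel (n + 1)) (D.skel (n + 1))

end MCWComplex

/-- Equivariance of a map of `M`-spaces. -/
def IsEquivariant (M : Type u) [Monoid M] {X : Type v} {Y : Type w} [MulAction M X]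
    [MulAction M Y] (f : X → Y) : Prop :=
  ∀ (m : M) x, f (m • x) = m • f x

/-- Two maps are `M`-homotopic if there is a homotopy between them that is equivariant for the
trivial action of `M` on the unit interval. -/
def MHomotopic (M : Type u) [Monoid M] {X : Type v} {Y : Type w} [TopologicalSpace X]
    [TopologicalSpace Y] [MulAction M X] [MulAction M Y] (f g : C(X, Y)) : Prop :=
  ∃ H : f.Homotopy g, ∀ t (m : M) x, H (t, m • x) = m • H (t, x)

/-- `f` and `g` are mutually inverse `M`-homotopy equivalences. -/
def AreMHomotopyInverse (M : Type u) [Monoid M] {X : Type v} {Y : Type w} [TopologicalSpace X]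
    [TopologicalSpace Y] [MulAction M X] [MulAction M Y] (f : C(X, Y)) (g : C(Y, X)) : Prop :=
  IsEquivariant M f ∧ IsEquivariant M g ∧
    MHomotopic M (g.comp f) (ContinuousMap.id X) ∧ MHomotopic M (f.comp g) (ContinuousMap.id Y)

/-- The equivalence relation on an `M`-set whose classes are the weak orbits: it is generated
by `M x ⊆ M y`, that is, by `x ∈ M y`. -/
def weakOrbitSetoid (M : Type u) [Monoid M] (X : Type v) [MulAction M X] : Setoid X :=
  Relation.EqvGen.setoid fun x y => x ∈ MulAction.orbit M y

/-- The quotient `M \ X`, with the quotient topology if `X` is a space. -/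
abbrev WeakOrbits (M : Type u) [Monoid M] (X : Type v) [MulAction M X] : Type v :=
  Quotient (weakOrbitSetoid M X)

/-- The objects of the right Cayley graph category of `M`: the elements of `M`. -/
@[ext]
structure RightCayley (M : Type u) where
  val : M

/-- The right Cayley graph category of `M`: the arrows from `x` to `y` are the `m : M` with
`x * m = y`; composing `m : x ⟶ x * m` and `n : x * m ⟶ x * m * n` gives `m * n`. -/
instance RightCayley.category (M : Type u) [Monoid M] : Category.{u} (RightCayley M) where
  Hom x y := {m : M // x.val * m = y.val}
  id x := ⟨1, mul_one _⟩
  comp f g := ⟨f.1 * g.1, by rw [← mul_assoc, f.2, g.2]⟩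
  id_comp f := Subtype.ext (one_mul f.1)
  comp_id f := Subtype.ext (mul_one f.1)
  assoc f g h := Subtype.ext (mul_assoc f.1 g.1 h.1)

/-- Left multiplication by `s` as an endofunctor of the right Cayley graph category. -/
def RightCayley.leftMul {M : Type u} [Monoid M] (s : M) : RightCayley M ⥤ RightCayley M where
  obj x := ⟨s * x.val⟩
  map f := ⟨f.1, by rw [mul_assoc, f.2]⟩
  map_id _ := rfl
  map_comp _ _ := rfl

theorem RightCayley.leftMul_one (M : Type u) [Monoid M] :
    RightCayley.leftMul (1 : M) = 𝟭 (RightCayley M) := by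
  refine CategoryTheory.Functor.hext (fun x => RightCayley.ext (one_mul _)) ?_
  rintro ⟨x⟩ ⟨y⟩ ⟨m, hm⟩
  simp only [RightCayley.leftMul, Functor.id_map]
  congr 1 <;> simp

theorem RightCayley.leftMul_mul {M : Type u} [Monoid M] (s t : M) :
    RightCayley.leftMul (s * t) = RightCayley.leftMul t ⋙ RightCayley.leftMul s := by
  refine CategoryTheory.Functor.hext (fun x => RightCayley.ext (mul_assoc _ _ _)) ?_
  rintro ⟨x⟩ ⟨y⟩ ⟨m, hm⟩
  simp only [RightCayley.leftMul, Functor.comp_map]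
  congr 1 <;> simp [mul_assoc]

/-- The simplicial set `EM`: the nerve of the right Cayley graph category. -/
abbrev EM (M : Type u) [Monoid M] : SSet.{u} := nerve (RightCayley M)

/-- The simplicial set `BM`: the nerve of the one-object category in which the composite of
`m : * ⟶ *` and `n : * ⟶ *`, in this order, is `m * n`. -/
abbrev BM (M : Type u) [Monoid M] : SSet.{u} := nerve (SingleObj Mᵐᵒᵖ)

/-- The geometric realization `|EM|`. -/
abbrev EMSpace (M : Type u) [Monoid M] : Type u := SSet.toTop.obj (EM M)

/-- The geometric realization `|BM|`, the classifying space of `M`. -/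
abbrev BMSpace (M : Type u) [Monoid M] : Type u := SSet.toTop.obj (BM M)

/-- `M` acts on `|EM|` by left multiplication. -/
noncomputable instance EMSpace.mulAction (M : Type u) [Monoid M] : MulAction M (EMSpace M) where
  smul s x := SSet.toTop.map (nerveMap (RightCayley.leftMul s)) x
  one_smul x := by
    change SSet.toTop.map (nerveMap (RightCayley.leftMul (1 : M))) x = x
    have h : nerveMap (𝟭 (RightCayley M)) = 𝟙 (EM M) := rfl
    rw [RightCayley.leftMul_one, h, SSet.toTop.map_id]
    rfl
  mul_smul s t x := by
    change SSet.toTop.map (nerveMap (RightCayley.leftMul (s * t))) x = _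
    have h : nerveMap (RightCayley.leftMul t ⋙ RightCayley.leftMul s) =
      nerveMap (RightCayley.leftMul t) ≫ nerveMap (RightCayley.leftMul s) := rfl
    rw [RightCayley.leftMul_mul, h, SSet.toTop.map_comp]
    rfl

instance EMSpace.continuousConstSMul (M : Type u) [Monoid M] :
    ContinuousConstSMul M (EMSpace M) where
  continuous_const_smul s :=
    (SSet.toTop.map (nerveMap (RightCayley.leftMul s))).hom.continuous

/-- An Eilenberg-Mac Lane space for a group `G`: a connected aspherical CW complex with
fundamental group `G`. -/
structure IsEilenbergMacLane (G : Type u) [Group G] (K : Type v) [TopologicalSpace K] : Prop where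
  t2Space : T2Space K
  cwComplex : Nonempty (Topology.CWComplex (Set.univ : Set K))
  pathConnectedSpace : PathConnectedSpace K
  fundamentalGroup : ∀ x : K, Nonempty (FundamentalGroup K x ≃* G)
  aspherical : ∀ n : ℕ, 2 ≤ n → ∀ x : K, Subsingleton (HomotopyGroup.Pi n K x)

/-- A continuous action of `G` on the total space of `p` is an action by deck transformations
that identifies `G` with the group of all deck transformations of `p`. -/
def IsDeckAction (G : Type u) [Group G] {E : Type v} {K : Type w} [TopologicalSpace E]
    [MulAction G E] (p : E → K) : Prop :=
  (∀ (g : G) x, p (g • x) = p x) ∧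
    ∀ h : E ≃ₜ E, (∀ x, p (h x) = p x) → ∃! g : G, ∀ x, h x = g • x

/-! Equivariant maps out of a projective `M`-CW complex can be built cell by cell, exactly as for an
ordinary CW complex. A projective `M`-set `P` is a retract of the free `M`-set `M × P`, so each `p`
can be written as `a p • b p` with `a` equivariant and `b` invariant. To extend an equivariant map
over the cells `P × B^n`, one extends it over the ball of `b p`, without regard to the action, and
translates the result by `a p`. On the sphere the two prescriptions agree because the given map is
equivariant. This is `IsPartialMap.exists_succ`. It is carried out for maps whose graph lies in an
invariant relation `R`, so that one construction yields several results according to the choice of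
`R` and of the target.

If `R` says that skeleta are respected, one obtains equivariant cellular maps into a contractible
complex; the cellwise input is cellular approximation for balls, proved by smooth approximation and
pushing off a missed point. If the target is the path space `C(I, Y)` and `R` prescribes the
endpoints, one obtains `M`-homotopies between any two equivariant maps; the input is that spheres
bound in `Y`. Together these give uniqueness of equivariant classifying spaces, and `M`-homotopies
descend to the quotients by `M`.

For existence, a simplex of `EM` is determined by its first vertex and by its image in `BM`. It is
degenerate exactly when that image is, so the nondegenerate simplices form a free `M`-set based on
those that start at `1`, and dividing by `M` leaves `|BM|`. The object `1` is initial in the Cayley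
graph category; coning off from it contracts `|EM|`.

For a group `G`, projective cells have trivial stabilizers, and an equivariant map to a cone on the
discrete set `G` separates a point from its translates. Hence `X → G\X` is a covering with simply
connected total space, which gives the fundamental group, while higher loops lift to the
contractible space `X`. Conversely, the cells of `K` lift to a covering `E`, where deck
transformations permute them freely. The homotopy groups of a simply connected `E` vanish, so every
sphere in `E` bounds and `E` is contractible by the cellwise construction again. -/

/-! ### Extending maps from spheres to balls -/

open Metric unitInterval in
/-- Every continuous map from the unit sphere of `V` to `Y` extends to the closed unit ball. -/
def SphereExtension (V : Type*) [NormedAddCommGroup V] (Y : Type*) [TopologicalSpace Y] : Prop :=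
  ∀ φ : C(sphere (0 : V) 1, Y), ∃ Φ : C(closedBall (0 : V) 1, Y),
    ∀ x : sphere (0 : V) 1, Φ ⟨x, sphere_subset_closedBall x.2⟩ = φ x

namespace SphereExtension

open Metric unitInterval

/-- The ball is the cone on its sphere: polar coordinates exhibit it as a quotient of `I × S` in
which only radius zero is collapsed, so a nullhomotopy descends to the ball. -/
theorem of_nullhomotopic {V : Type*} [NormedAddCommGroup V] [NormedSpace ℝ V]
    [FiniteDimensional ℝ V] {Y : Type*} [TopologicalSpace Y] [Nonempty Y]
    (h : ∀ φ : C(sphere (0 : V) 1, Y), φ.Nullhomotopic) : SphereExtension V Y := by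
  intro φ
  obtain ⟨y₀, ⟨H⟩⟩ := h φ
  rcases subsingleton_or_nontrivial V with hV | hV
  -- In dimension zero the unit sphere is empty and nothing is prescribed; only a point of `Y` is
  -- needed.
  · refine ⟨ContinuousMap.const _ y₀, fun x => ?_⟩
    have : ‖(x : V)‖ = 1 := by simp
    rw [Subsingleton.elim (x : V) 0] at this
    simp at this
  · let q : I × sphere (0 : V) 1 → closedBall (0 : V) 1 := fun z =>
      ⟨(z.1 : ℝ) • (z.2 : V), by
        have h2 : ‖(z.2 : V)‖ = 1 := by simp
        simp only [mem_closedBall, dist_zero_right, norm_smul, h2, mul_one, Real.norm_eq_abs]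
        exact abs_le.2 ⟨by linarith [z.1.2.1], z.1.2.2⟩⟩
    have hqc : Continuous q := by fun_prop
    have hqn : ∀ z, ‖(q z : V)‖ = z.1 := fun z => by
      have h2 : ‖(z.2 : V)‖ = 1 := by simp
      change ‖(z.1 : ℝ) • (z.2 : V)‖ = _
      rw [norm_smul, h2, mul_one, Real.norm_of_nonneg z.1.2.1]
    obtain ⟨s₀⟩ : Nonempty (sphere (0 : V) 1) := by
      obtain ⟨v, hv⟩ := exists_norm_eq V (c := 1) zero_le_one
      exact ⟨⟨v, by simp [hv]⟩⟩
    have hqs : Function.Surjective q := by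
      rintro ⟨x, hx⟩
      have hx' : ‖x‖ ≤ 1 := by simpa using hx
      by_cases h0 : x = 0
      · exact ⟨(0, s₀), Subtype.ext (by simp [q, h0])⟩
      · have hn : ‖x‖ ≠ 0 := by simpa using h0
        refine ⟨(⟨‖x‖, norm_nonneg _, hx'⟩, ⟨‖x‖⁻¹ • x, by simp [norm_smul, hn]⟩), ?_⟩
        exact Subtype.ext (by simp [q, smul_smul, hn])
    have hq : IsQuotientMap q := hqc.isClosedMap.isQuotientMap hqc hqs
    -- The homotopy starts at `φ`, which belongs on radius one, so its time is reversed.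
    let g : C(I × sphere (0 : V) 1, Y) := ⟨fun z => H (σ z.1, z.2), by fun_prop⟩
    have hg : Function.FactorsThrough g q := by
      intro z z' hzz
      have h1 : z.1 = z'.1 := Subtype.ext (by rw [← hqn z, ← hqn z', hzz])
      by_cases h0 : z.1 = 0
      · have h0' : z'.1 = 0 := h1 ▸ h0
        simp [g, h0, h0']
      · have h0' : (z.1 : ℝ) ≠ 0 := fun h => h0 (Subtype.ext h)
        have h3 := congrArg Subtype.val hzz
        simp only [q, ← h1] at h3
        have h4 : z.2 = z'.2 := Subtype.ext (smul_right_injective V h0' h3)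
        rw [Prod.ext h1 h4]
    refine ⟨hq.lift (f := ⟨q, hqc⟩) g hg, fun x => ?_⟩
    have : (⟨x, sphere_subset_closedBall x.2⟩ : closedBall (0 : V) 1) = q (1, x) :=
      Subtype.ext (by simp [q])
    rw [this]
    have h5 := congrArg (fun k : C(_, Y) => k (1, x)) (hq.lift_comp (f := ⟨q, hqc⟩) g hg)
    simp only [ContinuousMap.comp_apply, ContinuousMap.coe_mk] at h5
    rw [h5]
    simp [g]

theorem of_contractible (V : Type*) [NormedAddCommGroup V] [NormedSpace ℝ V]
    [FiniteDimensional ℝ V] (Y : Type*) [TopologicalSpace Y] [ContractibleSpace Y] :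
    SphereExtension V Y := by
  obtain ⟨y₀, ⟨H⟩⟩ := id_nullhomotopic Y
  have : Nonempty Y := ⟨y₀⟩
  exact of_nullhomotopic fun φ => ⟨y₀, ⟨H.compContinuousMap φ⟩⟩

end SphereExtension

open Metric in
/-- A homeomorphism of a bounded convex set with nonempty interior with the unit ball. -/
theorem exists_homeomorph_closedBall_of_convex {V : Type*} [NormedAddCommGroup V]
    [NormedSpace ℝ V] {W : Type*} [NormedAddCommGroup W] [NormedSpace ℝ W] (L : V ≃L[ℝ] W)
    {s : Set V} (hs : IsClosed s) (hc : Convex ℝ s) (hne : (interior s).Nonempty)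
    (hb : Bornology.IsBounded s) :
    ∃ h : s ≃ₜ closedBall (0 : W) 1, ∀ x, ‖(h x : W)‖ = 1 ↔ (x : V) ∈ frontier s := by
  have hLi : L '' interior s = interior (L '' s) := L.toHomeomorph.image_interior s
  obtain ⟨h, -, h2, h3⟩ := exists_homeomorph_image_interior_closure_frontier_eq_unitBall
    (s := L '' s) (hc.linear_image L.toLinearEquiv.toLinearMap)
    (by rw [← hLi]; exact hne.image _) (L.lipschitz.isBounded_image hb)
  have hcl : closure (L '' s) = L '' s := (L.toHomeomorph.isClosedMap s hs).closure_eq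
  have hfr : frontier (L '' s) = L '' frontier s := (L.toHomeomorph.image_frontier s).symm
  rw [hcl] at h2
  rw [hfr] at h3
  let e : V ≃ₜ W := L.toHomeomorph.trans h
  have he : e '' s = closedBall 0 1 := by rw [← h2, Set.image_image]; rfl
  have he' : e '' frontier s = sphere 0 1 := by rw [← h3, Set.image_image]; rfl
  refine ⟨(e.image s).trans (Homeomorph.setCongr he), fun x => ?_⟩
  have : ‖e x‖ = 1 ↔ e x ∈ sphere (0 : W) 1 := by simp
  change ‖e x‖ = 1 ↔ _
  rw [this, ← he']
  exact e.injective.mem_set_image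

open Metric in
/-- The closed unit balls of normed spaces of the same finite dimension are homeomorphic. -/
theorem exists_homeomorph_closedBall (V : Type*) [NormedAddCommGroup V]
    [NormedSpace ℝ V] [FiniteDimensional ℝ V] (W : Type*) [NormedAddCommGroup W]
    [NormedSpace ℝ W] [FiniteDimensional ℝ W]
    (h : Module.finrank ℝ V = Module.finrank ℝ W) :
    ∃ h : closedBall (0 : V) 1 ≃ₜ closedBall (0 : W) 1,
      ∀ x, ‖(h x : W)‖ = 1 ↔ ‖(x : V)‖ = 1 := by
  obtain ⟨h, hh⟩ := exists_homeomorph_closedBall_of_convex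
    (ContinuousLinearEquiv.ofFinrankEq h) (s := closedBall (0 : V) 1) isClosed_closedBall
    (convex_closedBall _ _) ⟨0, ball_subset_interior_closedBall (mem_ball_self one_pos)⟩
    isBounded_closedBall
  refine ⟨h, fun x => ?_⟩
  rw [hh, frontier_closedBall _ one_ne_zero]
  simp

namespace SphereExtension

open Metric unitInterval

theorem congr {V : Type*} [NormedAddCommGroup V] [NormedSpace ℝ V] [FiniteDimensional ℝ V]
    {W : Type*} [NormedAddCommGroup W] [NormedSpace ℝ W] [FiniteDimensional ℝ W]
    {Y : Type*} [TopologicalSpace Y] (hY : SphereExtension V Y)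
    (h : Module.finrank ℝ V = Module.finrank ℝ W) : SphereExtension W Y := by
  intro φ
  obtain ⟨e, he⟩ := exists_homeomorph_closedBall V W h
  obtain ⟨Φ, hΦ⟩ := hY (φ.comp ⟨fun x : sphere (0 : V) 1 =>
    (⟨e ⟨x, sphere_subset_closedBall x.2⟩, by simp [he]⟩ :
      sphere (0 : W) 1), by fun_prop⟩)
  refine ⟨Φ.comp ⟨e.symm, e.symm.continuous⟩, fun x => ?_⟩
  have hx : ‖(x : W)‖ = 1 := by simp
  have h1 : ‖((e.symm ⟨x, sphere_subset_closedBall x.2⟩ : closedBall (0 : V) 1) : V)‖ = 1 := by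
    rw [← he]; simp
  have h2 := hΦ ⟨(e.symm ⟨x, sphere_subset_closedBall x.2⟩ : closedBall (0 : V) 1), by simp [h1]⟩
  simp only [ContinuousMap.comp_apply, ContinuousMap.coe_mk]
  simpa using h2

/-- The parts of the boundary of `B × [-1, 1]`. -/
theorem exists_extension_prod {V : Type*} [NormedAddCommGroup V]
    {Y : Type*} [TopologicalSpace Y] (hY : SphereExtension (V × ℝ) Y)
    (g : C(sphere (0 : V) 1, C(I, Y))) (a b : C(closedBall (0 : V) 1, Y))
    (ha : ∀ s : sphere (0 : V) 1, g s 0 = a ⟨s, sphere_subset_closedBall s.2⟩)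
    (hb : ∀ s : sphere (0 : V) 1, g s 1 = b ⟨s, sphere_subset_closedBall s.2⟩) :
    ∃ G : C(closedBall (0 : V) 1, C(I, Y)),
      (∀ s : sphere (0 : V) 1, G ⟨s, sphere_subset_closedBall s.2⟩ = g s) ∧
      (∀ y, G y 0 = a y) ∧ ∀ y, G y 1 = b y := by
  let S := sphere (0 : V × ℝ) 1
  -- In the maximum norm of `V × ℝ` the unit ball is the cylinder `B × [-1, 1]`. Its sphere consists
  -- of the side, where `g` is prescribed, and of the bottom and the top, where `a` and `b` are. The
  -- three closed pieces are glued.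
  have hS : ∀ x : S, ‖x.1.1‖ ≤ 1 ∧ |x.1.2| ≤ 1 ∧ (‖x.1.1‖ = 1 ∨ x.1.2 = -1 ∨ x.1.2 = 1) := by
    rintro ⟨⟨x, r⟩, hx⟩
    have h : max ‖x‖ |r| = 1 := mem_sphere_zero_iff_norm.1 hx
    have h1 : ‖x‖ ≤ 1 := h ▸ le_max_left _ _
    have h2 : |r| ≤ 1 := h ▸ le_max_right _ _
    refine ⟨h1, h2, ?_⟩
    rcases max_choice ‖x‖ |r| with h3 | h3
    · left; rw [← h3]; exact h
    · right
      have : |r| = 1 := by rw [← h3]; exact h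
      rcases abs_choice r with h4 | h4
      · right; linarith
      · left; linarith
  let ht : ℝ → I := fun r => Set.projIcc 0 1 zero_le_one ((r + 1) / 2)
  have htc : Continuous ht := continuous_projIcc.comp (by fun_prop)
  have ht0 : ht (-1) = 0 := by simp [ht]
  have ht1 : ht 1 = 1 := by norm_num [ht]
  classical
  let φ : S → Y := fun x =>
    if h : ‖x.1.1‖ = 1 then g ⟨x.1.1, by simpa using h⟩ (ht x.1.2)
    else if x.1.2 = -1 then a ⟨x.1.1, by simpa using (hS x).1⟩
    else b ⟨x.1.1, by simpa using (hS x).1⟩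
  let A : Set S := {x | ‖x.1.1‖ = 1}
  let B : Set S := {x | x.1.2 = -1}
  let C : Set S := {x | x.1.2 = 1}
  have hA : IsClosed A := isClosed_eq (by fun_prop) (by fun_prop)
  have hB : IsClosed B := isClosed_eq (by fun_prop) (by fun_prop)
  have hC : IsClosed C := isClosed_eq (by fun_prop) (by fun_prop)
  have φA : ∀ x (h : x ∈ A), φ x = g ⟨x.1.1, mem_sphere_zero_iff_norm.2 h⟩ (ht x.1.2) := fun x h => dif_pos h
  have φB : ∀ x (_ : x ∈ B), φ x = a ⟨x.1.1, by simpa using (hS x).1⟩ := fun x h => by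
    by_cases h' : x ∈ A
    · have h2 : ht x.1.2 = 0 := (congrArg ht h).trans ht0
      rw [φA x h', h2, ha]
    · exact (dif_neg h').trans (if_pos h)
  have φC : ∀ x (_ : x ∈ C), φ x = b ⟨x.1.1, by simpa using (hS x).1⟩ := fun x h => by
    have h2 : x.1.2 = 1 := h
    by_cases h' : x ∈ A
    · have h3 : ht x.1.2 = 1 := (congrArg ht h2).trans ht1
      rw [φA x h', h3, hb]
    · exact (dif_neg h').trans (if_neg (by rw [h2]; norm_num))
  have cA : ContinuousOn φ A := by
    rw [continuousOn_iff_continuous_domRestrict]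
    have : A.domRestrict φ = fun x : A => g ⟨x.1.1.1, mem_sphere_zero_iff_norm.2 x.2⟩ (ht x.1.1.2) :=
      funext fun x => φA x.1 x.2
    rw [this]
    fun_prop
  have cB : ContinuousOn φ B := by
    rw [continuousOn_iff_continuous_domRestrict]
    have : B.domRestrict φ = fun x : B => a ⟨x.1.1.1, by simpa using (hS x).1⟩ :=
      funext fun x => φB x.1 x.2
    rw [this]
    fun_prop
  have cC : ContinuousOn φ C := by
    rw [continuousOn_iff_continuous_domRestrict]
    have : C.domRestrict φ = fun x : C => b ⟨x.1.1.1, by simpa using (hS x).1⟩ :=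
      funext fun x => φC x.1 x.2
    rw [this]
    fun_prop
  have hφ : Continuous φ := by
    rw [← continuousOn_univ]
    have : (Set.univ : Set S) = A ∪ (B ∪ C) :=
      (Set.eq_univ_of_forall fun x => (hS x).2.2).symm
    rw [this]
    exact cA.union_of_isClosed (cB.union_of_isClosed cC hB hC) hA (hB.union hC)
  obtain ⟨Φ, hΦ⟩ := hY ⟨φ, hφ⟩
  have hin : ∀ (y : closedBall (0 : V) 1) (t : I),
      ((y : V), 2 * (t : ℝ) - 1) ∈ closedBall (0 : V × ℝ) 1 := by
    intro y t
    have h1 : ‖(y : V)‖ ≤ 1 := mem_closedBall_zero_iff.1 y.2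
    have h2 : |2 * (t : ℝ) - 1| ≤ 1 := abs_le.2 ⟨by linarith [t.2.1], by linarith [t.2.2]⟩
    simpa [Prod.norm_def] using ⟨h1, h2⟩
  let F : C(closedBall (0 : V) 1 × I, Y) :=
    ⟨fun z => Φ ⟨(z.1, 2 * (z.2 : ℝ) - 1), hin z.1 z.2⟩, by fun_prop⟩
  have key : ∀ (y : closedBall (0 : V) 1) (t : I)
      (h : ((y : V), 2 * (t : ℝ) - 1) ∈ S), F (y, t) = φ ⟨_, h⟩ := fun y t h => hΦ ⟨_, h⟩
  have hy : ∀ y : closedBall (0 : V) 1, ‖(y : V)‖ ≤ 1 :=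
    fun y => mem_closedBall_zero_iff.1 y.2
  have hmem : ∀ (y : V) (r : ℝ), ‖y‖ ≤ 1 → |r| ≤ 1 → (‖y‖ = 1 ∨ |r| = 1) → (y, r) ∈ S := by
    intro y r h1 h2 h3
    simp only [S, mem_sphere, dist_zero_right, Prod.norm_def, Real.norm_eq_abs]
    rcases h3 with h3 | h3
    · rw [h3]; exact max_eq_left h2
    · rw [h3]; exact max_eq_right h1
  refine ⟨F.curry, fun s => ?_, fun y => ?_, fun y => ?_⟩
  · have hs : ‖(s : V)‖ = 1 := by simp
    ext t
    have h2 : |2 * (t : ℝ) - 1| ≤ 1 := abs_le.2 ⟨by linarith [t.2.1], by linarith [t.2.2]⟩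
    rw [ContinuousMap.curry_apply, key _ _ (hmem _ _ hs.le h2 (Or.inl hs)), φA _ hs]
    congr 1
    simp [ht]
  · rw [ContinuousMap.curry_apply, key _ _ (hmem _ _ (hy y) (by norm_num) (Or.inr (by norm_num))),
      φB _ (show 2 * ((0 : I) : ℝ) - 1 = -1 by simp)]
  · rw [ContinuousMap.curry_apply, key _ _ (hmem _ _ (hy y) (by norm_num) (Or.inr (by norm_num))),
      φC _ (show 2 * ((1 : I) : ℝ) - 1 = 1 by norm_num)]

end SphereExtension

/-! ### Projective and free `M`-sets -/

/-- The free `M`-set on the set `P`. -/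
def FreeMSet (M : Type u) (P : Type v) : Type (max u v) := M × P

instance FreeMSet.mulAction (M : Type u) [Monoid M] (P : Type v) : MulAction M (FreeMSet M P) where
  smul m q := (m * q.1, q.2)
  one_smul q := Prod.ext (one_mul q.1) rfl
  mul_smul m n q := Prod.ext (mul_assoc m n q.1) rfl

/-- A section of the action map from the free `M`-set `M × P` has two components. All later uses of
projectivity go through this pair: `a` carries the action, and `b` picks a representative on which
choices may be made freely. -/
theorem IsProjectiveMSet.exists_section {M : Type u} [Monoid M] {P : Type v} [MulAction M P]
    (hP : IsProjectiveMSet M P) :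
    ∃ (a : P → M) (b : P → P), (∀ p, a p • b p = p) ∧
      ∀ (m : M) p, a (m • p) = m * a p ∧ b (m • p) = b p := by
  let f : FreeMSet M P →[M] P := ⟨fun q => q.1 • q.2, fun m q => mul_smul m q.1 q.2⟩
  obtain ⟨s, hs⟩ := hP (FreeMSet M P) f fun p => ⟨((1 : M), p), one_smul M p⟩
  refine ⟨fun p => (s p).1, fun p => (s p).2, hs, fun m p => ?_⟩
  have h : s (m • p) = m • s p := map_smul s m p
  have h1 := congrArg (fun q : FreeMSet M P => q.1) h
  have h2 := congrArg (fun q : FreeMSet M P => q.2) h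
  exact ⟨h1, h2⟩

theorem IsFreeMSet.isProjectiveMSet {M : Type u} [Monoid M] {P : Type v} [MulAction M P]
    (hP : IsFreeMSet M P) : IsProjectiveMSet M P := by
  obtain ⟨B, hB⟩ := hP
  intro Q _ f hf
  let e := Equiv.ofBijective _ hB
  have he : ∀ (m : M) (q : M × B), e (m * q.1, q.2) = m • e q := fun m q => mul_smul m q.1 _
  have he' : ∀ (m : M) (p : P), e.symm (m • p) = (m * (e.symm p).1, (e.symm p).2) := fun m p => by
    rw [Equiv.symm_apply_eq, he, Equiv.apply_symm_apply]
  choose g hg using fun b : B => hf b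
  refine ⟨⟨fun p => (e.symm p).1 • g (e.symm p).2, fun m p => ?_⟩, fun p => ?_⟩
  · rw [he', mul_smul]; rfl
  · change f ((e.symm p).1 • g (e.symm p).2) = p
    rw [map_smul, hg]
    exact e.apply_symm_apply p

theorem isProjectiveMSet_unit (P : Type v) [MulAction Unit P] : IsProjectiveMSet Unit P :=
  IsFreeMSet.isProjectiveMSet ⟨Set.univ, by
    constructor
    · rintro ⟨_, p⟩ ⟨_, q⟩ h
      have h' : (p : P) = q := by simpa using h
      exact Prod.ext rfl (Subtype.ext h')
    · exact fun p => ⟨((), ⟨p, trivial⟩), one_smul Unit p⟩⟩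

/-! ### Point-set topology of `M`-CW complexes -/

namespace MCWComplex

open Metric Set

variable {M : Type u} [Monoid M] {X : Type v} [TopologicalSpace X] [MulAction M X]
  (C : MCWComplex M X)

theorem skel_mono : Monotone C.skel :=
  monotone_nat_of_le_succ fun n => by rw [C.skel_succ]; exact subset_union_left

theorem char_mem_skel_succ {n : ℕ} (p : C.cell n) (y : Ball n) : C.char n p y ∈ C.skel (n + 1) := by
  rw [C.skel_succ]
  exact Or.inr (mem_iUnion.2 ⟨p, y, rfl⟩)

theorem char_mem_skel {k n : ℕ} (h : k < n) (p : C.cell k) (y : Ball k) :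
    C.char k p y ∈ C.skel n :=
  C.skel_mono h (C.char_mem_skel_succ p y)

theorem isClosed_skel (n : ℕ) : IsClosed (C.skel n) := by
  induction n with
  | zero => rw [C.skel_zero]; exact isClosed_empty
  | succ n ih =>
    rw [C.isClosed_skel_succ n _ Subset.rfl]
    refine ⟨by rwa [inter_eq_right.2 (C.skel_mono n.le_succ)], fun p => ?_⟩
    rw [eq_univ_of_forall (s := C.char n p ⁻¹' _) fun y => C.char_mem_skel_succ p y]
    exact isClosed_univ

theorem exists_mem_skel (x : X) : ∃ n, x ∈ C.skel n :=
  mem_iUnion.1 (C.iUnion_skel ▸ mem_univ x)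

theorem norm_le_one {n : ℕ} (y : Ball n) : ‖y.1‖ ≤ 1 := mem_closedBall_zero_iff.1 y.2

theorem exists_char_of_mem_diff {n : ℕ} {x : X} (h : x ∈ C.skel (n + 1)) (h' : x ∉ C.skel n) :
    ∃ (p : C.cell n) (y : Ball n), ‖y.1‖ < 1 ∧ C.char n p y = x := by
  rw [C.skel_succ] at h
  obtain ⟨p, y, rfl⟩ := mem_iUnion.1 (h.resolve_left h')
  refine ⟨p, y, lt_of_le_of_ne (norm_le_one y) fun hy => h' (C.char_sphere n p y hy), rfl⟩

theorem exists_char (x : X) :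
    ∃ (n : ℕ) (p : C.cell n) (y : Ball n), ‖y.1‖ < 1 ∧ C.char n p y = x := by
  classical
  have h := C.exists_mem_skel x
  obtain ⟨n, hn⟩ : ∃ n, Nat.find h = n + 1 := Nat.exists_eq_succ_of_ne_zero fun h0 => by
    have := Nat.find_spec h
    rw [h0, C.skel_zero] at this
    exact this
  exact ⟨n, C.exists_char_of_mem_diff (hn ▸ Nat.find_spec h) (Nat.find_min h (by omega))⟩

theorem exists_char_of_mem_skel {n : ℕ} {x : X} (hx : x ∈ C.skel n) :
    ∃ k < n, ∃ (p : C.cell k) (y : Ball k), ‖y.1‖ < 1 ∧ C.char k p y = x := by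
  obtain ⟨k, p, y, hy, rfl⟩ := C.exists_char x
  refine ⟨k, ?_, p, y, hy, rfl⟩
  by_contra h
  exact C.char_interior k p y hy (C.skel_mono (not_lt.1 h) hx)

theorem char_eq_char {n k : ℕ} {p : C.cell n} {q : C.cell k} {y : Ball n} {z : Ball k}
    (hy : ‖y.1‖ < 1) (hz : ‖z.1‖ < 1) (h : C.char n p y = C.char k q z) :
    (⟨n, p, y⟩ : Σ n, C.cell n × Ball n) = ⟨k, q, z⟩ := by
  rcases lt_trichotomy n k with hnk | rfl | hnk
  · exact absurd (h ▸ C.char_mem_skel hnk p y) (C.char_interior k q z hz)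
  · obtain ⟨rfl, rfl⟩ := C.char_injective n p q y z hy hz h
    rfl
  · exact absurd (h ▸ C.char_mem_skel hnk q z) (C.char_interior n p y hy)

theorem smul_mem_skel {n : ℕ} (m : M) {x : X} (hx : x ∈ C.skel n) : m • x ∈ C.skel n := by
  obtain ⟨k, hk, p, y, -, rfl⟩ := C.exists_char_of_mem_skel hx
  rw [← C.char_smul]
  exact C.char_mem_skel hk _ _

theorem smul_mem_skel_iff {n : ℕ} (m : M) {x : X} : m • x ∈ C.skel n ↔ x ∈ C.skel n := by
  refine ⟨fun hx => ?_, C.smul_mem_skel m⟩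
  obtain ⟨k, p, y, hy, rfl⟩ := C.exists_char x
  rw [← C.char_smul] at hx
  by_contra h
  exact C.char_interior k (m • p) y hy
    (C.skel_mono (not_lt.1 fun hk => h (C.char_mem_skel hk p y)) hx)

theorem isClosed_of_subset_skel {n : ℕ} {K : Set X} (hK : K ⊆ C.skel n)
    (h : ∀ k < n, ∀ p, IsClosed (C.char k p ⁻¹' K)) : IsClosed K := by
  induction n generalizing K with
  | zero =>
    rw [C.skel_zero, subset_empty_iff] at hK
    rw [hK]; exact isClosed_empty
  | succ n ih =>
    rw [C.isClosed_skel_succ n K hK]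
    refine ⟨ih inter_subset_right fun k hk p => ?_, h n n.lt_succ_self⟩
    rw [preimage_inter, (eq_univ_of_forall fun y => C.char_mem_skel hk p y :
      C.char k p ⁻¹' C.skel n = univ), inter_univ]
    exact h k (hk.trans n.lt_succ_self) p

theorem isClosed_iff_char (K : Set X) : IsClosed K ↔ ∀ n p, IsClosed (C.char n p ⁻¹' K) := by
  refine ⟨fun h n p => h.preimage (C.continuous_char n p), fun h => ?_⟩
  rw [C.isClosed_iff]
  refine fun n => C.isClosed_of_subset_skel inter_subset_right fun k _ p => ?_
  rw [preimage_inter]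
  exact (h k p).inter ((C.isClosed_skel n).preimage (C.continuous_char k p))

theorem continuousOn_skel {Z : Type*} [TopologicalSpace Z] {F : X → Z} {n : ℕ}
    (h : ∀ k < n, ∀ p, Continuous fun y => F (C.char k p y)) : ContinuousOn F (C.skel n) := by
  rw [continuousOn_iff_isClosed]
  intro _ ht
  refine ⟨F ⁻¹' _ ∩ C.skel n, C.isClosed_of_subset_skel inter_subset_right fun k hk p => ?_, by
    rw [inter_assoc, inter_self]⟩
  rw [preimage_inter, (eq_univ_of_forall fun y => C.char_mem_skel hk p y :
    C.char k p ⁻¹' C.skel n = univ), inter_univ]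
  exact ht.preimage (h k hk p)

theorem continuous_of_char {Z : Type*} [TopologicalSpace Z] {F : X → Z}
    (h : ∀ n p, Continuous fun y => F (C.char n p y)) : Continuous F :=
  continuous_iff_isClosed.2 fun _ ht => (C.isClosed_iff_char _).2 fun n p => ht.preimage (h n p)

/-- A set which meets each open cell in at most one point is closed. -/
theorem isClosed_of_subsingleton {T : Set X}
    (h : ∀ n (p : C.cell n) (y z : Ball n), ‖y.1‖ < 1 → ‖z.1‖ < 1 → C.char n p y ∈ T →
      C.char n p z ∈ T → y = z) : IsClosed T := by
  rw [C.isClosed_iff]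
  intro n
  induction n with
  | zero => rw [C.skel_zero, inter_empty]; exact isClosed_empty
  | succ n ih =>
    rw [C.isClosed_skel_succ n _ inter_subset_right]
    refine ⟨by rwa [inter_assoc, inter_eq_right.2 (C.skel_mono n.le_succ)], fun p => ?_⟩
    have h1 : C.char n p ⁻¹' (T ∩ C.skel (n + 1)) =
        C.char n p ⁻¹' (T ∩ C.skel n) ∪ {y | ‖y.1‖ < 1 ∧ C.char n p y ∈ T} := by
      ext y
      simp only [mem_preimage, mem_inter_iff, C.char_mem_skel_succ, and_true, mem_union,
        mem_ofPred_eq]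
      refine ⟨fun hy => ?_, fun hy => hy.elim (fun h => h.1) fun h => h.2⟩
      by_cases h1 : ‖y.1‖ < 1
      · exact Or.inr ⟨h1, hy⟩
      · exact Or.inl ⟨hy, C.char_sphere n p y (le_antisymm (norm_le_one y) (not_lt.1 h1))⟩
    rw [h1]
    refine (ih.preimage (C.continuous_char n p)).union (Set.Subsingleton.isClosed ?_)
    exact fun y hy z hz => h n p y z hy.1 hz.1 hy.2 hz.2

include C in
theorem t1Space : T1Space X :=
  ⟨fun _ => C.isClosed_of_subsingleton fun n p y z hy hz h h' =>
    (C.char_injective n p p y z hy hz (h.trans h'.symm)).2⟩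

/-- A compact set meets only finitely many open cells. -/
theorem finite_openCells_of_isCompact {K : Set X} (hK : IsCompact K) :
    {c : Σ n, C.cell n | ∃ y : Ball c.1, ‖y.1‖ < 1 ∧ C.char c.1 c.2 y ∈ K}.Finite := by
  set D := {c : Σ n, C.cell n | ∃ y : Ball c.1, ‖y.1‖ < 1 ∧ C.char c.1 c.2 y ∈ K} with hD
  choose y hy hyK using fun c : D => c.2
  let x : D → X := fun c => C.char c.1.1 c.1.2 (y c)
  have hinj : Function.Injective x := by
    rintro c c' h
    have := C.char_eq_char (hy c) (hy c') h
    apply Subtype.ext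
    exact congrArg (fun q : Σ n, C.cell n × Ball n => (⟨q.1, q.2.1⟩ : Σ n, C.cell n)) this
  -- With one point chosen in each open cell that meets `K`, every set of chosen points is closed.
  -- The set of all of them is therefore discrete and compact, hence finite.
  have hcl : ∀ T ⊆ range x, IsClosed T := fun T hT => by
    refine C.isClosed_of_subsingleton fun n p a b ha hb haT hbT => ?_
    obtain ⟨c, hc⟩ := hT haT
    obtain ⟨c', hc'⟩ := hT hbT
    have h1 := C.char_eq_char (hy c) ha hc
    have h2 := C.char_eq_char (hy c') hb hc'
    have h3 : c = c' := Subtype.ext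
      (congrArg (fun q : Σ n, C.cell n × Ball n => (⟨q.1, q.2.1⟩ : Σ n, C.cell n))
        h1 |>.trans (congrArg (fun q : Σ n, C.cell n × Ball n =>
          (⟨q.1, q.2.1⟩ : Σ n, C.cell n)) h2).symm)
    subst h3
    exact (C.char_injective n p p a b ha hb (hc.symm.trans hc')).2
  have hcomp : IsCompact (range x) :=
    hK.of_isClosed_subset (hcl _ Subset.rfl) (by rintro _ ⟨c, rfl⟩; exact hyK c)
  have hdisc : DiscreteTopology (range x) := by
    refine discreteTopology_iff_forall_isClosed.2 fun s => ?_
    have := (hcl (Subtype.val '' s) (by rintro _ ⟨z, -, rfl⟩; exact z.2)).preimage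
      (continuous_subtype_val (p := fun z => z ∈ range x))
    rwa [preimage_image_eq _ Subtype.val_injective] at this
  have hfin : (range x).Finite := hcomp.finite (isDiscrete_iff_discreteTopology.2 hdisc)
  have : Finite D := Set.finite_univ_iff.1 <|
    Set.Finite.of_finite_image (f := x) (by rwa [image_univ]) hinj.injOn
  exact Set.toFinite D

theorem exists_subset_skel_of_isCompact {K : Set X} (hK : IsCompact K) : ∃ n, K ⊆ C.skel n := by
  have hfin := C.finite_openCells_of_isCompact hK
  obtain ⟨N, hN⟩ := (hfin.image Sigma.fst).bddAbove
  refine ⟨N + 1, fun x hx => ?_⟩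
  obtain ⟨n, p, y, hy, rfl⟩ := C.exists_char x
  exact C.char_mem_skel (Nat.lt_succ_of_le (hN ⟨⟨n, p⟩, ⟨y, hy, hx⟩, rfl⟩)) _ _

/-! ### Cellwise construction of equivariant maps -/

/-- The hypothesis on the cells in the cellwise construction of maps subject to a relation. -/
def CellExtension {Z : Type*} [TopologicalSpace Z] (R : X → Z → Prop) : Prop :=
  ∀ (n : ℕ) (p : C.cell n) (g : C(sphere (0 : EuclideanSpace ℝ (Fin n)) 1, Z)),
    (∀ s : sphere (0 : EuclideanSpace ℝ (Fin n)) 1,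
      R (C.char n p ⟨s, sphere_subset_closedBall s.2⟩) (g s)) →
    ∃ G : C(Ball n, Z), (∀ s : sphere (0 : EuclideanSpace ℝ (Fin n)) 1,
      G ⟨s, sphere_subset_closedBall s.2⟩ = g s) ∧ ∀ y, R (C.char n p y) (G y)

section Extension

variable {Z : Type*} [TopologicalSpace Z] [MulAction M Z] [ContinuousConstSMul M Z]
  {R : X → Z → Prop}

/-- Partial maps, defined on a skeleton, of the cellwise construction. -/
def IsPartialMap (R : X → Z → Prop) (n : ℕ) (F : X → Z) : Prop :=
  (∀ k < n, ∀ p, Continuous fun y => F (C.char k p y)) ∧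
    ∀ x ∈ C.skel n, R x (F x) ∧ ∀ m : M, F (m • x) = m • F x

/-- The extension is chosen on the balls of the cells `b p` only and then transported by `a p`.
Equivariance holds because `a` is equivariant and `b` is invariant. -/
theorem IsPartialMap.exists_succ (hC : C.IsProjective) (hR : ∀ (m : M) x z, R x z → R (m • x) (m • z))
    (hext : C.CellExtension R) {n : ℕ} {F : X → Z} (hF : C.IsPartialMap R n F) :
    ∃ F' : X → Z, C.IsPartialMap R (n + 1) F' ∧ EqOn F' F (C.skel n) := by
  classical
  obtain ⟨a, b, hab, hmab⟩ := (hC n).exists_section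
  have hFc := C.continuousOn_skel hF.1
  have hsph : ∀ (p : C.cell n) (s : sphere (0 : EuclideanSpace ℝ (Fin n)) 1),
      C.char n p ⟨s, sphere_subset_closedBall s.2⟩ ∈ C.skel n := fun p s =>
    C.char_sphere n p _ (mem_sphere_zero_iff_norm.1 s.2)
  choose G hG hGR using fun p : C.cell n => hext n p
    ⟨fun s => F (C.char n p ⟨s, sphere_subset_closedBall s.2⟩),
      hFc.comp_continuous ((C.continuous_char n p).comp (by fun_prop)) (hsph p)⟩
    fun s => (hF.2 _ (hsph p s)).1
  let F' : X → Z := fun x =>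
    if x ∈ C.skel n then F x
    else if h : ∃ (p : C.cell n) (y : Ball n), ‖y.1‖ < 1 ∧ C.char n p y = x then
      a h.choose • G (b h.choose) h.choose_spec.choose
    else F x
  have hF'1 : EqOn F' F (C.skel n) := fun x hx => if_pos hx
  -- For interior points this is the definition. On the sphere it is the compatibility of the new
  -- values with `F`: translating `F` on the cell `b p` by `a p` gives `F` on the cell `a p • b p =
  -- p`.
  have hF'2 : ∀ p y, F' (C.char n p y) = a p • G (b p) y := by
    intro p y
    by_cases hy : ‖y.1‖ < 1
    · have h : ∃ (p' : C.cell n) (y' : Ball n), ‖y'.1‖ < 1 ∧ C.char n p' y' = C.char n p y :=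
        ⟨p, y, hy, rfl⟩
      have h0 : F' (C.char n p y) = a h.choose • G (b h.choose) h.choose_spec.choose := by
        simp only [F']
        rw [if_neg (C.char_interior n p y hy), dif_pos h]
      obtain ⟨h1, h2⟩ := C.char_injective n _ _ _ _ h.choose_spec.choose_spec.1 hy
        h.choose_spec.choose_spec.2
      rw [h0, h2, h1]
    · have hy' : ‖y.1‖ = 1 := le_antisymm (norm_le_one y) (not_lt.1 hy)
      have h1 := hG (b p) ⟨y, mem_sphere_zero_iff_norm.2 hy'⟩
      rw [hF'1 (C.char_sphere n p y hy')]
      simp only [ContinuousMap.coe_mk] at h1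
      rw [Subtype.coe_eta] at h1
      rw [h1, ← (hF.2 _ (C.char_sphere n (b p) y hy')).2, ← C.char_smul, hab]
  refine ⟨F', ⟨fun k hk p => ?_, fun x hx => ?_⟩, hF'1⟩
  · rcases Nat.lt_succ_iff_lt_or_eq.1 hk with hk | rfl
    · refine (hF.1 k hk p).congr fun y => ?_
      rw [hF'1 (C.char_mem_skel hk p y)]
    · simp_rw [hF'2]
      exact ((G (b p)).continuous).const_smul (a p)
  · by_cases hx' : x ∈ C.skel n
    · rw [hF'1 hx']
      refine ⟨(hF.2 x hx').1, fun m => ?_⟩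
      rw [hF'1 (C.smul_mem_skel m hx'), (hF.2 x hx').2]
    · obtain ⟨p, y, hy, rfl⟩ := C.exists_char_of_mem_diff hx hx'
      refine ⟨?_, fun m => ?_⟩
      · have := hR (a p) _ _ (hGR (b p) y)
        rwa [← C.char_smul, hab, ← hF'2] at this
      · rw [← C.char_smul, hF'2, hF'2, (hmab m p).1, (hmab m p).2, mul_smul]

/-- The cellwise construction of an equivariant map subject to an invariant relation. -/
theorem exists_continuousMap_of_cellExtension [Nonempty Z] (hC : C.IsProjective)
    (hR : ∀ (m : M) x z, R x z → R (m • x) (m • z)) (hext : C.CellExtension R) :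
    ∃ F : C(X, Z), IsEquivariant M F ∧ ∀ x, R x (F x) := by
  classical
  have h0 : C.IsPartialMap R 0 fun _ => Classical.arbitrary Z :=
    ⟨fun k hk => absurd hk k.not_lt_zero, fun x hx => by rw [C.skel_zero] at hx; exact hx.elim⟩
  choose next hnext hnext' using fun (n : ℕ) (F : {F : X → Z // C.IsPartialMap R n F}) =>
    IsPartialMap.exists_succ C hC hR hext F.2
  let S : ∀ n, {F : X → Z // C.IsPartialMap R n F} := fun n =>
    Nat.rec ⟨_, h0⟩ (fun n F => ⟨next n F, hnext n F⟩) n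
  have hS : ∀ n, EqOn (S (n + 1)).1 (S n).1 (C.skel n) := fun n => hnext' n (S n)
  have hS' : ∀ n k, n ≤ k → EqOn (S k).1 (S n).1 (C.skel n) := by
    intro n k hnk
    induction k, hnk using Nat.le_induction with
    | base => exact fun x _ => rfl
    | succ k hk ih => exact ((hS k).mono (C.skel_mono hk)).trans ih
  -- The limit map is read off at the first skeleton containing the point; later stages do not
  -- change the value there.
  let N : X → ℕ := fun x => Nat.find (C.exists_mem_skel x)
  have hN : ∀ x, x ∈ C.skel (N x) := fun x => Nat.find_spec (C.exists_mem_skel x)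
  let F : X → Z := fun x => (S (N x)).1 x
  have hF : ∀ n, EqOn F (S n).1 (C.skel n) := fun n x hx =>
    (hS' (N x) n (Nat.find_min' _ hx) (hN x)).symm
  refine ⟨⟨F, C.continuous_of_char fun n p => ?_⟩, fun m x => ?_, fun x => ?_⟩
  · exact ((S (n + 1)).2.1 n n.lt_succ_self p).congr fun y =>
      (hF (n + 1) (C.char_mem_skel_succ p y)).symm
  · change F (m • x) = m • F x
    rw [hF (N x) (hN x), hF (N x) (C.smul_mem_skel m (hN x)), ((S (N x)).2.2 x (hN x)).2]
  · exact ((S (N x)).2.2 x (hN x)).1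

end Extension

/-! ### Constructions that forget the action -/

/-- The trivial action of the trivial monoid. -/
abbrev _root_.unitAction (X : Type*) : MulAction Unit X where
  smul _ x := x
  one_smul _ := rfl
  mul_smul _ _ _ := rfl

/-- An `M`-CW complex without its action. -/
def forget : @MCWComplex Unit _ X _ (unitAction X) :=
  letI := unitAction X
  { cell := C.cell
    cellAction := fun n => unitAction (C.cell n)
    skel := C.skel
    char := C.char
    continuous_char := C.continuous_char
    char_smul := fun _ _ _ _ => rfl
    skel_zero := C.skel_zero
    skel_succ := C.skel_succ
    char_sphere := C.char_sphere
    char_interior := C.char_interior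
    char_injective := C.char_injective
    isClosed_skel_succ := C.isClosed_skel_succ
    iUnion_skel := C.iUnion_skel
    isClosed_iff := C.isClosed_iff }

/-- The cellwise construction of maps without an action. -/
theorem exists_continuousMap_of_cellExtension' {Z : Type*} [TopologicalSpace Z] [Nonempty Z]
    {R : X → Z → Prop} (hext : C.CellExtension R) : ∃ F : C(X, Z), ∀ x, R x (F x) := by
  let _ := unitAction X
  let _ := unitAction Z
  have : ContinuousConstSMul Unit Z := ⟨fun _ => continuous_id⟩
  obtain ⟨F, -, hF⟩ := C.forget.exists_continuousMap_of_cellExtension (R := R)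
    (fun n => @isProjectiveMSet_unit _ (C.forget.cellAction n)) (fun _ _ _ h => h) hext
  exact ⟨F, hF⟩

-- Two distinct points are separated by a real function built with the cellwise construction. On
-- each ball the values on the sphere and over the two points are prescribed on a closed set,
-- because points are closed in `X`, and the Tietze theorem extends them.
include C in
theorem t2Space : T2Space X := by
  have := C.t1Space
  refine ⟨fun x₀ x₁ hne => ?_⟩
  obtain ⟨F, hF⟩ := C.exists_continuousMap_of_cellExtension' (Z := ℝ)
    (R := fun x z => (x = x₀ → z = 0) ∧ (x = x₁ → z = 1)) <| by
    classical
    intro n p g hg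
    let S : Set (Ball n) := {y | ‖y.1‖ = 1}
    let A : Set (Ball n) := C.char n p ⁻¹' {x₀}
    let B : Set (Ball n) := C.char n p ⁻¹' {x₁}
    have hS : IsClosed S := isClosed_eq (by fun_prop) (by fun_prop)
    have hA : IsClosed A := isClosed_singleton.preimage (C.continuous_char n p)
    have hB : IsClosed B := isClosed_singleton.preimage (C.continuous_char n p)
    let f : Ball n → ℝ := fun y =>
      if h : ‖y.1‖ = 1 then g ⟨y.1, mem_sphere_zero_iff_norm.2 h⟩
      else if C.char n p y = x₀ then 0 else 1
    have fS : ∀ y (h : y ∈ S), f y = g ⟨y.1, mem_sphere_zero_iff_norm.2 h⟩ := fun y h => dif_pos h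
    have fA : ∀ y ∈ A, f y = 0 := fun y hy => by
      by_cases h : y ∈ S
      · rw [fS y h]; exact (hg ⟨y.1, mem_sphere_zero_iff_norm.2 h⟩).1 hy
      · exact (dif_neg h).trans (if_pos hy)
    have fB : ∀ y ∈ B, f y = 1 := fun y hy => by
      by_cases h : y ∈ S
      · rw [fS y h]; exact (hg ⟨y.1, mem_sphere_zero_iff_norm.2 h⟩).2 hy
      · exact (dif_neg h).trans (if_neg fun h' => hne (h'.symm.trans hy))
    have cS : ContinuousOn f S := by
      rw [continuousOn_iff_continuous_domRestrict]
      have : S.domRestrict f = fun y : S => g ⟨y.1.1, mem_sphere_zero_iff_norm.2 y.2⟩ :=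
        funext fun y => fS y.1 y.2
      rw [this]
      fun_prop
    have cA : ContinuousOn f A := continuousOn_const.congr fA
    have cB : ContinuousOn f B := continuousOn_const.congr fB
    have cU : ContinuousOn f (S ∪ (A ∪ B)) :=
      cS.union_of_isClosed (cA.union_of_isClosed cB hA hB) hS (hA.union hB)
    obtain ⟨G, hG⟩ := ContinuousMap.exists_restrict_eq (hS.union (hA.union hB))
      ⟨_, continuousOn_iff_continuous_domRestrict.1 cU⟩
    have hG' : ∀ y ∈ S ∪ (A ∪ B), G y = f y := fun y hy =>
      congrArg (fun k : C(_, ℝ) => k ⟨y, hy⟩) hG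
    refine ⟨G, fun s => ?_, fun y => ⟨fun h => ?_, fun h => ?_⟩⟩
    · have : (⟨s, sphere_subset_closedBall s.2⟩ : Ball n) ∈ S := mem_sphere_zero_iff_norm.1 s.2
      rw [hG' _ (Or.inl this), fS _ this]
    · rw [hG' _ (Or.inr (Or.inl h)), fA _ h]
    · rw [hG' _ (Or.inr (Or.inr h)), fB _ h]
  have h : F x₀ ≠ F x₁ := by
    rw [(hF x₀).1 rfl, (hF x₁).2 rfl]
    exact zero_ne_one
  exact separated_by_continuous F.continuous h

end MCWComplex

/-! ### Cellular approximation for maps of balls -/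

open Metric in
/-- The radial retraction of a normed space onto its closed unit ball. -/
noncomputable def ballRetraction {V : Type*} [NormedAddCommGroup V] [NormedSpace ℝ V] :
    C(V, closedBall (0 : V) 1) where
  toFun y := ⟨(max 1 ‖y‖)⁻¹ • y, by
    have h : 0 < max 1 ‖y‖ := lt_max_of_lt_left one_pos
    rw [mem_closedBall_zero_iff, norm_smul, norm_inv, Real.norm_of_nonneg h.le,
      inv_mul_le_one₀ h]
    exact le_max_right _ _⟩
  continuous_toFun := by
    refine Continuous.subtype_mk (Continuous.smul (Continuous.inv₀ (by fun_prop) fun y => ?_)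
      continuous_id) _
    exact (lt_max_of_lt_left one_pos).ne'

theorem ballRetraction_of_norm_le {V : Type*} [NormedAddCommGroup V] [NormedSpace ℝ V] {y : V}
    (h : ‖y‖ ≤ 1) : (ballRetraction y : V) = y := by
  simp [ballRetraction, max_eq_left h]

theorem norm_ballRetraction {V : Type*} [NormedAddCommGroup V] [NormedSpace ℝ V] {y : V}
    (h : 1 ≤ ‖y‖) : ‖(ballRetraction y : V)‖ = 1 := by
  have : ‖y‖ ≠ 0 := by linarith
  simp [ballRetraction, max_eq_right h, norm_smul, this]

open Metric in
/-- A self-map of the unit ball which fixes the sphere and maps everything but a small ball to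
the sphere. -/
theorem exists_expansion {V : Type*} [NormedAddCommGroup V] [NormedSpace ℝ V] {q : V} {ε : ℝ}
    (hq : ‖q‖ < 3 / 8) (hε : 0 < ε) :
    ∃ r : C(closedBall (0 : V) 1, closedBall (0 : V) 1), (∀ y, ‖y.1‖ = 1 → r y = y) ∧
      ∀ y, ε ≤ ‖y.1 - q‖ → ‖(r y).1‖ = 1 := by
  -- A point `y` is pushed away from `q` by `N * (1 - ‖y‖)` times `y - q`, then retracted radially.
  -- Where `‖y‖ ≥ 1 / 2`, one has `‖y‖ - ‖q‖ > 1 / 8`, and `8 ≤ N` makes the norm at least one.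
  -- Where `‖y‖ ≤ 1 / 2`, the displacement is at least `N * ε / 2 ≥ 2`, which suffices.
  obtain ⟨N, hN8, hNε⟩ : ∃ N : ℝ, 8 ≤ N ∧ 4 ≤ N * ε :=
    ⟨max 8 (4 / ε), le_max_left _ _, by
      rw [← div_le_iff₀ hε]; exact le_max_right _ _⟩
  refine ⟨⟨fun y => ballRetraction (y.1 + (N * (1 - ‖y.1‖)) • (y.1 - q)), by fun_prop⟩,
    fun y hy => ?_, fun y hy => ?_⟩
  · apply Subtype.ext
    simp only [ContinuousMap.coe_mk, hy, sub_self, mul_zero, zero_smul, add_zero]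
    exact ballRetraction_of_norm_le hy.le
  · apply norm_ballRetraction
    have hy1 : ‖y.1‖ ≤ 1 := mem_closedBall_zero_iff.1 y.2
    set δ := 1 - ‖y.1‖ with hδ
    have hδ0 : 0 ≤ δ := by linarith
    have hNδ : 0 ≤ N * δ := by positivity
    rcases le_total (1 / 2) ‖y.1‖ with h | h
    · have h1 : y.1 + (N * δ) • (y.1 - q) = (1 + N * δ) • y.1 - (N * δ) • q := by
        rw [smul_sub, add_smul, one_smul]; abel
      have h2 := norm_sub_norm_le ((1 + N * δ) • y.1) ((N * δ) • q)
      rw [norm_smul, norm_smul, Real.norm_of_nonneg hNδ, Real.norm_of_nonneg (by linarith)] at h2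
      rw [h1]
      have h3 : 8 * δ ≤ N * δ := mul_le_mul_of_nonneg_right hN8 hδ0
      have h4 : N * δ * (1 / 8) ≤ N * δ * (‖y.1‖ - ‖q‖) :=
        mul_le_mul_of_nonneg_left (by linarith) hNδ
      nlinarith
    · have h2 := norm_sub_norm_le ((N * δ) • (y.1 - q)) (-y.1)
      rw [norm_smul, Real.norm_of_nonneg hNδ, norm_neg, sub_neg_eq_add, add_comm _ y.1] at h2
      have h3 : N * (1 / 2) * ε ≤ N * δ * ‖y.1 - q‖ :=
        mul_le_mul (mul_le_mul_of_nonneg_left (by linarith) (by linarith)) hy hε.le hNδ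
      linarith

open Metric in
/-- Continuous maps between Euclidean spaces can be approximated on compact sets by smooth maps. -/
theorem exists_contDiff_approx {V W : Type*} [NormedAddCommGroup V] [NormedSpace ℝ V]
    [FiniteDimensional ℝ V] [NormedAddCommGroup W] [NormedSpace ℝ W] [FiniteDimensional ℝ W]
    (f : C(V, W)) {K : Set V} (hK : IsCompact K) {ε : ℝ} (hε : 0 < ε) :
    ∃ s : C(V, W), ContDiff ℝ 1 s ∧ ∀ x ∈ K, dist (f x) (s x) < ε := by
  have h := ContinuousMap.dense_setOfPred_contDiff (E := V) (F := W) f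
  rw [mem_closure_iff_nhds_basis (nhds_basis_uniformity
    Metric.uniformity_basis_dist.compactConvergenceUniformity)] at h
  obtain ⟨s, hs, hs'⟩ := h (K, ε) ⟨hK, hε⟩
  exact ⟨s, ContDiff.of_le (n := ((⊤ : ℕ∞) : WithTop ℕ∞)) hs (by exact_mod_cast le_top), fun x hx => by rw [dist_comm]; exact hs' x hx⟩

namespace MCWComplex

open Metric Set

variable {M : Type u} [Monoid M] {Y : Type v} [TopologicalSpace Y] [MulAction M Y]
  (D : MCWComplex M Y)

theorem char_eq_char_iff {n : ℕ} {p q : D.cell n} {y z : Ball n} (hy : ‖y.1‖ < 1) :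
    D.char n p y = D.char n q z ↔ p = q ∧ y = z := by
  refine ⟨fun h => D.char_injective n p q y z hy ?_ h, by rintro ⟨rfl, rfl⟩; rfl⟩
  refine lt_of_le_of_ne (norm_le_one z) fun hz => ?_
  exact D.char_interior n p y hy (h ▸ D.char_sphere n q z hz)

/-- The union of the images of a set of interior points under all characteristic maps. -/
theorem preimage_char_iUnion {n : ℕ} {W : D.cell n → Set (Ball n)} (hW : ∀ p, ∀ y ∈ W p, ‖y.1‖ < 1)
    (p : D.cell n) : D.char n p ⁻¹' (⋃ q, D.char n q '' W q) = W p := by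
  ext y
  simp only [mem_preimage, mem_iUnion, mem_image]
  refine ⟨?_, fun h => ⟨p, y, h, rfl⟩⟩
  rintro ⟨q, z, hz, h⟩
  obtain ⟨rfl, rfl⟩ := (D.char_eq_char_iff (hW q z hz)).1 h
  exact hz

theorem isClosed_iUnion_image {n : ℕ} {W : D.cell n → Set (Ball n)}
    (hW : ∀ p, ∀ y ∈ W p, ‖y.1‖ < 1) (hc : ∀ p, IsClosed (W p)) :
    IsClosed (⋃ q, D.char n q '' W q) := by
  rw [D.isClosed_skel_succ n]
  · refine ⟨?_, fun p => by rw [D.preimage_char_iUnion hW]; exact hc p⟩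
    convert isClosed_empty
    refine eq_empty_of_forall_notMem ?_
    rintro x ⟨hx, hx'⟩
    obtain ⟨q, y, hy, rfl⟩ := mem_iUnion.1 hx
    exact D.char_interior n q y (hW q y hy) hx'
  · refine iUnion_subset fun q => ?_
    rintro _ ⟨y, -, rfl⟩
    exact D.char_mem_skel_succ q y

theorem isClosed_skel_diff {n : ℕ} {W : D.cell n → Set (Ball n)}
    (hW : ∀ p, ∀ y ∈ W p, ‖y.1‖ < 1) (hc : ∀ p, IsOpen (W p)) :
    IsClosed (D.skel (n + 1) \ ⋃ q, D.char n q '' W q) := by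
  rw [D.isClosed_skel_succ n _ sdiff_subset]
  refine ⟨?_, fun p => ?_⟩
  · convert D.isClosed_skel n using 1
    refine Subset.antisymm inter_subset_right fun x hx => ⟨⟨D.skel_mono n.le_succ hx, ?_⟩, hx⟩
    intro hx'
    obtain ⟨q, y, hy, rfl⟩ := mem_iUnion.1 hx'
    exact D.char_interior n q y (hW q y hy) hx
  · rw [preimage_sdiff, D.preimage_char_iUnion hW, (eq_univ_of_forall fun y =>
      D.char_mem_skel_succ p y : D.char n p ⁻¹' D.skel (n + 1) = univ), ← compl_eq_univ_sdiff]
    exact (hc p).isClosed_compl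

/-- A characteristic map is an embedding on compact subsets of the open ball. -/
theorem isClosedEmbedding_char {n : ℕ} (p : D.cell n) {T : Set (Ball n)} (hT : IsClosed T)
    (hT1 : ∀ y ∈ T, ‖y.1‖ < 1) : IsClosedEmbedding fun y : T => D.char n p y := by
  have := D.t2Space
  have : CompactSpace T := isCompact_iff_compactSpace.1 hT.isCompact
  refine ((D.continuous_char n p).comp continuous_subtype_val).isClosedEmbedding ?_
  intro y z h
  exact Subtype.ext ((D.char_eq_char_iff (hT1 y.1 y.2)).1 h).2

/-- A map from a ball into a skeleton of larger dimension can be pushed off the top cells. -/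
theorem exists_pushOff {n k : ℕ} (hnk : n < k) (f : C(Ball n, Y)) (hf : ∀ x, f x ∈ D.skel (k + 1)) :
    ∃ f' : C(Ball n, Y), (∀ x, f' x ∈ D.skel k) ∧ ∀ x, f x ∈ D.skel k → f' x = f x := by
  classical
  have := D.t2Space
  let B : ℝ → Set (Ball k) := fun r => {y | ‖y.1‖ ≤ r}
  have hB : ∀ r, IsClosed (B r) := fun r => isClosed_le (by fun_prop) (by fun_prop)
  have hB1 : ∀ {r : ℝ}, r < 1 → ∀ y ∈ B r, ‖y.1‖ < 1 := fun hr y hy => lt_of_le_of_lt hy hr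
  -- On `T p` the map has the coordinate `h p` in the cell `p`, of norm at most `3 / 4`. Inside it
  -- the modification has three zones: up to norm `1 / 2` the coordinate is replaced by a smooth
  -- approximation, between `1 / 2` and `5 / 8` the two are interpolated, and beyond `5 / 8` nothing
  -- changes.
  let T : D.cell k → Set (Ball n) := fun p => {x | ∃ y ∈ B (3 / 4), D.char k p y = f x}
  have hTc : ∀ p, IsClosed (T p) := fun p => by
    have h1 := ((hB (3 / 4)).isCompact.image (D.continuous_char k p)).isClosed.preimage f.continuous
    exact h1
  choose h hhB hh using fun (p : D.cell k) (x : T p) => x.2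
  have hhc : ∀ p, Continuous (h p) := fun p => by
    have h1 := (D.isClosedEmbedding_char p (hB (3 / 4)) (hB1 (by norm_num))).isInducing
    have h2 : Continuous fun x : T p => (⟨h p x, hhB p x⟩ : B (3 / 4)) := by
      rw [h1.continuous_iff]
      exact (f.continuous.comp continuous_subtype_val).congr fun x => (hh p x).symm
    exact continuous_subtype_val.comp h2
  have hs : ∀ p, ∃ s : C(EuclideanSpace ℝ (Fin n), EuclideanSpace ℝ (Fin k)),
      ContDiff ℝ 1 s ∧ ∀ x : T p, dist (h p x).1 (s x.1.1) < 1 / 8 := fun p => by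
    have he : IsClosedEmbedding fun x : T p => (x.1.1 : EuclideanSpace ℝ (Fin n)) :=
      isClosed_closedBall.isClosedEmbedding_subtypeVal.comp (hTc p).isClosedEmbedding_subtypeVal
    obtain ⟨g, hg⟩ := ContinuousMap.exists_extension he
      ⟨fun x : T p => (h p x).1, continuous_subtype_val.comp (hhc p)⟩
    obtain ⟨s, hs1, hs2⟩ := exists_contDiff_approx g
      (isCompact_closedBall (0 : EuclideanSpace ℝ (Fin n)) 1) (ε := 1 / 8) (by norm_num)
    refine ⟨s, hs1, fun x => ?_⟩
    have h1 := congrArg (fun φ : C(T p, _) => φ x) hg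
    simp only [ContinuousMap.comp_apply, ContinuousMap.coe_mk] at h1
    rw [← h1]
    exact hs2 _ x.1.2
  choose s hsd hsh using hs
  -- a small ball missed by `s p`
  have hq : ∀ p, ∃ (q : EuclideanSpace ℝ (Fin k)) (ε : ℝ), ‖q‖ < 3 / 8 ∧ 0 < ε ∧
      ε ≤ 3 / 8 - ‖q‖ ∧ ∀ x : Ball n, ε ≤ ‖s p x.1 - q‖ := fun p => by
    -- This is where the dimensions enter: a continuously differentiable map from the smaller
    -- dimension `n` has a range with dense complement in dimension `k`.
    have hd := (hsd p).dense_compl_range_of_finrank_lt_finrank (by simpa using hnk)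
    obtain ⟨q, hq, hq'⟩ := hd.exists_mem_open (U := ball 0 (3 / 8)) isOpen_ball
      ⟨0, mem_ball_self (by norm_num)⟩
    rw [mem_ball_zero_iff] at hq'
    have hcl : IsClosed (s p '' closedBall (0 : EuclideanSpace ℝ (Fin n)) 1) :=
      ((isCompact_closedBall _ _).image (s p).continuous).isClosed
    have hqc : q ∈ (s p '' closedBall (0 : EuclideanSpace ℝ (Fin n)) 1)ᶜ := fun h =>
      hq (image_subset_range _ _ h)
    obtain ⟨δ, hδ, hδ'⟩ := Metric.isOpen_iff.1 hcl.isOpen_compl q hqc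
    refine ⟨q, min δ (3 / 8 - ‖q‖), hq', lt_min hδ (by linarith), min_le_right _ _, fun x => ?_⟩
    refine (min_le_left _ _).trans (not_lt.1 fun h => ?_)
    exact hδ' (mem_ball_iff_norm.2 h) ⟨x.1, x.2, rfl⟩
  choose q ε hq hε0 hε hsq using hq
  choose r hr1 hr2 using fun p => exists_expansion (hq p) (hε0 p)
  -- the modification of `f` on the cells
  let ρ : ℝ → ℝ := fun t => max 0 (min 1 (5 - 8 * t))
  have hρc : Continuous ρ := by fun_prop
  have hρ0 : ∀ t, 0 ≤ ρ t := fun t => le_max_left _ _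
  have hρ1 : ∀ t, ρ t ≤ 1 := fun t => max_le zero_le_one (min_le_left _ _)
  have hρ2 : ∀ t, t ≤ 1 / 2 → ρ t = 1 := fun t ht => by
    simp only [ρ]; rw [min_eq_left (by linarith), max_eq_right zero_le_one]
  have hρ3 : ∀ t, 5 / 8 ≤ t → ρ t = 0 := fun t ht => by
    simp only [ρ]; exact max_eq_left ((min_le_right _ _).trans (by linarith))
  let w : ∀ p, T p → EuclideanSpace ℝ (Fin k) := fun p x =>
    (h p x).1 + ρ ‖(h p x).1‖ • (s p x.1.1 - (h p x).1)
  have hwc : ∀ p, Continuous (w p) := fun p => by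
    have := hhc p
    fun_prop
  have hwn : ∀ p x, ‖w p x - (h p x).1‖ < 1 / 8 := fun p x => by
    have h1 : w p x - (h p x).1 = ρ ‖(h p x).1‖ • (s p x.1.1 - (h p x).1) := add_sub_cancel_left _ _
    have h2 := hsh p x
    rw [dist_comm, dist_eq_norm] at h2
    rw [h1, norm_smul, Real.norm_of_nonneg (hρ0 _)]
    exact (mul_le_of_le_one_left (norm_nonneg _) (hρ1 _)).trans_lt h2
  have hw1 : ∀ p x, ‖w p x‖ < 1 := fun p x => by
    have h1 := hwn p x
    have h2 : ‖(h p x).1‖ ≤ 3 / 4 := hhB p x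
    have h3 := norm_sub_norm_le (w p x) (h p x).1
    linarith
  let f₁ : Ball n → Y := fun x =>
    if hx : ∃ p, x ∈ T p then D.char k hx.choose (ballRetraction (w _ ⟨x, hx.choose_spec⟩))
    else f x
  have hTu : ∀ {p p' x}, x ∈ T p → x ∈ T p' → p = p' := by
    rintro p p' x ⟨y, hy, hyx⟩ ⟨z, -, hzx⟩
    exact ((D.char_eq_char_iff (hB1 (by norm_num) y hy)).1 (hyx.trans hzx.symm)).1
  have hf₁T : ∀ p (x : T p), f₁ x = D.char k p (ballRetraction (w p x)) := fun p x => by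
    have hx : ∃ p, x.1 ∈ T p := ⟨p, x.2⟩
    have h1 : f₁ x = D.char k hx.choose (ballRetraction (w _ ⟨x, hx.choose_spec⟩)) := dif_pos hx
    have h2 : ∀ p' (h' : x.1 ∈ T p'), p = p' →
        D.char k p' (ballRetraction (w p' ⟨x, h'⟩)) = D.char k p (ballRetraction (w p x)) := by
      rintro p' h' rfl; rfl
    rw [h1]
    exact h2 _ _ (hTu x.2 hx.choose_spec)
  have hf₁n : ∀ x, (∀ p, x ∉ T p) → f₁ x = f x := fun x hx => dif_neg fun ⟨p, hp⟩ => hx p hp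
  have hf₁e : ∀ x, f x ∉ (⋃ p, D.char k p '' B (5 / 8)) → f₁ x = f x := by
    intro x hx
    by_cases hx' : ∃ p, x ∈ T p
    · obtain ⟨p, hp⟩ := hx'
      have h1 : 5 / 8 ≤ ‖(h p ⟨x, hp⟩).1‖ := by
        by_contra hlt
        exact hx (mem_iUnion.2 ⟨p, h p ⟨x, hp⟩, (not_le.1 hlt).le, hh p ⟨x, hp⟩⟩)
      rw [hf₁T p ⟨x, hp⟩]
      have h2 : w p ⟨x, hp⟩ = (h p ⟨x, hp⟩).1 := by simp only [w]; rw [hρ3 _ h1, zero_smul, add_zero]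
      have h3 : ballRetraction (w p ⟨x, hp⟩) = h p ⟨x, hp⟩ := Subtype.ext <| by
        rw [h2]; exact ballRetraction_of_norm_le (norm_le_one _)
      rw [h3, hh]
    · exact hf₁n x (not_exists.1 hx')
  -- If `f x` lies in one of the balls of radius `5 / 8`, then `T p` is a neighbourhood of `x` and
  -- the formula there applies. The union of these balls over all cells is closed, so elsewhere `f₁`
  -- agrees with `f` near `x`.
  have hf₁c : Continuous f₁ := by
    rw [continuous_iff_continuousAt]
    intro x
    by_cases hx : f x ∈ ⋃ p, D.char k p '' B (5 / 8)
    · obtain ⟨p, y, hy, hyx⟩ := mem_iUnion.1 hx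
      have hcl := D.isClosed_skel_diff (n := k) (W := fun p' => {y | p' = p ∧ ‖y.1‖ < 3 / 4})
        (fun p' y hy => hy.2.trans (by norm_num)) fun p' => by
          by_cases hp : p' = p
          · simp only [hp, true_and]; exact isOpen_lt (by fun_prop) (by fun_prop)
          · simp [hp]
      have hop := (hcl.preimage f.continuous).isOpen_compl
      have hTx : T p ∈ 𝓝 x := by
        refine Filter.mem_of_superset (hop.mem_nhds ?_) ?_
        · intro hx'
          refine hx'.2 (mem_iUnion.2 ⟨p, y, ⟨rfl, lt_of_le_of_lt hy (by norm_num)⟩, hyx⟩)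
        · intro z hz
          have hz' : f z ∈ ⋃ q, D.char k q '' {y | q = p ∧ ‖y.1‖ < 3 / 4} := by
            by_contra hz'
            exact hz ⟨hf z, hz'⟩
          obtain ⟨q, y, ⟨rfl, hy⟩, hyz⟩ := mem_iUnion.1 hz'
          exact ⟨y, hy.le, hyz⟩
      have hon : ContinuousOn f₁ (T p) := by
        rw [continuousOn_iff_continuous_domRestrict]
        exact ((D.continuous_char k p).comp (ballRetraction.continuous.comp (hwc p))).congr
          fun x => (hf₁T p x).symm
      exact hon.continuousAt hTx
    · have hcl := D.isClosed_iUnion_image (n := k) (W := fun _ => B (5 / 8))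
        (fun _ => hB1 (by norm_num)) fun _ => hB _
      have hop := (hcl.preimage f.continuous).isOpen_compl
      refine (f.continuous.continuousAt (x := x)).congr
        (Filter.mem_of_superset (hop.mem_nhds hx) fun z hz => (hf₁e z hz).symm)
  -- the self-map of the skeleton
  let R : Y → Y := fun z =>
    if hz : ∃ (p : D.cell k) (y : Ball k), ‖y.1‖ < 1 ∧ D.char k p y = z then
      D.char k hz.choose (r hz.choose hz.choose_spec.choose) else z
  have hR1 : ∀ z ∈ D.skel k, R z = z := fun z hz => dif_neg <| by
    rintro ⟨p, y, hy, rfl⟩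
    exact D.char_interior k p y hy hz
  have hR2 : ∀ p y, R (D.char k p y) = D.char k p (r p y) := by
    intro p y
    by_cases hy : ‖y.1‖ < 1
    · have hz : ∃ (p' : D.cell k) (y' : Ball k), ‖y'.1‖ < 1 ∧ D.char k p' y' = D.char k p y :=
        ⟨p, y, hy, rfl⟩
      have h0 : R (D.char k p y) = D.char k hz.choose (r hz.choose hz.choose_spec.choose) := dif_pos hz
      obtain ⟨h1, h2⟩ := (D.char_eq_char_iff hz.choose_spec.choose_spec.1).1
        hz.choose_spec.choose_spec.2
      rw [h0, h2, h1]
    · have hy' : ‖y.1‖ = 1 := le_antisymm (norm_le_one y) (not_lt.1 hy)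
      rw [hR1 _ (D.char_sphere k p y hy'), hr1 p y hy']
  have hRc : ContinuousOn R (D.skel (k + 1)) := D.continuousOn_skel fun j hj p => by
    rcases Nat.lt_succ_iff_lt_or_eq.1 hj with hj | rfl
    · exact (D.continuous_char j p).congr fun y => (hR1 _ (D.char_mem_skel hj p y)).symm
    · simp_rw [hR2]
      exact (D.continuous_char j p).comp (r p).continuous
  have hf₁s : ∀ x, f₁ x ∈ D.skel (k + 1) := fun x => by
    by_cases hx : ∃ p, x ∈ T p
    · obtain ⟨p, hp⟩ := hx
      rw [hf₁T p ⟨x, hp⟩]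
      exact D.char_mem_skel_succ _ _
    · rw [hf₁n x (not_exists.1 hx)]
      exact hf x
  have hRs : ∀ p (y : Ball k), ε p ≤ ‖y.1 - q p‖ → R (D.char k p y) ∈ D.skel k := fun p y hy => by
    rw [hR2]
    exact D.char_sphere k p _ (hr2 p y hy)
  have hfar : ∀ p (y : EuclideanSpace ℝ (Fin k)), 3 / 8 ≤ ‖y‖ → ε p ≤ ‖y - q p‖ := fun p y hy => by
    have := norm_sub_norm_le y (q p)
    linarith [hε p]
  refine ⟨⟨fun x => R (f₁ x), hRc.comp_continuous hf₁c hf₁s⟩, fun x => ?_, fun x hx => ?_⟩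
  · change R (f₁ x) ∈ _
    by_cases hx : ∃ p, x ∈ T p
    · obtain ⟨p, hp⟩ := hx
      rw [hf₁T p ⟨x, hp⟩]
      refine hRs p _ ?_
      rw [ballRetraction_of_norm_le (hw1 p _).le]
      -- In the inner zone the new coordinate is a value of `s p` and so avoids the ball of radius
      -- `ε p` around `q p`. Further out its norm is at least `3 / 8`, and `ε p ≤ 3 / 8 - ‖q p‖`
      -- keeps it away from that ball. In both cases the expansion moves it to the sphere.
      rcases le_total ‖(h p ⟨x, hp⟩).1‖ (1 / 2) with h1 | h1
      · have h2 : w p ⟨x, hp⟩ = s p x.1 := by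
          simp only [w]; rw [hρ2 _ h1, one_smul, add_sub_cancel]
        rw [h2]
        exact hsq p x
      · refine hfar p _ ?_
        have h2 := hwn p ⟨x, hp⟩
        have h3 := norm_sub_norm_le (h p ⟨x, hp⟩).1 (w p ⟨x, hp⟩)
        rw [norm_sub_rev] at h3
        linarith
    · rw [hf₁n x (not_exists.1 hx)]
      by_cases hxk : f x ∈ D.skel k
      · rwa [hR1 _ hxk]
      · obtain ⟨p, y, hy, hyx⟩ := D.exists_char_of_mem_diff (hf x) hxk
        rw [← hyx]
        refine hRs p y (hfar p _ ?_)
        by_contra hlt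
        exact hx ⟨p, y, show ‖y.1‖ ≤ 3 / 4 by linarith [not_le.1 hlt], hyx⟩
  · change R (f₁ x) = f x
    rw [hf₁e x, hR1 _ hx]
    intro hx'
    obtain ⟨p, y, hy, hyx⟩ := mem_iUnion.1 hx'
    exact D.char_interior k p y (hB1 (by norm_num) y hy) (hyx ▸ hx)

/-- Cellular approximation for maps of balls, relative to the part mapped to the skeleton. -/
theorem exists_cellular_approx {n : ℕ} (f : C(Ball n, Y)) :
    ∃ f' : C(Ball n, Y), (∀ x, f' x ∈ D.skel (n + 1)) ∧ ∀ x, f x ∈ D.skel (n + 1) → f' x = f x := by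
  -- The compact image lies in some skeleton, and the cells of dimension greater than `n` are
  -- vacated one dimension at a time from the top.
  obtain ⟨N, hN⟩ := D.exists_subset_skel_of_isCompact (isCompact_range f.continuous)
  have hN' : ∀ x, f x ∈ D.skel (n + 1 + N) := fun x =>
    D.skel_mono (Nat.le_add_left _ _) (hN ⟨x, rfl⟩)
  clear hN
  induction N generalizing f with
  | zero => exact ⟨f, hN', fun _ _ => rfl⟩
  | succ N ih =>
    obtain ⟨f₁, hf₁, hf₁'⟩ := D.exists_pushOff (k := n + 1 + N) (by omega) f hN'
    obtain ⟨f₂, hf₂, hf₂'⟩ := ih f₁ hf₁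
    refine ⟨f₂, hf₂, fun x hx => ?_⟩
    have h1 := hf₁' x (D.skel_mono (Nat.le_add_right _ _) hx)
    rw [hf₂' x (h1 ▸ hx), h1]

theorem exists_cellular_extension {n : ℕ} (hY : SphereExtension (EuclideanSpace ℝ (Fin n)) Y)
    (g : C(sphere (0 : EuclideanSpace ℝ (Fin n)) 1, Y)) (hg : ∀ s, g s ∈ D.skel n) :
    ∃ G : C(Ball n, Y), (∀ s : sphere (0 : EuclideanSpace ℝ (Fin n)) 1,
      G ⟨s, sphere_subset_closedBall s.2⟩ = g s) ∧ ∀ y, G y ∈ D.skel (n + 1) := by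
  obtain ⟨f, hf⟩ := hY g
  obtain ⟨G, hG, hG'⟩ := D.exists_cellular_approx f
  refine ⟨G, fun s => ?_, hG⟩
  rw [hG', hf]
  rw [hf]
  exact D.skel_mono n.le_succ (hg s)

end MCWComplex

/-! ### Equivariant cellular maps and equivariant homotopies -/

namespace MCWComplex

open Metric Set unitInterval

variable {M : Type u} [Monoid M] {X : Type v} [TopologicalSpace X] [MulAction M X]
  {Y : Type w} [TopologicalSpace Y] [MulAction M Y] [ContinuousConstSMul M Y]
  (C : MCWComplex M X) (D : MCWComplex M Y)

theorem exists_equivariant_cellular (hC : C.IsProjective) [Nonempty Y]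
    (hY : ∀ n, SphereExtension (EuclideanSpace ℝ (Fin n)) Y) :
    ∃ f : C(X, Y), IsEquivariant M f ∧ C.IsCellular D f := by
  obtain ⟨f, hf, hf'⟩ := C.exists_continuousMap_of_cellExtension hC
    -- Over the interior of an `n`-cell only the indices above `n` impose a condition; over its
    -- boundary the condition is inherited from `g`.
    (R := fun x z => ∀ n, x ∈ C.skel n → z ∈ D.skel n)
    (fun m x z h n hx => D.smul_mem_skel m (h n ((C.smul_mem_skel_iff m).1 hx)))
    fun n p g hg => by
      obtain ⟨G, hG, hG'⟩ := D.exists_cellular_extension (hY n) g fun s =>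
        hg s n (C.char_sphere n p _ (mem_sphere_zero_iff_norm.1 s.2))
      refine ⟨G, hG, fun y k hk => ?_⟩
      by_cases hy : ‖y.1‖ < 1
      · by_cases hkn : k ≤ n
        · exact absurd (C.skel_mono hkn hk) (C.char_interior n p y hy)
        · exact D.skel_mono (Nat.lt_of_not_le hkn) (hG' y)
      · have hy' : ‖y.1‖ = 1 := le_antisymm (norm_le_one y) (not_lt.1 hy)
        have := hG ⟨y.1, mem_sphere_zero_iff_norm.2 hy'⟩
        rw [Subtype.coe_eta] at this
        rw [this]
        exact hg ⟨y.1, mem_sphere_zero_iff_norm.2 hy'⟩ k hk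
  exact ⟨f, hf, fun n x hx => hf' x _ hx⟩

/-- Equivariant maps into a space without higher homotopy are equivariantly homotopic. -/
theorem mHomotopic (hC : C.IsProjective)
    (hY : ∀ n, SphereExtension (EuclideanSpace ℝ (Fin n) × ℝ) Y) (f g : C(X, Y))
    (hf : IsEquivariant M f) (hg : IsEquivariant M g) : MHomotopic M f g := by
  rcases isEmpty_or_nonempty X with hX | ⟨⟨x₀⟩⟩
  · refine ⟨⟨⟨fun z => hX.elim z.2, continuous_of_const fun z => hX.elim z.2⟩,
      fun x => hX.elim x, fun x => hX.elim x⟩, fun t m x => hX.elim x⟩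
  have : Nonempty C(I, Y) := ⟨ContinuousMap.const _ (f x₀)⟩
  -- A homotopy is a map into the path space with prescribed endpoints, so no cell structure on `X ×
  -- I` is needed. The action on paths is pointwise, and equivariance of `F` is equivariance of the
  -- homotopy.
  obtain ⟨F, hF, hF'⟩ := C.exists_continuousMap_of_cellExtension (Z := C(I, Y)) hC
    (R := fun x γ => γ 0 = f x ∧ γ 1 = g x)
    (fun m x γ h => by
      constructor
      · rw [hf m x, ← h.1]; rfl
      · rw [hg m x, ← h.2]; rfl)
    fun n p φ hφ => by
      obtain ⟨G, hG, h0, h1⟩ := (hY n).exists_extension_prod φ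
        ⟨fun y => f (C.char n p y), f.continuous.comp (C.continuous_char n p)⟩
        ⟨fun y => g (C.char n p y), g.continuous.comp (C.continuous_char n p)⟩
        (fun s => (hφ s).1) (fun s => (hφ s).2)
      exact ⟨G, hG, fun y => ⟨h0 y, h1 y⟩⟩
  refine ⟨⟨F.uncurry.comp ⟨Prod.swap, continuous_swap⟩, fun x => (hF' x).1, fun x => (hF' x).2⟩,
    fun t m x => ?_⟩
  exact congrArg (fun γ : C(I, Y) => γ t) (hF m x)

end MCWComplex

/-! ### The quotient by a monoid action -/

namespace WeakOrbits

open unitInterval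

variable {M : Type u} [Monoid M] {X : Type v} [MulAction M X] {Y : Type w} [MulAction M Y]

variable (M) in
/-- The quotient map to the set of weak orbits. -/
def mk (x : X) : WeakOrbits M X := Quotient.mk _ x

theorem mk_smul (m : M) (x : X) : mk M (m • x) = mk M x :=
  Quotient.sound (Relation.EqvGen.rel _ _ ⟨m, rfl⟩)

theorem mk_surjective : Function.Surjective (mk M : X → WeakOrbits M X) := Quotient.mk_surjective

theorem invariant {T : Type*} {φ : X → T} (h : ∀ (m : M) x, φ (m • x) = φ x) (x y : X)
    (hxy : weakOrbitSetoid M X x y) : φ x = φ y := by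
  induction hxy with
  | rel x y h' => obtain ⟨m, rfl⟩ := h'; exact h m y
  | refl x => rfl
  | symm x y _ ih => exact ih.symm
  | trans x y z _ _ ih ih' => exact ih.trans ih'

variable [TopologicalSpace X] [TopologicalSpace Y]

theorem continuous_mk : Continuous (mk M : X → WeakOrbits M X) := continuous_quotient_mk'

theorem isQuotientMap_mk : IsQuotientMap (mk M : X → WeakOrbits M X) := isQuotientMap_quotient_mk'

/-- An invariant map induces a map on the quotient. -/
def lift {T : Type*} [TopologicalSpace T] (φ : C(X, T)) (h : ∀ (m : M) x, φ (m • x) = φ x) :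
    C(WeakOrbits M X, T) :=
  ⟨Quotient.lift φ (invariant h), φ.continuous.quotient_lift _⟩

/-- The map of quotients induced by an equivariant map. -/
def map (f : C(X, Y)) (hf : IsEquivariant M f) : C(WeakOrbits M X, WeakOrbits M Y) :=
  lift ⟨fun x => mk M (f x), continuous_mk.comp f.continuous⟩ fun m x => by
    change mk M (f (m • x)) = mk M (f x)
    rw [hf, mk_smul]

theorem map_homotopic {f g : C(X, Y)} (hf : IsEquivariant M f) (hg : IsEquivariant M g)
    (h : MHomotopic M f g) : (map f hf).Homotopic (map g hg) := by
  obtain ⟨H, hH⟩ := h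
  -- Currying lets the homotopy descend along `X → M\X` itself, so it need not be known that the
  -- product of this quotient map with `I` is a quotient map.
  let φ : C(X, C(I, WeakOrbits M Y)) := ContinuousMap.curry
    ⟨fun z => mk M (H (z.2, z.1)), continuous_mk.comp (by fun_prop)⟩
  have hφ : ∀ (m : M) x, φ (m • x) = φ x := fun m x => by
    ext t
    change mk M (H (t, m • x)) = mk M (H (t, x))
    rw [hH, mk_smul]
  refine ⟨⟨(lift φ hφ).uncurry.comp ⟨Prod.swap, continuous_swap⟩, fun q => ?_, fun q => ?_⟩⟩
  · obtain ⟨x, rfl⟩ := mk_surjective q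
    change mk M (H (0, x)) = mk M (f x)
    rw [H.apply_zero]
  · obtain ⟨x, rfl⟩ := mk_surjective q
    change mk M (H (1, x)) = mk M (g x)
    rw [H.apply_one]

/-- Equivariantly homotopy equivalent spaces have homotopy equivalent quotients. -/
theorem nonempty_homotopyEquiv {f : C(X, Y)} {g : C(Y, X)} (h : AreMHomotopyInverse M f g) :
    Nonempty (ContinuousMap.HomotopyEquiv (WeakOrbits M X) (WeakOrbits M Y)) := by
  obtain ⟨hf, hg, h1, h2⟩ := h
  have hgf : IsEquivariant M (g.comp f) := fun m x => by
    change g (f (m • x)) = m • g (f x)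
    rw [hf, hg]
  have hfg : IsEquivariant M (f.comp g) := fun m x => by
    change f (g (m • x)) = m • f (g x)
    rw [hg, hf]
  refine ⟨⟨map f hf, map g hg, ?_, ?_⟩⟩
  · have := map_homotopic hgf (fun _ _ => rfl) h1
    convert this using 1 <;> ext q <;> obtain ⟨x, rfl⟩ := mk_surjective q <;> rfl
  · have := map_homotopic hfg (fun _ _ => rfl) h2
    convert this using 1 <;> ext q <;> obtain ⟨x, rfl⟩ := mk_surjective q <;> rfl

end WeakOrbits

namespace MCWComplex

variable {M : Type u} [Monoid M] {X : Type v} [TopologicalSpace X] [MulAction M X]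
  {Y : Type w} [TopologicalSpace Y] [MulAction M Y]

/-- Two equivariant classifying spaces are equivalent by a cellular equivalence. -/
theorem IsEquivariantClassifyingSpace.exists_equivalence [ContinuousConstSMul M X]
    [ContinuousConstSMul M Y] {C : MCWComplex M X} {D : MCWComplex M Y}
    (hC : C.IsEquivariantClassifyingSpace) (hD : D.IsEquivariantClassifyingSpace) :
    ∃ (f : C(X, Y)) (g : C(Y, X)), AreMHomotopyInverse M f g ∧
      C.IsCellular D f ∧ D.IsCellular C g := by
  have := hC.2
  have := hD.2
  obtain ⟨f, hf, hf'⟩ := C.exists_equivariant_cellular D hC.1 fun n =>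
    SphereExtension.of_contractible _ _
  obtain ⟨g, hg, hg'⟩ := D.exists_equivariant_cellular C hD.1 fun n =>
    SphereExtension.of_contractible _ _
  refine ⟨f, g, ⟨hf, hg, ?_, ?_⟩, hf', hg'⟩
  · refine C.mHomotopic hC.1 (fun n => SphereExtension.of_contractible _ _) _ _ (fun m x => ?_)
      fun _ _ => rfl
    change g (f (m • x)) = m • g (f x)
    rw [hf, hg]
  · refine D.mHomotopic hD.1 (fun n => SphereExtension.of_contractible _ _) _ _ (fun m x => ?_)
      fun _ _ => rfl
    change f (g (m • x)) = m • f (g x)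
    rw [hg, hf]

end MCWComplex

namespace WeakOrbits

theorem mk_eq_mk_iff {G : Type u} [Group G] {X : Type v} [MulAction G X] {x y : X} :
    mk G x = mk G y ↔ ∃ g : G, g • x = y := by
  refine ⟨fun h => ?_, by rintro ⟨g, rfl⟩; exact (mk_smul g x).symm⟩
  have h' : weakOrbitSetoid G X x y := Quotient.exact h
  induction h' with
  | rel x y h' => obtain ⟨g, rfl⟩ := h'; exact ⟨g⁻¹, inv_smul_smul g y⟩
  | refl x => exact ⟨1, one_smul G x⟩
  | symm x y h' ih => obtain ⟨g, rfl⟩ := ih h.symm; exact ⟨g⁻¹, inv_smul_smul g x⟩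
  | trans x y z h1 h2 ih ih' =>
    obtain ⟨g, rfl⟩ := ih (Quotient.sound h1)
    obtain ⟨g', rfl⟩ := ih' (Quotient.sound h2)
    exact ⟨g' * g, mul_smul g' g x⟩

end WeakOrbits

/-! ### Quotients by groups and classical CW complexes -/

namespace MCWComplex

open Metric Set

section Quotient

variable {G : Type u} [Group G] {X : Type v} [TopologicalSpace X] [MulAction G X]
  (C : MCWComplex G X)

/-- For a group, weak orbits are orbits, so invariant subsets are saturated. This permits every
closedness condition on the quotient complex to be checked upstairs. -/
theorem preimage_image_skel (n : ℕ) :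
    WeakOrbits.mk G ⁻¹' (WeakOrbits.mk G '' C.skel n) = C.skel n := by
  refine Subset.antisymm ?_ (subset_preimage_image _ _)
  rintro x ⟨y, hy, hyx⟩
  obtain ⟨g, rfl⟩ := WeakOrbits.mk_eq_mk_iff.1 hyx
  exact C.smul_mem_skel g hy

/-- The cell structure on the quotient of a `G`-CW complex by the group `G`. -/
def quotient : @MCWComplex Unit _ (WeakOrbits G X) _ (unitAction _) :=
  letI := unitAction (WeakOrbits G X)
  { cell := fun n => WeakOrbits G (C.cell n)
    cellAction := fun n => unitAction _
    skel := fun n => WeakOrbits.mk G '' C.skel n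
    char := fun n => Quotient.lift (fun p y => WeakOrbits.mk G (C.char n p y))
      (WeakOrbits.invariant fun m p => funext fun y => by rw [C.char_smul, WeakOrbits.mk_smul])
    continuous_char := by
      rintro n ⟨p⟩
      exact WeakOrbits.continuous_mk.comp (C.continuous_char n p)
    char_smul := fun _ _ _ _ => rfl
    skel_zero := by rw [C.skel_zero, image_empty]
    skel_succ := by
      intro n
      rw [C.skel_succ, image_union, image_iUnion]
      congr 1
      apply Subset.antisymm
      · refine iUnion_subset fun p => ?_
        rintro _ ⟨_, ⟨y, rfl⟩, rfl⟩
        exact mem_iUnion.2 ⟨WeakOrbits.mk G p, y, rfl⟩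
      · refine iUnion_subset fun q => ?_
        obtain ⟨p, rfl⟩ := WeakOrbits.mk_surjective q
        rintro _ ⟨y, rfl⟩
        exact mem_iUnion.2 ⟨p, _, ⟨y, rfl⟩, rfl⟩
    char_sphere := by
      rintro n ⟨p⟩ y hy
      exact ⟨_, C.char_sphere n p y hy, rfl⟩
    char_interior := by
      rintro n ⟨p⟩ y hy h
      have h' : C.char n p y ∈ WeakOrbits.mk G ⁻¹' (WeakOrbits.mk G '' C.skel n) := h
      rw [C.preimage_image_skel] at h'
      exact C.char_interior n p y hy h'
    char_injective := by
      rintro n ⟨p⟩ ⟨p'⟩ y y' hy hy' h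
      have h' : WeakOrbits.mk G (C.char n p y) = WeakOrbits.mk G (C.char n p' y') := h
      obtain ⟨g, hg⟩ := WeakOrbits.mk_eq_mk_iff.1 h'
      rw [← C.char_smul] at hg
      obtain ⟨rfl, rfl⟩ := C.char_injective n _ _ _ _ hy hy' hg
      exact ⟨(WeakOrbits.mk_smul g p).symm, rfl⟩
    isClosed_skel_succ := by
      intro n K hK
      have hK' : WeakOrbits.mk G ⁻¹' K ⊆ C.skel (n + 1) :=
        (preimage_mono hK).trans (C.preimage_image_skel (n + 1)).subset
      rw [← WeakOrbits.isQuotientMap_mk.isClosed_preimage, C.isClosed_skel_succ n _ hK',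
        ← WeakOrbits.isQuotientMap_mk.isClosed_preimage, preimage_inter, C.preimage_image_skel]
      exact and_congr_right fun _ => ⟨fun h => by rintro ⟨p⟩; exact h p,
        fun h p => h (WeakOrbits.mk G p)⟩
    iUnion_skel := by
      rw [← image_iUnion, C.iUnion_skel, image_univ, WeakOrbits.mk_surjective.range_eq]
    isClosed_iff := by
      intro K
      rw [← WeakOrbits.isQuotientMap_mk.isClosed_preimage, C.isClosed_iff]
      refine forall_congr' fun n => ?_
      rw [← WeakOrbits.isQuotientMap_mk.isClosed_preimage, preimage_inter, C.preimage_image_skel] }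

end Quotient

/-- The restriction of a continuous map on a compact space to a saturated set on which it is
injective is an embedding. -/
theorem _root_.Continuous.continuousOn_invFunOn {K : Type*} [TopologicalSpace K] [CompactSpace K]
    [Nonempty K] {X : Type*} [TopologicalSpace X] [T2Space X] {f : K → X} (hf : Continuous f)
    {U : Set K} (hU : ∀ u ∈ U, ∀ x, f x = f u → x = u) {g : X → K} (hg : ∀ u ∈ U, g (f u) = u) :
    ContinuousOn g (f '' U) := by
  have hr : IsClosedMap ((f '' U).restrictPreimage f) := hf.isClosedMap.restrictPreimage _
  have hrc : Continuous ((f '' U).restrictPreimage f) := hf.restrictPreimage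
  have hUx : ∀ x : f ⁻¹' (f '' U), x.1 ∈ U := by
    rintro ⟨x, u, hu, hux⟩
    change x ∈ U
    rwa [hU u hu x hux.symm]
  have hemb : IsClosedEmbedding ((f '' U).restrictPreimage f) := by
    refine .of_continuous_injective_isClosedMap hrc (fun x y hxy => ?_) hr
    exact Subtype.ext (hU y.1 (hUx y) x.1 (congrArg Subtype.val hxy))
  rw [continuousOn_iff_continuous_domRestrict]
  have h1 : ∀ z : f '' U, g z ∈ f ⁻¹' (f '' U) := by
    rintro ⟨_, u, hu, rfl⟩
    simp only [hg u hu]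
    exact ⟨u, hu, rfl⟩
  have h2 : Continuous fun z : f '' U => (⟨g z, h1 z⟩ : f ⁻¹' (f '' U)) := by
    rw [hemb.isInducing.continuous_iff]
    refine continuous_id.congr ?_
    rintro ⟨_, u, hu, rfl⟩
    apply Subtype.ext
    change f u = f (g (f u))
    rw [hg u hu]
  exact continuous_subtype_val.comp h2

section Classical

variable {M : Type u} [Monoid M] {X : Type v} [TopologicalSpace X] [MulAction M X]
  (C : MCWComplex M X)

/-- The homeomorphism of the unit ball of the maximum norm with the Euclidean unit ball. -/
noncomputable def maxBallHomeo (n : ℕ) : closedBall (0 : Fin n → ℝ) 1 ≃ₜ Ball n :=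
  (exists_homeomorph_closedBall (Fin n → ℝ) (EuclideanSpace ℝ (Fin n)) (by simp)).choose

theorem norm_maxBallHomeo {n : ℕ} (x : closedBall (0 : Fin n → ℝ) 1) :
    ‖(maxBallHomeo n x).1‖ = 1 ↔ ‖x.1‖ = 1 :=
  (exists_homeomorph_closedBall (Fin n → ℝ) (EuclideanSpace ℝ (Fin n)) (by simp)).choose_spec x

theorem norm_maxBallHomeo_lt {n : ℕ} (x : closedBall (0 : Fin n → ℝ) 1) :
    ‖(maxBallHomeo n x).1‖ < 1 ↔ ‖x.1‖ < 1 := by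
  rw [lt_iff_le_and_ne, lt_iff_le_and_ne, Ne, norm_maxBallHomeo]
  simp only [norm_le_one, true_and, mem_closedBall_zero_iff.1 x.2]

/-- The characteristic maps in the form used by `Topology.CWComplex`. -/
noncomputable def charMax {n : ℕ} (p : C.cell n) (v : Fin n → ℝ) : X :=
  C.char n p (maxBallHomeo n (ballRetraction v))

theorem charMax_eq {n : ℕ} (p : C.cell n) (v : closedBall (0 : Fin n → ℝ) 1) :
    C.charMax p v.1 = C.char n p (maxBallHomeo n v) := by
  have : ballRetraction v.1 = v :=
    Subtype.ext (ballRetraction_of_norm_le (mem_closedBall_zero_iff.1 v.2))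
  rw [charMax, this]

theorem continuous_charMax {n : ℕ} (p : C.cell n) : Continuous (C.charMax p) :=
  (C.continuous_char n p).comp ((maxBallHomeo n).continuous.comp ballRetraction.continuous)

theorem image_charMax {n : ℕ} (p : C.cell n) : C.charMax p '' closedBall 0 1 = range (C.char n p) := by
  ext x
  constructor
  · rintro ⟨v, -, rfl⟩; exact ⟨_, rfl⟩
  · rintro ⟨y, rfl⟩
    refine ⟨((maxBallHomeo n).symm y).1, ((maxBallHomeo n).symm y).2, ?_⟩
    rw [charMax_eq, Homeomorph.apply_symm_apply]

theorem charMax_eq_charMax {n : ℕ} {p : C.cell n} {v w : Fin n → ℝ} (hv : ‖v‖ < 1) (hw : ‖w‖ ≤ 1)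
    (h : C.charMax p v = C.charMax p w) : v = w := by
  have h1 := C.charMax_eq p ⟨v, mem_closedBall_zero_iff.2 hv.le⟩
  have h2 := C.charMax_eq p ⟨w, mem_closedBall_zero_iff.2 hw⟩
  have h3 := ((C.char_eq_char_iff ((norm_maxBallHomeo_lt _).2 hv)).1 ((h1.symm.trans h).trans h2)).2
  exact congrArg Subtype.val ((maxBallHomeo n).injective h3)

theorem injOn_charMax {n : ℕ} (p : C.cell n) : InjOn (C.charMax p) (ball 0 1) :=
  fun _ hv _ hw h => C.charMax_eq_charMax (mem_ball_zero_iff.1 hv) (mem_ball_zero_iff.1 hw).le h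

/-- An `M`-CW complex is a CW complex. -/
noncomputable abbrev toCWComplex : CWComplex (univ : Set X) where
  cell := C.cell
  map n p := (C.injOn_charMax p).toPartialEquiv _ _
  source_eq _ _ := rfl
  continuousOn n p := (C.continuous_charMax p).continuousOn
  continuousOn_symm n p := by
    have := C.t2Space
    let f : closedBall (0 : Fin n → ℝ) 1 → X := fun v => C.charMax p v.1
    let U : Set (closedBall (0 : Fin n → ℝ) 1) := {v | ‖v.1‖ < 1}
    let g : X → Fin n → ℝ := ((C.injOn_charMax p).toPartialEquiv _ _).symm
    have hg : ∀ v, ‖v‖ < 1 → g (C.charMax p v) = v := fun v hv =>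
      ((C.injOn_charMax p).toPartialEquiv _ _).left_inv (mem_ball_zero_iff.2 hv)
    have hfU : f '' U = C.charMax p '' ball 0 1 := by
      ext x
      constructor
      · rintro ⟨v, hv, rfl⟩; exact ⟨v.1, mem_ball_zero_iff.2 hv, rfl⟩
      · rintro ⟨v, hv, rfl⟩; exact ⟨⟨v, ball_subset_closedBall hv⟩, mem_ball_zero_iff.1 hv, rfl⟩
    have : Nonempty (closedBall (0 : Fin n → ℝ) 1) := ⟨⟨0, by simp⟩⟩
    -- The retraction makes the inverse take values in the compact ball, where the embedding
    -- criterion applies; it does not change the values of `g` on the open cell.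
    have h1 : ContinuousOn (fun x => (ballRetraction (g x) : closedBall (0 : Fin n → ℝ) 1))
        (f '' U) :=
      ((C.continuous_charMax p).comp continuous_subtype_val).continuousOn_invFunOn
        (fun u hu x hx => Subtype.ext (C.charMax_eq_charMax hu
          (mem_closedBall_zero_iff.1 x.2) hx.symm).symm)
        (fun u hu => Subtype.ext (by
          change (ballRetraction (g (C.charMax p u.1))).1 = u.1
          rw [hg u.1 hu]; exact ballRetraction_of_norm_le (le_of_lt hu)))
    change ContinuousOn g (C.charMax p '' ball 0 1)
    rw [← hfU]
    refine (continuous_subtype_val.comp_continuousOn h1).congr ?_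
    rintro _ ⟨v, hv, rfl⟩
    change g (C.charMax p v.1) = (ballRetraction (g (C.charMax p v.1))).1
    rw [hg v.1 hv]; exact (ballRetraction_of_norm_le hv.le).symm
  pairwiseDisjoint' := by
    rintro ⟨n, p⟩ - ⟨k, q⟩ - hne
    refine Set.disjoint_left.2 ?_
    rintro _ ⟨v, hv, rfl⟩ ⟨w, hw, h⟩
    rw [mem_ball_zero_iff] at hv hw
    have h1 := C.charMax_eq p ⟨v, mem_closedBall_zero_iff.2 hv.le⟩
    have h2 := C.charMax_eq q ⟨w, mem_closedBall_zero_iff.2 hw.le⟩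
    have h3 := C.char_eq_char ((norm_maxBallHomeo_lt _).2 hv) ((norm_maxBallHomeo_lt _).2 hw)
      ((h1.symm.trans h.symm).trans h2)
    exact hne (congrArg (fun q : Σ n, C.cell n × Ball n => (⟨q.1, q.2.1⟩ : Σ n, C.cell n)) h3)
  mapsTo' n p := by
    classical
    -- Closure finiteness: the closed cell is compact, hence meets only finitely many open cells,
    -- and each boundary point lies in one of these of smaller dimension.
    have hfin := C.finite_openCells_of_isCompact (isCompact_range (C.continuous_char n p))
    refine ⟨fun m => (hfin.preimage (f := Sigma.mk m)
      sigma_mk_injective.injOn).toFinset, fun v hv => ?_⟩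
    have hv' : ‖v‖ = 1 := mem_sphere_zero_iff_norm.1 hv
    have h1 := C.charMax_eq p ⟨v, mem_closedBall_zero_iff.2 hv'.le⟩
    have h2 := C.char_sphere n p _ ((norm_maxBallHomeo ⟨v, mem_closedBall_zero_iff.2 hv'.le⟩).2 hv')
    obtain ⟨k, hk, q, z, hz, hqz⟩ := C.exists_char_of_mem_skel h2
    refine mem_iUnion₂.2 ⟨k, hk, mem_iUnion₂.2 ⟨q, ?_, ?_⟩⟩
    · simp only [Finite.mem_toFinset, mem_preimage]
      exact ⟨z, hz, hqz ▸ ⟨_, rfl⟩⟩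
    · change C.charMax p v ∈ C.charMax q '' closedBall 0 1
      rw [image_charMax]
      exact ⟨z, hqz.trans h1.symm⟩
  closed' A _ h := by
    rw [C.isClosed_iff_char]
    intro n p
    have h1 : IsClosed (A ∩ C.charMax p '' closedBall 0 1) := h n p
    rw [image_charMax] at h1
    have h2 := h1.preimage (C.continuous_char n p)
    rwa [preimage_inter, preimage_range, inter_univ] at h2
  union' := by
    refine eq_univ_of_forall fun x => ?_
    obtain ⟨n, p, y, -, rfl⟩ := C.exists_char x
    refine mem_iUnion₂.2 ⟨n, p, ?_⟩
    change _ ∈ C.charMax p '' closedBall 0 1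
    rw [image_charMax]
    exact ⟨y, rfl⟩

end Classical

end MCWComplex

/-! ### Projective `G`-CW complexes cover their quotients -/

/-- The cone of functions on `G` with values in `[0, ∞)` and at most one nonzero value. -/
def SparseFunction (G : Type u) : Type u :=
  {z : G → ℝ // (∀ g, 0 ≤ z g) ∧ ∀ g h, z g ≠ 0 → z h ≠ 0 → g = h}

namespace SparseFunction

open Metric unitInterval

variable {G : Type u}

instance : TopologicalSpace (SparseFunction G) := instTopologicalSpaceSubtype

theorem continuous_val (g : G) : Continuous fun z : SparseFunction G => z.1 g :=
  (continuous_apply g).comp continuous_subtype_val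

/-- The multiple of a point mass. -/
noncomputable def single [DecidableEq G] (g : G) (r : ℝ) (hr : 0 ≤ r) : SparseFunction G :=
  ⟨Pi.single g r, fun h => by
    by_cases hg : h = g
    · subst hg; simpa using hr
    · simp [hg], fun a b ha hb => by
    have ha' : a = g := by by_contra h; simp [h] at ha
    have hb' : b = g := by by_contra h; simp [h] at hb
    rw [ha', hb']⟩

instance : Nonempty (SparseFunction G) := ⟨⟨0, fun _ => le_rfl, fun _ _ h => (h rfl).elim⟩⟩

instance [Group G] : MulAction G (SparseFunction G) where
  smul g z := ⟨fun h => z.1 (g⁻¹ * h), fun h => z.2.1 _, fun a b ha hb =>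
    mul_left_cancel (z.2.2 _ _ ha hb)⟩
  one_smul z := Subtype.ext (funext fun h => by
    change z.1 (1⁻¹ * h) = z.1 h
    simp)
  mul_smul a b z := Subtype.ext (funext fun h => by
    change z.1 ((a * b)⁻¹ * h) = z.1 (b⁻¹ * (a⁻¹ * h))
    rw [mul_inv_rev, mul_assoc])

theorem smul_val [Group G] (g h : G) (z : SparseFunction G) : (g • z).1 h = z.1 (g⁻¹ * h) := rfl

instance [Group G] : ContinuousConstSMul G (SparseFunction G) :=
  ⟨fun g => Continuous.subtype_mk (continuous_pi fun h => continuous_val (g⁻¹ * h)) _⟩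

/-- Scaling to zero contracts the cone. The contraction need not be equivariant, since the cellwise
construction asks for extensions over single balls only. -/
theorem sphereExtension (V : Type*) [NormedAddCommGroup V] [NormedSpace ℝ V]
    [FiniteDimensional ℝ V] : SphereExtension V (SparseFunction G) := by
  refine SphereExtension.of_nullhomotopic fun φ => ?_
  refine ⟨⟨0, fun _ => le_rfl, fun _ _ h => (h rfl).elim⟩, ⟨⟨⟨fun x => ⟨fun g =>
    (1 - (x.1 : ℝ)) * (φ x.2).1 g, fun g => ?_, fun a b ha hb => ?_⟩, ?_⟩, fun x => ?_, fun x => ?_⟩⟩⟩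
  · exact mul_nonneg (by linarith [x.1.2.2]) ((φ x.2).2.1 g)
  · exact (φ x.2).2.2 _ _ (right_ne_zero_of_mul ha) (right_ne_zero_of_mul hb)
  · refine Continuous.subtype_mk (continuous_pi fun g => ?_) _
    have := (continuous_val g).comp (φ.continuous.comp continuous_snd :
      Continuous fun x : I × sphere (0 : V) 1 => φ x.2)
    exact (by fun_prop : Continuous fun x : I × sphere (0 : V) 1 => 1 - (x.1 : ℝ)).mul this
  · apply Subtype.ext
    funext g
    simp
  · apply Subtype.ext
    funext g
    change (1 - ((1 : I) : ℝ)) * (φ x).1 g = 0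
    simp

end SparseFunction

namespace MCWComplex

open Metric Set

variable {G : Type u} [Group G] {X : Type v} [TopologicalSpace X] [MulAction G X]
  (C : MCWComplex G X)

/-- The component `a` of the section maps the cells equivariantly to `G`, where translation is free.
-/
theorem eq_one_of_smul_cell (hC : C.IsProjective) {n : ℕ} {p : C.cell n} {g : G}
    (h : g • p = p) : g = 1 := by
  obtain ⟨a, b, -, hab⟩ := (hC n).exists_section
  have := (hab g p).1
  rw [h] at this
  exact (mul_eq_right.1 this.symm)

/-- Every point has a neighbourhood which is disjoint from its translates. -/
theorem exists_nhds_disjoint (hC : C.IsProjective) (x : X) :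
    ∃ U ∈ 𝓝 x, ∀ g : G, ((g • ·) '' U ∩ U).Nonempty → g = 1 := by
  classical
  obtain ⟨N, p₀, y₀, hy₀, rfl⟩ := C.exists_char x
  let zero : SparseFunction G := ⟨0, fun _ => le_rfl, fun _ _ h => (h rfl).elim⟩
  let δ : G → SparseFunction G := fun g => SparseFunction.single g 1 zero_le_one
  have hzero : ∀ g : G, g • zero = zero := fun g => rfl
  have hδ : ∀ g h : G, g • δ h = δ (g * h) := fun g h => Subtype.ext <| funext fun k => by
    rw [SparseFunction.smul_val]
    simp only [δ, SparseFunction.single, Pi.single_apply]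
    congr 1
    rw [inv_mul_eq_iff_eq_mul]
  have hsm : ∀ g : G, g • C.char N p₀ y₀ = C.char N (g • p₀) y₀ := fun g => (C.char_smul N g p₀ y₀).symm
  -- The map `F` to the cone vanishes on the skeleton below the cell of the given point and sends
  -- the translate of this point by `g` to the unit mass at `g`. Later cells are filled in because
  -- the cone is contractible.
  obtain ⟨F, hF, hF'⟩ := C.exists_continuousMap_of_cellExtension hC
    (R := fun z (ζ : SparseFunction G) => (z ∈ C.skel N → ζ = zero) ∧
      ∀ g : G, z = g • C.char N p₀ y₀ → ζ = δ g) (by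
      intro m z ζ h
      refine ⟨fun hz => ?_, fun g hg => ?_⟩
      · rw [h.1 ((C.smul_mem_skel_iff m).1 hz), hzero]
      · rw [h.2 (m⁻¹ * g) (by rw [mul_smul, ← hg, inv_smul_smul]), hδ, mul_inv_cancel_left]) (by
      intro n p φ hφ
      have hsk : ∀ s : sphere (0 : EuclideanSpace ℝ (Fin n)) 1,
          C.char n p ⟨s, sphere_subset_closedBall s.2⟩ ∈ C.skel n := fun s =>
        C.char_sphere n p _ (mem_sphere_zero_iff_norm.1 s.2)
      rcases lt_trichotomy n N with hn | rfl | hn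
      · refine ⟨ContinuousMap.const _ zero, fun s => ?_, fun y => ⟨fun _ => rfl, fun g hg => ?_⟩⟩
        · exact ((hφ s).1 (C.skel_mono hn.le (hsk s))).symm
        · rw [hsm] at hg
          exact absurd (hg ▸ C.char_mem_skel hn p y) (C.char_interior N _ y₀ hy₀)
      · by_cases hp : ∃ g : G, p = g • p₀
        · obtain ⟨g, rfl⟩ := hp
          have hpos : 0 < 1 - ‖y₀.1‖ := by linarith
          -- A bump with value one at `y₀` that vanishes on the sphere, because every point of the
          -- sphere has distance at least `1 - ‖y₀‖` from `y₀`.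
          let r : Ball n → ℝ := fun y => max 0 (1 - ‖y.1 - y₀.1‖ / (1 - ‖y₀.1‖))
          have hr : ∀ y, 0 ≤ r y := fun y => le_max_left _ _
          have hrc : Continuous r := by fun_prop
          have hr0 : ∀ y : Ball n, ‖y.1‖ = 1 → r y = 0 := fun y hy => by
            refine max_eq_left (sub_nonpos.2 ?_)
            have h := norm_sub_norm_le y.1 y₀.1
            rw [hy] at h
            rwa [one_le_div hpos]
          have hG0 : ∀ y : Ball n, ‖y.1‖ = 1 → SparseFunction.single g (r y) (hr y) = zero :=
            fun y hy => Subtype.ext (by simp [SparseFunction.single, hr0 y hy, zero])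
          refine ⟨⟨fun y => SparseFunction.single g (r y) (hr y),
            Continuous.subtype_mk ((continuous_single g).comp hrc) _⟩, fun s => ?_,
            fun y => ⟨fun hy => ?_, fun g' hg' => ?_⟩⟩
          · rw [(hφ s).1 (hsk s)]
            exact hG0 _ (mem_sphere_zero_iff_norm.1 s.2)
          · refine hG0 _ (le_antisymm (norm_le_one y) (not_lt.1 fun hlt => ?_))
            exact C.char_interior n _ y hlt hy
          · rw [hsm] at hg'
            obtain ⟨h1, h2⟩ := (C.char_eq_char_iff hy₀).1 hg'.symm
            have h3 : g = g' := by
              have : (g⁻¹ * g') • p₀ = p₀ := by rw [mul_smul, h1, inv_smul_smul]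
              exact (inv_mul_eq_one.1 (C.eq_one_of_smul_cell hC this))
            subst h3
            subst h2
            have hr1 : r y₀ = 1 := by simp [r]
            refine Subtype.ext ?_
            change (Pi.single g (r y₀) : G → ℝ) = Pi.single g 1
            rw [hr1]
        · refine ⟨ContinuousMap.const _ zero, fun s => ((hφ s).1 (hsk s)).symm,
            fun y => ⟨fun _ => rfl, fun g hg => ?_⟩⟩
          rw [hsm] at hg
          exact absurd ⟨g, ((C.char_eq_char_iff hy₀).1 hg.symm).1.symm⟩ hp
      · obtain ⟨G', hG'⟩ := SparseFunction.sphereExtension (EuclideanSpace ℝ (Fin n)) φ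
        have key : ∀ y, C.char n p y ∈ C.skel n → ∃ s : sphere (0 : EuclideanSpace ℝ (Fin n)) 1,
            y = ⟨s, sphere_subset_closedBall s.2⟩ := fun y hy => by
          have : ‖y.1‖ = 1 := le_antisymm (norm_le_one y) (not_lt.1 fun hlt =>
            C.char_interior n _ y hlt hy)
          exact ⟨⟨y.1, mem_sphere_zero_iff_norm.2 this⟩, rfl⟩
        refine ⟨G', hG', fun y => ⟨fun hy => ?_, fun g hg => ?_⟩⟩
        · obtain ⟨s, rfl⟩ := key y (C.skel_mono hn.le hy)
          rw [hG']
          exact (hφ s).1 hy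
        · obtain ⟨s, rfl⟩ := key y (by rw [hg, hsm]; exact C.char_mem_skel hn _ _)
          rw [hG']
          exact (hφ s).2 g hg)
  -- For `z` and `g • z` both in this set, `F z` is nonzero at `1` and at `g⁻¹`. A sparse function
  -- has at most one nonzero value, so `g = 1`.
  refine ⟨{z | (F z).1 1 ≠ 0}, ?_, ?_⟩
  · refine IsOpen.mem_nhds (isOpen_ne.preimage ((SparseFunction.continuous_val 1).comp F.continuous)) ?_
    have : F (C.char N p₀ y₀) = δ 1 := (hF' _).2 1 (one_smul _ _).symm
    change (F (C.char N p₀ y₀)).1 1 ≠ 0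
    rw [this]
    simp [δ, SparseFunction.single]
  · rintro g ⟨_, ⟨z, hz, rfl⟩, hz'⟩
    have h1 : (F (g • z)).1 1 ≠ 0 := hz'
    rw [hF, SparseFunction.smul_val] at h1
    simpa using (F z).2.2 _ _ h1 hz

theorem isQuotientCoveringMap [ContinuousConstSMul G X] (hC : C.IsProjective) :
    IsQuotientCoveringMap (WeakOrbits.mk G : X → WeakOrbits G X) G where
  __ := WeakOrbits.isQuotientMap_mk
  continuous_const_smul := continuous_const_smul
  apply_eq_iff_mem_orbit {x y} := by
    rw [eq_comm, WeakOrbits.mk_eq_mk_iff]; rfl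
  disjoint := C.exists_nhds_disjoint hC

end MCWComplex

/-! ### Cubes, balls and homotopy groups of coverings -/

section Cubes

open unitInterval Metric Set

instance closedBall_locallyPathConnectedSpace (V : Type*) [NormedAddCommGroup V] [NormedSpace ℝ V] :
    LocallyPathConnectedSpace (closedBall (0 : V) 1) := by
  have h : IsQuotientMap (ballRetraction : V → closedBall (0 : V) 1) :=
    IsQuotientMap.of_inverse continuous_subtype_val ballRetraction.continuous fun x =>
      Subtype.ext (ballRetraction_of_norm_le (mem_closedBall_zero_iff.1 x.2))
  exact h.locallyPathConnectedSpace

instance closedBall_contractibleSpace (V : Type*) [NormedAddCommGroup V] [NormedSpace ℝ V] :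
    ContractibleSpace (closedBall (0 : V) 1) :=
  (convex_closedBall 0 1).contractibleSpace ⟨0, by simp⟩

/-- The homeomorphism of the cube with the unit ball of the maximum norm. -/
noncomputable def cubeHomeo (n : ℕ) : (Fin n → I) ≃ₜ closedBall (0 : Fin n → ℝ) 1 where
  toFun y := ⟨fun i => 2 * (y i : ℝ) - 1, by
    rw [mem_closedBall_zero_iff, pi_norm_le_iff_of_nonneg zero_le_one]
    intro i
    exact abs_le.2 ⟨by linarith [(y i).2.1], by linarith [(y i).2.2]⟩⟩
  invFun v := fun i => ⟨(v.1 i + 1) / 2, by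
    have h := (norm_le_pi_norm v.1 i).trans (mem_closedBall_zero_iff.1 v.2)
    have h' := abs_le.1 h
    exact ⟨by linarith [h'.1], by linarith [h'.2]⟩⟩
  left_inv y := by ext i; simp
  right_inv v := by
    apply Subtype.ext
    funext i
    change 2 * ((v.1 i + 1) / 2) - 1 = v.1 i
    ring
  continuous_toFun := by fun_prop
  continuous_invFun := continuous_pi fun i => Continuous.subtype_mk
    ((((continuous_apply i).comp continuous_subtype_val).add continuous_const).div_const 2) _

theorem norm_cubeHomeo {n : ℕ} (y : Fin n → I) :
    ‖(cubeHomeo n y).1‖ = 1 ↔ y ∈ Cube.boundary (Fin n) := by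
  have h1 : ‖(cubeHomeo n y).1‖ ≤ 1 := mem_closedBall_zero_iff.1 (cubeHomeo n y).2
  have h2 : ∀ i, (cubeHomeo n y).1 i = 2 * (y i : ℝ) - 1 := fun i => rfl
  constructor
  · intro h
    by_contra hb
    have : ‖(cubeHomeo n y).1‖ < 1 := by
      rw [pi_norm_lt_iff one_pos]
      intro i
      have h3 : y i ≠ 0 := fun h => hb ⟨i, Or.inl h⟩
      have h4 : y i ≠ 1 := fun h => hb ⟨i, Or.inr h⟩
      have h5 := unitInterval.pos_iff_ne_zero.2 h3
      have h6 := unitInterval.lt_one_iff_ne_one.2 h4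
      have h5' : (0 : ℝ) < y i := h5
      have h6' : (y i : ℝ) < 1 := h6
      rw [h2]
      exact abs_lt.2 ⟨by linarith, by linarith⟩
    exact this.ne h
  · rintro ⟨i, hi⟩
    refine le_antisymm h1 ?_
    refine le_trans ?_ (norm_le_pi_norm _ i)
    rw [h2]
    rcases hi with hi | hi
    · simp [hi]
    · norm_num [hi]

instance cube_contractibleSpace (n : ℕ) : ContractibleSpace (Fin n → I) :=
  (cubeHomeo n).contractibleSpace

instance cube_locallyPathConnectedSpace (n : ℕ) : LocallyPathConnectedSpace (Fin n → I) :=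
  (cubeHomeo n).symm.isQuotientMap.locallyPathConnectedSpace

/-- A homotopy relative to the boundary is a filling of the cylinder over the cube, constant along
its side; the cube is the unit ball of the maximum norm. -/
theorem SphereExtension.genLoop_homotopic {Y : Type*} [TopologicalSpace Y] {n : ℕ}
    (hY : SphereExtension ((Fin n → ℝ) × ℝ) Y) {e : Y} (α β : GenLoop (Fin n) Y e) :
    GenLoop.Homotopic α β := by
  have hb : ∀ s : sphere (0 : Fin n → ℝ) 1,
      (cubeHomeo n).symm ⟨s, sphere_subset_closedBall s.2⟩ ∈ Cube.boundary (Fin n) := fun s => by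
    rw [← norm_cubeHomeo, Homeomorph.apply_symm_apply]
    exact mem_sphere_zero_iff_norm.1 s.2
  obtain ⟨H, hH, hα, hβ⟩ := hY.exists_extension_prod
    (ContinuousMap.const _ (ContinuousMap.const _ e))
    (α.1.comp ⟨(cubeHomeo n).symm, (cubeHomeo n).symm.continuous⟩)
    (β.1.comp ⟨(cubeHomeo n).symm, (cubeHomeo n).symm.continuous⟩)
    (fun s => (α.2 _ (hb s)).symm) (fun s => (β.2 _ (hb s)).symm)
  refine ⟨⟨⟨H.uncurry.comp ⟨fun z : I × (Fin n → I) => (cubeHomeo n z.2, z.1), by fun_prop⟩,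
    fun y => ?_, fun y => ?_⟩, fun t y hy => ?_⟩⟩
  · change H (cubeHomeo n y) 0 = α.1 y
    rw [hα]
    simp
  · change H (cubeHomeo n y) 1 = β.1 y
    rw [hβ]
    simp
  · change H (cubeHomeo n y) t = α.1 y
    have h1 := hH ⟨(cubeHomeo n y).1, mem_sphere_zero_iff_norm.2 ((norm_cubeHomeo y).2 hy)⟩
    rw [Subtype.coe_eta] at h1
    rw [h1, α.2 y hy]
    rfl

/-- Loops of dimension at least two lift to a covering. -/
theorem IsCoveringMap.exists_genLoop_lift {E : Type*} [TopologicalSpace E] {K : Type*}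
    [TopologicalSpace K] {p : E → K} (hp : IsCoveringMap p) {n : ℕ} (hn : 2 ≤ n) (e : E)
    (α : GenLoop (Fin n) K (p e)) :
    ∃ β : GenLoop (Fin n) E e, ∀ y, p (β y) = α y := by
  have h0n : (0 : ℕ) < n := by omega
  have hz : ∀ i : Fin n, (0 : Fin n → I) ∈ Cube.boundary (Fin n) := fun i => ⟨i, Or.inl rfl⟩
  obtain ⟨β, ⟨hβ0, hβ⟩, -⟩ := hp.existsUnique_continuousMap_lifts α.1 (0 : Fin n → I) e
    (α.2 _ (hz ⟨0, h0n⟩)).symm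
  have hβ' : ∀ y, p (β y) = α y := fun y => congrFun hβ y
  -- On each face the loop is constant, so its lift, being constant over a connected set, is
  -- constant there too.
  have face : ∀ (i : Fin n) (c : I), (c = 0 ∨ c = 1) → ∀ y y' : Fin n → I, y i = c → y' i = c →
      β y = β y' := by
    intro i c hc y y' hy hy'
    have h1 : Continuous fun z : Fin n → I => β (Function.update z i c) :=
      β.continuous.comp (continuous_id.update i continuous_const)
    have h2 : ∀ z : Fin n → I, p (β (Function.update z i c)) = p e := fun z => by
      rw [hβ']
      refine α.2 _ ⟨i, ?_⟩
      simpa using hc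
    have h3 := hp.const_of_comp h1 (fun a a' => (h2 a).trans (h2 a').symm) y y'
    rwa [← hy, Function.update_eq_self, hy, ← hy', Function.update_eq_self] at h3
  refine ⟨⟨β, ?_⟩, hβ'⟩
  rintro y ⟨i, hi⟩
  obtain ⟨j, hj⟩ : ∃ j : Fin n, j ≠ i := by
    have : Nontrivial (Fin n) := Fin.nontrivial_iff_two_le.2 hn
    exact exists_ne i
  -- From `y` one moves within its face to the point whose other coordinates vanish. As `n ≥ 2`,
  -- this point lies on a face `j` that also contains the origin, where the lift is `e`.
  rw [face i (y i) hi y (Function.update 0 i (y i)) rfl (by simp),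
    face j 0 (Or.inl rfl) (Function.update 0 i (y i)) 0 (by simp [hj]) rfl, hβ0]

/-- Both loops lift to loops at `e`, which are homotopic upstairs because spheres bound there; the
homotopy is then projected. -/
theorem IsCoveringMap.subsingleton_homotopyGroup {E : Type*} [TopologicalSpace E] {K : Type*}
    [TopologicalSpace K] {p : E → K} (hp : IsCoveringMap p) {n : ℕ} (hn : 2 ≤ n) (e : E)
    (hE : SphereExtension ((Fin n → ℝ) × ℝ) E) : Subsingleton (HomotopyGroup.Pi n K (p e)) := by
  refine ⟨fun a b => ?_⟩
  induction a using Quotient.inductionOn with | _ α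
  induction b using Quotient.inductionOn with | _ β
  obtain ⟨α', hα'⟩ := hp.exists_genLoop_lift hn e α
  obtain ⟨β', hβ'⟩ := hp.exists_genLoop_lift hn e β
  refine Quotient.sound ?_
  have h := (hp.homotopicRel_iff_comp (S := Cube.boundary (Fin n)) (f₀ := α'.1) (f₁ := β'.1) ?_).1
    (hE.genLoop_homotopic α' β')
  · have h1 : α.1 = (ContinuousMap.mk p hp.continuous).comp α'.1 :=
      ContinuousMap.ext fun y => (hα' y).symm
    have h2 : β.1 = (ContinuousMap.mk p hp.continuous).comp β'.1 :=
      ContinuousMap.ext fun y => (hβ' y).symm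
    change α.1.HomotopicRel β.1 _
    rwa [h1, h2]
  · have : (0 : Fin n → I) ∈ Cube.boundary (Fin n) := ⟨⟨0, by omega⟩, Or.inl rfl⟩
    exact ⟨0, this, (α'.2 _ this).trans (β'.2 _ this).symm⟩

end Cubes

/-- The quotient of a classifying space of a group is an Eilenberg-Mac Lane space. -/
theorem MCWComplex.IsEquivariantClassifyingSpace.isEilenbergMacLane {G : Type u} [Group G]
    {X : Type v} [TopologicalSpace X] [MulAction G X] [ContinuousConstSMul G X]
    {C : MCWComplex G X} (hC : C.IsEquivariantClassifyingSpace) :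
    IsEilenbergMacLane G (WeakOrbits G X) := by
  let _ := unitAction (WeakOrbits G X)
  have := hC.2
  have hcov := C.isQuotientCoveringMap hC.1
  refine ⟨C.quotient.t2Space, ⟨C.quotient.toCWComplex⟩, ?_, fun x => ?_, fun n hn x => ?_⟩
  · exact WeakOrbits.mk_surjective.pathConnectedSpace WeakOrbits.continuous_mk
  · obtain ⟨e, rfl⟩ := WeakOrbits.mk_surjective x
    -- The covering identifies the fundamental group with the opposite of `G`; inversion turns this
    -- into an isomorphism with `G`.
    exact ⟨(hcov.fundamentalGroupEquiv ⟨e, rfl⟩).trans (MulEquiv.inv' G).symm⟩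
  · obtain ⟨e, rfl⟩ := WeakOrbits.mk_surjective x
    exact hcov.isCoveringMap.subsingleton_homotopyGroup hn e (SphereExtension.of_contractible _ _)

/-! ### Geometric realization of simplicial sets as a cell complex -/

/-- The standard topological simplex of dimension `n`. -/
abbrev TopSimplex (n : ℕ) : Type := stdSimplex ℝ (Fin (n + 1))

namespace SSet

open Simplicial Opposite

variable {X Y : SSet.{u}}

/-- The characteristic map of a simplex in the geometric realization. -/
noncomputable def simplexMap {n : ℕ} (σ : X _⦋n⦌) :
    C(TopSimplex n, SSet.toTop.obj X) :=
  (SSet.toTop.map (SSet.yonedaEquiv.symm σ)).hom.comp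
    ⟨_, (SimplexCategory.toTopHomeo.{u} ⦋n⦌).symm.continuous⟩

theorem simplexMap_apply {n : ℕ} (σ : X _⦋n⦌) (t : TopSimplex n) :
    simplexMap σ t = SSet.toTop.map (SSet.yonedaEquiv.symm σ)
      ((SimplexCategory.toTopHomeo.{u} ⦋n⦌).symm t) := rfl

theorem toTop_map_simplexMap (g : X ⟶ Y) {n : ℕ} (σ : X _⦋n⦌) (t : TopSimplex n) :
    SSet.toTop.map g (simplexMap σ t) = simplexMap (g.app _ σ) t := by
  rw [simplexMap_apply, simplexMap_apply, ← SSet.yonedaEquiv_symm_comp, SSet.toTop.map_comp]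
  rfl

theorem simplexMap_map {n m : ℕ} (f : ⦋n⦌ ⟶ ⦋m⦌) (σ : X _⦋m⦌) (t : TopSimplex n) :
    simplexMap (X.map f.op σ) t = simplexMap σ (_root_.stdSimplex.map f t) := by
  have h := SimplexCategory.toTopHomeo_symm_naturality_apply.{u} f t
  rw [simplexMap_apply, simplexMap_apply]
  erw [h]
  rw [← SSet.yonedaEquiv_symm_naturality_left, SSet.toTop.map_comp]
  rfl

theorem homEquiv_apply_eq {Z : TopCat.{u}} (F : SSet.toTop.obj X ⟶ Z) {n : ℕ} (σ : X _⦋n⦌)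
    (t : TopSimplex n) :
    Z.toSSetObjEquiv (op ⦋n⦌) ((sSetTopAdj.homEquiv X Z F).app (op ⦋n⦌) σ) t =
      F (simplexMap σ t) := by
  have h1 : ((sSetTopAdj.homEquiv X Z F).app (op ⦋n⦌) σ).down =
      SSet.toTopSimplex.inv.app _ ≫ SSet.toTop.map (SSet.yonedaEquiv.symm σ) ≫ F := by
    rw [Adjunction.homEquiv_unit, ← Category.assoc, ← sSetTopAdj_unit_app_app_down X (op ⦋n⦌) σ]
    rfl
  change (ConcreteCategory.hom (C := TopCat)
    ((sSetTopAdj.homEquiv X Z F).app (op ⦋n⦌) σ).down) (ULift.up t) = _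
  rw [h1]
  rfl

/-- Maps out of a geometric realization. -/
theorem existsUnique_desc (Z : Type u) [TopologicalSpace Z]
    (φ : ∀ n : ℕ, X _⦋n⦌ → C(TopSimplex n, Z))
    (hφ : ∀ {n m : ℕ} (f : ⦋n⦌ ⟶ ⦋m⦌) (σ : X _⦋m⦌) t,
      φ n (X.map f.op σ) t = φ m σ (_root_.stdSimplex.map f t)) :
    ∃! F : C(SSet.toTop.obj X, Z), ∀ (n : ℕ) (σ : X _⦋n⦌) t, F (simplexMap σ t) = φ n σ t := by
  let α : X ⟶ TopCat.toSSet.obj (TopCat.of Z) :=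
    { app := fun n => TypeCat.ofHom fun σ => ((TopCat.of Z).toSSetObjEquiv n).symm (φ n.unop.len σ)
      naturality := fun n m f => by
        ext σ
        apply ((TopCat.of Z).toSSetObjEquiv m).injective
        ext t
        exact hφ f.unop σ t }
  refine ⟨((sSetTopAdj.homEquiv X (TopCat.of Z)).symm α).hom, fun n σ t => ?_, fun F hF => ?_⟩
  · change ((sSetTopAdj.homEquiv X (TopCat.of Z)).symm α) (simplexMap σ t) = _
    rw [← homEquiv_apply_eq, Equiv.apply_symm_apply]
    rfl
  · have : TopCat.ofHom F = (sSetTopAdj.homEquiv X (TopCat.of Z)).symm α := by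
      apply (sSetTopAdj.homEquiv X (TopCat.of Z)).injective
      rw [Equiv.apply_symm_apply]
      ext n σ
      apply ((TopCat.of Z).toSSetObjEquiv n).injective
      ext t
      exact (homEquiv_apply_eq (TopCat.ofHom F) (n := n.unop.len) σ t).trans (hF _ σ t)
    rw [← this]
    rfl

/-- With an indiscrete target, every function is continuous. The indicator of the union of the
simplices and the constant function `True` then agree by the uniqueness part of the universal
property. -/
theorem exists_simplexMap (x : SSet.toTop.obj X) :
    ∃ (n : ℕ) (σ : X _⦋n⦌) (t : TopSimplex n), simplexMap σ t = x := by
  let _ : TopologicalSpace (ULift.{u} Prop) := ⊤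
  let a : C(SSet.toTop.obj X, ULift.{u} Prop) :=
    ⟨fun x => ⟨∃ (n : ℕ) (σ : X _⦋n⦌) (t : TopSimplex n), simplexMap σ t = x⟩, continuous_top⟩
  let b : C(SSet.toTop.obj X, ULift.{u} Prop) := ⟨fun _ => ⟨True⟩, continuous_top⟩
  have h : a = b := (existsUnique_desc (X := X) (ULift.{u} Prop) (fun _ _ => ⟨fun _ => ⟨True⟩,
    continuous_top⟩) (fun _ _ _ => rfl)).unique (fun n σ t => by
      simp only [a, ContinuousMap.coe_mk, ULift.up.injEq, eq_iff_iff, iff_true]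
      exact ⟨n, σ, t, rfl⟩) (fun n σ t => rfl)
  have h' := congrArg (fun f : C(SSet.toTop.obj X, ULift.{u} Prop) => (f x).down) h
  simpa [a, b] using h'

/-- The quotient of the disjoint union of all simplices by the kernel of its map to the realization
receives a continuous map `F` from the realization, so the realization carries the quotient
topology. -/
theorem isClosed_iff_simplexMap {A : Set (SSet.toTop.obj X)} :
    IsClosed A ↔ ∀ (n : ℕ) (σ : X _⦋n⦌), IsClosed (simplexMap σ ⁻¹' A) := by
  refine ⟨fun h n σ => h.preimage (simplexMap σ).continuous, fun h => ?_⟩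
  let q : (Σ s : (Σ n, X _⦋n⦌), TopSimplex s.1) → SSet.toTop.obj X := fun p => simplexMap p.1.2 p.2
  obtain ⟨F, hF, -⟩ := existsUnique_desc (X := X) (Quotient (Setoid.ker q))
    (fun n σ => ⟨fun t => Quotient.mk _ ⟨⟨n, σ⟩, t⟩,
      continuous_quotient_mk'.comp (continuous_sigmaMk (σ := fun s : (Σ n, X _⦋n⦌) =>
        TopSimplex s.1) (i := ⟨n, σ⟩))⟩)
    (fun f σ t => Quotient.sound (simplexMap_map f σ t))
  have hA : A = F ⁻¹' (Quotient.lift q (fun _ _ h => h) ⁻¹' A) := by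
    ext x
    obtain ⟨n, σ, t, rfl⟩ := exists_simplexMap x
    simp only [Set.mem_preimage]
    rw [hF]
    rfl
  rw [hA]
  refine IsClosed.preimage F.continuous ?_
  rw [← isQuotientMap_quotient_mk'.isClosed_preimage, isClosed_sigma_iff]
  exact fun s => h s.1 s.2

end SSet

namespace TopSimplex

open Simplicial

/-- The interior of the standard simplex. -/
def IsInterior {n : ℕ} (t : TopSimplex n) : Prop := ∀ i, 0 < t i

theorem map_apply {n m : ℕ} (f : Fin (n + 1) → Fin (m + 1)) (t : TopSimplex n) (j : Fin (m + 1)) :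
    stdSimplex.map f t j = ∑ i with f i = j, t i :=
  FunOnFinite.linearMap_apply_apply _ _ _ _ _

theorem map_apply_of_injective {n m : ℕ} {f : Fin (n + 1) → Fin (m + 1)}
    (hf : Function.Injective f) (t : TopSimplex n) (i : Fin (n + 1)) :
    stdSimplex.map f t (f i) = t i := by
  rw [map_apply, Finset.sum_eq_single i]
  · intro b hb hbi
    exact absurd (hf (Finset.mem_filter.1 hb).2) hbi
  · intro h
    simp at h

theorem map_apply_of_notMem {n m : ℕ} {f : Fin (n + 1) → Fin (m + 1)} (t : TopSimplex n)
    {j : Fin (m + 1)} (hj : j ∉ Set.range f) : stdSimplex.map f t j = 0 := by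
  rw [map_apply, Finset.sum_eq_zero]
  intro i hi
  exact absurd ⟨i, (Finset.mem_filter.1 hi).2⟩ hj

theorem IsInterior.map_pos_iff {n m : ℕ} {f : Fin (n + 1) → Fin (m + 1)} {t : TopSimplex n}
    (ht : t.IsInterior) {j : Fin (m + 1)} : 0 < stdSimplex.map f t j ↔ j ∈ Set.range f := by
  constructor
  · intro h
    by_contra hj
    rw [map_apply_of_notMem t hj] at h
    exact lt_irrefl _ h
  · rintro ⟨i, rfl⟩
    rw [map_apply]
    exact Finset.sum_pos (fun i _ => ht i) ⟨i, by simp⟩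

theorem IsInterior.map {n m : ℕ} {f : Fin (n + 1) → Fin (m + 1)} {t : TopSimplex n}
    (ht : t.IsInterior) (hf : Function.Surjective f) : IsInterior (n := m) (stdSimplex.map f t) :=
  fun j => ht.map_pos_iff.2 (hf j)

/-- Every point of a simplex lies in the interior of a face. -/
theorem exists_face {n : ℕ} (t : TopSimplex n) :
    ∃ (k : ℕ) (i : ⦋k⦌ ⟶ ⦋n⦌) (s : TopSimplex k), Function.Injective i ∧ s.IsInterior ∧
      stdSimplex.map i s = t := by
  classical
  set A : Finset (Fin (n + 1)) := Finset.univ.filter fun j => 0 < t j with hA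
  have hsum : ∑ j ∈ A, t j = 1 := by
    rw [← stdSimplex.sum_eq_one t, hA, Finset.sum_filter]
    refine Finset.sum_congr rfl fun j _ => ?_
    split_ifs with h
    · rfl
    · exact le_antisymm (stdSimplex.zero_le t j) (not_lt.1 h)
  have hne : A.Nonempty := by
    by_contra h
    rw [Finset.not_nonempty_iff_eq_empty.1 h] at hsum
    simp at hsum
  obtain ⟨k, hk⟩ : ∃ k, A.card = k + 1 := ⟨A.card - 1, by have := hne.card_pos; omega⟩
  let e := A.orderEmbOfFin hk
  have hmap : ∑ j, t (e j) = 1 := by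
    rw [← hsum, ← Finset.image_orderEmbOfFin_univ A hk, Finset.sum_image fun _ _ _ _ h => e.injective h]
  let s : TopSimplex k := ⟨fun j => t (e j), fun j => stdSimplex.zero_le t _, hmap⟩
  refine ⟨k, SimplexCategory.mkHom e.toOrderHom, s, e.injective, fun j => ?_, ?_⟩
  · exact (Finset.mem_filter.1 (Finset.orderEmbOfFin_mem A hk j)).2
  · have he : Function.Injective e := e.injective
    apply stdSimplex.ext
    funext j
    change stdSimplex.map e s j = t j
    by_cases hj : j ∈ Set.range e
    · obtain ⟨i, rfl⟩ := hj
      exact map_apply_of_injective he s i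
    · rw [map_apply_of_notMem s hj]
      rw [Finset.range_orderEmbOfFin] at hj
      refine le_antisymm (stdSimplex.zero_le t j) (not_lt.1 fun h => hj ?_)
      simpa [hA] using h

/-- The range of the face inclusion is the set of positive coordinates of the point, and a strictly
monotone map is determined by its range. -/
theorem face_unique {n k k' : ℕ} {i : ⦋k⦌ ⟶ ⦋n⦌} {i' : ⦋k'⦌ ⟶ ⦋n⦌} {s : TopSimplex k}
    {s' : TopSimplex k'} (hi : Function.Injective i) (hi' : Function.Injective i')
    (hs : s.IsInterior) (hs' : s'.IsInterior) (h : stdSimplex.map i s = stdSimplex.map i' s') :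
    ∃ hk : k = k', hk ▸ i = i' ∧ hk ▸ s = s' := by
  have hr : Set.range i = Set.range i' := by
    ext j
    rw [← hs.map_pos_iff, ← hs'.map_pos_iff, h]
  have hk : k = k' := by
    have h1 := Set.ncard_range_of_injective hi
    have h2 := Set.ncard_range_of_injective hi'
    simp at h1 h2
    rw [hr] at h1
    omega
  subst hk
  refine ⟨rfl, ?_, ?_⟩
  · have m1 : StrictMono i := (i.toOrderHom.monotone).strictMono_of_injective hi
    have m2 : StrictMono i' := (i'.toOrderHom.monotone).strictMono_of_injective hi'
    ext j : 3
    exact congrFun ((StrictMono.range_inj m1 m2).1 hr) j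
  · have m1 : StrictMono i := (i.toOrderHom.monotone).strictMono_of_injective hi
    have m2 : StrictMono i' := (i'.toOrderHom.monotone).strictMono_of_injective hi'
    have hii : (i : Fin (k + 1) → Fin (n + 1)) = i' := (StrictMono.range_inj m1 m2).1 hr
    apply stdSimplex.ext
    funext j
    change s j = s' j
    rw [← map_apply_of_injective hi, h, hii, map_apply_of_injective hi']

end TopSimplex

namespace TopSimplex

theorem exists_homeomorph_ball (n : ℕ) :
    ∃ h : Ball n ≃ₜ TopSimplex n, ∀ y, ‖y.1‖ < 1 ↔ (h y).IsInterior := by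
  -- Dropping the zeroth barycentric coordinate turns the simplex into a convex body with nonempty
  -- interior in `ℝ^n`, which is homeomorphic to the ball.
  let S : Set (Fin n → ℝ) := {x | (∀ i, 0 ≤ x i) ∧ ∑ i, x i ≤ 1}
  have hS : IsClosed S := by
    refine IsClosed.inter ?_ (isClosed_le (continuous_finsetSum _ fun i _ => continuous_apply i)
      continuous_const)
    change IsClosed {x : Fin n → ℝ | ∀ i, 0 ≤ x i}
    rw [Set.ofPred_forall]
    exact isClosed_iInter fun i => isClosed_le continuous_const (continuous_apply i)
  have hint : ∀ x ∈ S, x ∈ interior S ↔ (∀ i, 0 < x i) ∧ ∑ i, x i < 1 := by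
    intro x hx
    constructor
    · intro h
      have hm : ∀ᶠ y in 𝓝 x, y ∈ S := mem_interior_iff_mem_nhds.1 h
      -- Moving from an interior point a little along the diagonal, in either direction, stays in
      -- `S`; this makes all the inequalities strict.
      have hlim : ∀ c : ℝ, Filter.Tendsto (fun e : ℝ => x + (e * c) • (1 : Fin n → ℝ)) (𝓝[>] 0) (𝓝 x) := by
        intro c
        have : Continuous fun e : ℝ => x + (e * c) • (1 : Fin n → ℝ) := by fun_prop
        have h := this.tendsto 0
        simp only [zero_mul, zero_smul, add_zero] at h
        exact h.mono_left nhdsWithin_le_nhds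
      refine ⟨fun i => ?_, ?_⟩
      · obtain ⟨e, he, he'⟩ := (((hlim (-1)).eventually hm).and self_mem_nhdsWithin).exists
        have := he.1 i
        have he'' : 0 < e := he'
        simp at this
        linarith
      · obtain ⟨e, he, he'⟩ := (((hlim 1).eventually hm).and self_mem_nhdsWithin).exists
        have := he.2
        have he'' : 0 < e := he'
        simp [Finset.sum_add_distrib] at this
        rcases Nat.eq_zero_or_pos n with rfl | hn
        · simp
        · have : 0 < (n : ℝ) * e := by positivity
          linarith
    · rintro ⟨h1, h2⟩
      have : {x : Fin n → ℝ | (∀ i, 0 < x i) ∧ ∑ i, x i < 1} ⊆ interior S := by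
        refine interior_maximal (fun y hy => ⟨fun i => (hy.1 i).le, hy.2.le⟩) (IsOpen.inter ?_
          (isOpen_lt (continuous_finsetSum _ fun i _ => continuous_apply i) continuous_const))
        change IsOpen {x : Fin n → ℝ | ∀ i, 0 < x i}
        rw [Set.ofPred_forall]
        exact isOpen_iInter_of_finite fun i => isOpen_lt continuous_const (continuous_apply i)
      exact this ⟨h1, h2⟩
  obtain ⟨h, hh⟩ := exists_homeomorph_closedBall_of_convex
    (EuclideanSpace.equiv (Fin n) ℝ).symm (s := S) hS
    (by
      refine fun x hx y hy a b ha hb hab => ⟨fun i => ?_, ?_⟩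
      · exact add_nonneg (mul_nonneg ha (hx.1 i)) (mul_nonneg hb (hy.1 i))
      · simp only [Pi.add_apply, Pi.smul_apply, smul_eq_mul, Finset.sum_add_distrib,
          ← Finset.mul_sum]
        nlinarith [hx.2, hy.2])
    (by
      have h0 : (fun _ => ((n : ℝ) + 1)⁻¹ : Fin n → ℝ) ∈ S := by
        refine ⟨fun i => by positivity, ?_⟩
        simp only [Finset.sum_const, Finset.card_univ, Fintype.card_fin, nsmul_eq_mul]
        rw [← div_eq_mul_inv, div_le_one (by positivity)]
        linarith
      refine ⟨_, (hint _ h0).2 ⟨fun i => by positivity, ?_⟩⟩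
      simp only [Finset.sum_const, Finset.card_univ, Fintype.card_fin, nsmul_eq_mul]
      rw [← div_eq_mul_inv, div_lt_one (by positivity)]
      linarith)
    (by
      refine (Metric.isBounded_Icc (0 : Fin n → ℝ) 1).subset fun x hx => ⟨hx.1, fun i => ?_⟩
      exact (Finset.single_le_sum (fun j _ => hx.1 j) (Finset.mem_univ i)).trans hx.2)
  let e : S ≃ₜ TopSimplex n :=
    { toFun := fun x => ⟨Fin.cons (1 - ∑ i, x.1 i) x.1, fun i => by
          refine Fin.cases ?_ (fun j => ?_) i
          · simpa using x.2.2
          · simpa using x.2.1 j, by simp [Fin.sum_univ_succ]⟩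
      invFun := fun t => ⟨fun i => t i.succ, fun i => stdSimplex.zero_le t _, by
        have := stdSimplex.sum_eq_one t
        rw [Fin.sum_univ_succ] at this
        linarith [stdSimplex.zero_le t 0]⟩
      left_inv := fun x => by
        ext i
        change (Fin.cons (1 - ∑ i, x.1 i) x.1 : Fin (n + 1) → ℝ) i.succ = _
        simp
      right_inv := fun t => by
        have := stdSimplex.sum_eq_one t
        rw [Fin.sum_univ_succ] at this
        apply stdSimplex.ext
        funext i
        change (Fin.cons (1 - ∑ i : Fin n, t i.succ) (fun i => t i.succ) : Fin (n + 1) → ℝ) i = t i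
        refine Fin.cases ?_ (fun j => ?_) i
        · simp only [Fin.cons_zero]
          linarith
        · simp
      continuous_toFun := by
        refine Continuous.subtype_mk (continuous_pi fun i => ?_) _
        refine Fin.cases ?_ (fun j => ?_) i
        · simp only [Fin.cons_zero]
          fun_prop
        · simp only [Fin.cons_succ]
          exact (continuous_apply j).comp continuous_subtype_val
      continuous_invFun := by
        refine Continuous.subtype_mk (continuous_pi fun i => ?_) _
        exact (continuous_apply i.succ).comp continuous_subtype_val }
  have he : ∀ x : S, (e x).IsInterior ↔ x.1 ∈ interior S := by
    intro x
    rw [hint _ x.2, IsInterior, Fin.forall_fin_succ, and_comm]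
    refine and_congr (forall_congr' fun i => ?_) ?_
    · change 0 < (Fin.cons (1 - ∑ i, x.1 i) x.1 : Fin (n + 1) → ℝ) i.succ ↔ _
      simp
    · change 0 < (Fin.cons (1 - ∑ i, x.1 i) x.1 : Fin (n + 1) → ℝ) 0 ↔ _
      simp
  refine ⟨h.symm.trans e, fun y => ?_⟩
  obtain ⟨x, rfl⟩ := h.surjective y
  have h1 : ‖(h x).1‖ ≤ 1 := mem_closedBall_zero_iff.1 (h x).2
  rw [Homeomorph.trans_apply, Homeomorph.symm_apply_apply, he, lt_iff_le_and_ne]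
  rw [ne_eq, hh, hS.frontier_eq]
  simp [h1, x.2]

end TopSimplex

namespace SSet

open Simplicial Opposite

variable {X Y : SSet.{u}}

/-- The point `t` of the simplex `σ` is identified in the realization with the interior point
`p.2.2` of the nondegenerate simplex `p.2.1`. -/
def IsNormalForm {n : ℕ} (σ : X _⦋n⦌) (t : TopSimplex n) (p : Σ m, X _⦋m⦌ × TopSimplex m) : Prop :=
  ∃ (k : ℕ) (i : ⦋k⦌ ⟶ ⦋n⦌) (f : ⦋k⦌ ⟶ ⦋p.1⦌) (t' : TopSimplex k),
    Function.Injective i ∧ Function.Surjective f ∧ t'.IsInterior ∧ p.2.1 ∈ X.nonDegenerate p.1 ∧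
      _root_.stdSimplex.map i t' = t ∧ _root_.stdSimplex.map f t' = p.2.2 ∧
      X.map i.op σ = X.map f.op p.2.1

/-- First the point is placed in the interior of a face, then that face is written as a degeneracy
of a nondegenerate simplex; surjective maps preserve interior points. -/
theorem exists_isNormalForm {n : ℕ} (σ : X _⦋n⦌) (t : TopSimplex n) :
    ∃ p, IsNormalForm σ t p := by
  obtain ⟨k, i, t', hi, ht', rfl⟩ := t.exists_face
  obtain ⟨m, f, hf, y, hy⟩ := X.exists_nonDegenerate (X.map i.op σ)
  exact ⟨⟨m, y.1, _root_.stdSimplex.map f t'⟩, k, i, f, t', hi,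
    SimplexCategory.epi_iff_surjective.1 hf, ht', y.2, rfl, rfl, hy⟩

/-- Each of the two steps is unique: the face by its positive coordinates, the nondegenerate simplex
and the degeneracy operator by the Eilenberg–Zilber lemma. -/
theorem IsNormalForm.unique {n : ℕ} {σ : X _⦋n⦌} {t : TopSimplex n}
    {p q : Σ m, X _⦋m⦌ × TopSimplex m} (hp : IsNormalForm σ t p) (hq : IsNormalForm σ t q) :
    p = q := by
  obtain ⟨m, y, s⟩ := p
  obtain ⟨m', y', s'⟩ := q
  obtain ⟨k, i, f, a, hi, hf, ha, hy, hia, hfa, he⟩ := hp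
  obtain ⟨k', i', f', a', hi', hf', ha', hy', hia', hfa', he'⟩ := hq
  obtain ⟨rfl, h1, h2⟩ := TopSimplex.face_unique hi hi' ha ha' (hia.trans hia'.symm)
  dsimp only at *
  subst h1 h2
  have : Epi f := SimplexCategory.epi_iff_surjective.2 hf
  have : Epi f' := SimplexCategory.epi_iff_surjective.2 hf'
  obtain rfl := X.unique_nonDegenerate_dim _ f ⟨y, hy⟩ he f' ⟨y', hy'⟩ he'
  have h3 := X.unique_nonDegenerate_simplex _ f ⟨y, hy⟩ he f' ⟨y', hy'⟩ he'
  have h4 := X.unique_nonDegenerate_map _ f ⟨y, hy⟩ he f' ⟨y', hy'⟩ he'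
  simp only [Subtype.mk.injEq] at h3
  subst h3 h4
  exact congrArg (fun r => (⟨m, y, r⟩ : Σ m, X _⦋m⦌ × TopSimplex m)) (hfa.symm.trans hfa')

/-- The composite of the face inclusion with `f` is split into a surjection and an injection; the
injective part must be the face found in the normal form upstairs. -/
theorem IsNormalForm.map {n m : ℕ} {f : ⦋n⦌ ⟶ ⦋m⦌} {σ : X _⦋m⦌} {t : TopSimplex n}
    {p : Σ m, X _⦋m⦌ × TopSimplex m}
    (hp : IsNormalForm σ (_root_.stdSimplex.map f t) p) : IsNormalForm (X.map f.op σ) t p := by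
  obtain ⟨k, i, t', hi, ht', rfl⟩ := t.exists_face
  obtain ⟨l, j, g, a, hj, hg, ha, hy, hja, hga, he⟩ := hp
  let e := Limits.factorThruImage (i ≫ f)
  let d := Limits.image.ι (i ≫ f)
  have hed : e ≫ d = i ≫ f := Limits.image.fac _
  obtain ⟨q, hq⟩ : ∃ q, Limits.image (i ≫ f) = ⦋q⦌ := ⟨_, rfl⟩
  have he' : Function.Surjective e := SimplexCategory.epi_iff_surjective.1 inferInstance
  have hd' : Function.Injective d := SimplexCategory.mono_iff_injective.1 inferInstance
  clear_value e d
  generalize Limits.image (i ≫ f) = I at *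
  subst hq
  have h1 : _root_.stdSimplex.map d (_root_.stdSimplex.map e t') =
      _root_.stdSimplex.map f (_root_.stdSimplex.map i t') := by
    rw [_root_.stdSimplex.map_comp_apply, _root_.stdSimplex.map_comp_apply]
    congr 1
    have := congrArg (fun h : ⦋k⦌ ⟶ ⦋m⦌ => (h : Fin (k + 1) → Fin (m + 1))) hed
    exact this
  obtain ⟨rfl, h2, h3⟩ := TopSimplex.face_unique hj hd' ha (ht'.map he')
    (hja.trans h1.symm)
  dsimp only at h2 h3
  subst h2 h3
  refine ⟨k, i, e ≫ g, t', hi, hg.comp he', ht', hy, rfl, ?_, ?_⟩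
  · rw [← hga, _root_.stdSimplex.map_comp_apply]
    rfl
  · have h5 : X.map i.op (X.map f.op σ) = X.map (i ≫ f).op σ := by simp
    rw [h5, ← hed]
    simp [he]

/-- The normal form of a point of the realization of a simplicial set. -/
theorem exists_normalForm (X : SSet.{u}) :
    ∃ N : SSet.toTop.obj X → Σ m, X _⦋m⦌ × TopSimplex m,
      ∀ (n : ℕ) (σ : X _⦋n⦌) t, IsNormalForm σ t (N (simplexMap σ t)) := by
  -- The indiscrete topology turns the universal property into one for arbitrary functions, so
  -- well-definedness on the realization is just compatibility on simplices.
  let _ : TopologicalSpace (Σ m, X _⦋m⦌ × TopSimplex m) := ⊤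
  choose N hN using fun (n : ℕ) (σ : X _⦋n⦌) t => exists_isNormalForm σ t
  obtain ⟨F, hF, -⟩ := existsUnique_desc (X := X) (Σ m, X _⦋m⦌ × TopSimplex m)
    (fun n σ => ⟨N n σ, continuous_top⟩) (fun f σ t => (hN _ _ _).unique (hN _ _ _).map)
  refine ⟨F, fun n σ t => ?_⟩
  rw [hF]
  exact hN n σ t

/-- The normal form of a point of the realization of a simplicial set. -/
noncomputable def normalForm (x : SSet.toTop.obj X) : Σ m, X _⦋m⦌ × TopSimplex m :=
  (exists_normalForm X).choose x

theorem isNormalForm {n : ℕ} (σ : X _⦋n⦌) (t : TopSimplex n) :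
    IsNormalForm σ t (normalForm (simplexMap σ t)) := (exists_normalForm X).choose_spec n σ t

theorem simplexMap_normalForm (x : SSet.toTop.obj X) :
    simplexMap (normalForm x).2.1 (normalForm x).2.2 = x := by
  obtain ⟨n, σ, t, rfl⟩ := exists_simplexMap x
  obtain ⟨k, i, f, t', hi, hf, ht', hy, hit, hft, he⟩ := isNormalForm σ t
  rw [← hft, ← simplexMap_map, ← he, simplexMap_map, hit]

theorem normalForm_mem_nonDegenerate (x : SSet.toTop.obj X) :
    (normalForm x).2.1 ∈ X.nonDegenerate (normalForm x).1 := by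
  obtain ⟨n, σ, t, rfl⟩ := exists_simplexMap x
  obtain ⟨k, i, f, t', hi, hf, ht', hy, hit, hft, he⟩ := isNormalForm σ t
  exact hy

theorem normalForm_simplexMap {n : ℕ} {σ : X _⦋n⦌} {t : TopSimplex n}
    (hσ : σ ∈ X.nonDegenerate n) (ht : t.IsInterior) : normalForm (simplexMap σ t) = ⟨n, σ, t⟩ :=
  (isNormalForm σ t).unique ⟨n, 𝟙 _, 𝟙 _, t, Function.injective_id, Function.surjective_id, ht, hσ,
    _root_.stdSimplex.map_id_apply t, _root_.stdSimplex.map_id_apply t, rfl⟩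

theorem normalForm_dim_le {n : ℕ} (σ : X _⦋n⦌) (t : TopSimplex n) :
    (normalForm (simplexMap σ t)).1 ≤ n := by
  obtain ⟨k, i, f, t', hi, hf, ht', hy, hit, hft, he⟩ := isNormalForm σ t
  have h1 := Fintype.card_le_of_injective _ hi
  have h2 := Fintype.card_le_of_surjective _ hf
  simp at h1 h2
  omega

/-- Induction on the dimension of the test simplex. A degenerate simplex factors through a smaller
one. A nondegenerate simplex of dimension at least `n` has no interior point over `A`, so its
preimage is a finite union of compact sets coming from simplices of smaller dimension. -/
theorem isClosed_of_nonDegenerate {A : Set (SSet.toTop.obj X)} {n : ℕ}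
    (hA : ∀ x ∈ A, (normalForm x).1 < n)
    (h : ∀ m < n, ∀ σ ∈ X.nonDegenerate m, IsClosed (simplexMap σ ⁻¹' A)) : IsClosed A := by
  rw [isClosed_iff_simplexMap]
  intro k
  induction k using Nat.strong_induction_on with
  | _ k ih =>
    intro σ
    by_cases hσ : σ ∈ X.nonDegenerate k
    · rcases lt_or_ge k n with hk | hk
      · exact h k hk σ hσ
      have hint : ∀ t ∈ simplexMap σ ⁻¹' A, ¬ TopSimplex.IsInterior t := fun t ht hi => by
        have := hA _ ht
        rw [normalForm_simplexMap hσ hi] at this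
        exact absurd this (not_lt.2 hk)
      have he : simplexMap σ ⁻¹' A = ⋃ p : (Σ l : Fin k, ⦋l.1⦌ ⟶ ⦋k⦌),
          (_root_.stdSimplex.map p.2 : TopSimplex p.1 → TopSimplex k) ''
            (simplexMap (X.map p.2.op σ) ⁻¹' A) := by
        ext t
        simp only [Set.mem_iUnion, Set.mem_image, Set.mem_preimage]
        constructor
        · intro ht
          obtain ⟨l, i, s, hi, hs, rfl⟩ := t.exists_face
          have hl : l < k := by
            have h1 := Fintype.card_le_of_injective _ hi
            simp at h1
            refine lt_of_le_of_ne h1 ?_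
            rintro rfl
            exact hint _ ht (hs.map (Finite.surjective_of_injective hi))
          refine ⟨⟨⟨l, hl⟩, i⟩, s, ?_, rfl⟩
          dsimp only
          rwa [simplexMap_map]
        · rintro ⟨⟨⟨l, hl⟩, i⟩, s, hs, rfl⟩
          rwa [simplexMap_map] at hs
      rw [he]
      have hfin : ∀ l : ℕ, Finite (⦋l⦌ ⟶ ⦋k⦌) := fun l =>
        Finite.of_injective (fun f : ⦋l⦌ ⟶ ⦋k⦌ => (f : Fin (l + 1) → Fin (k + 1)))
          fun f g hfg => by
            ext j : 3
            exact congrFun hfg j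
      have := fun l : Fin k => hfin l.1
      refine isClosed_iUnion_of_finite fun p => ?_
      exact ((ih p.1.1 p.1.2 _).isCompact.image (_root_.stdSimplex.continuous_map _)).isClosed
    · rw [← mem_degenerate_iff_notMem_nonDegenerate] at hσ
      obtain ⟨m, hm, f, τ, rfl⟩ := hσ
      have : simplexMap (X.map f.op τ) ⁻¹' A =
          (_root_.stdSimplex.map f : TopSimplex k → TopSimplex m) ⁻¹' (simplexMap τ ⁻¹' A) := by
        ext t
        simp only [Set.mem_preimage, simplexMap_map]
      rw [this]
      exact (ih m hm τ).preimage (_root_.stdSimplex.continuous_map _)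

theorem isClosed_normalForm_dim_lt (X : SSet.{u}) (n : ℕ) :
    IsClosed {x | (normalForm (X := X) x).1 < n} :=
  isClosed_of_nonDegenerate (n := n) (fun x hx => hx) fun m hm σ _ => by
    convert isClosed_univ
    ext t
    simpa using (normalForm_dim_le σ t).trans_lt hm

/-- The action on the nondegenerate simplices. -/
abbrev nonDegenerateAction {M : Type v} [Monoid M] (act : M → (X ⟶ X)) (h1 : act 1 = 𝟙 X)
    (hmul : ∀ m n, act (m * n) = act n ≫ act m)
    (hnd : ∀ m (n : ℕ), ∀ σ ∈ X.nonDegenerate n, (act m).app (op ⦋n⦌) σ ∈ X.nonDegenerate n)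
    (n : ℕ) : MulAction M (X.nonDegenerate n) where
  smul m σ := ⟨(act m).app (op ⦋n⦌) σ.1, hnd m n σ.1 σ.2⟩
  one_smul σ := Subtype.ext (by
    change (act 1).app (op ⦋n⦌) σ.1 = σ.1
    rw [h1]
    rfl)
  mul_smul m m' σ := Subtype.ext (by
    change (act (m * m')).app (op ⦋n⦌) σ.1 = _
    rw [hmul]
    rfl)

/-- The homeomorphism of the ball with the standard simplex. -/
noncomputable def ballHomeo (n : ℕ) : Ball n ≃ₜ TopSimplex n :=
  (TopSimplex.exists_homeomorph_ball n).choose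

theorem norm_lt_one_iff {n : ℕ} (y : Ball n) :
    ‖y.1‖ < 1 ↔ TopSimplex.IsInterior (ballHomeo n y) :=
  (TopSimplex.exists_homeomorph_ball n).choose_spec y

theorem normalForm_dim_lt {n : ℕ} {σ : X _⦋n⦌} {t : TopSimplex n} (ht : ¬ t.IsInterior) :
    (normalForm (simplexMap σ t)).1 < n := by
  refine lt_of_le_of_ne (normalForm_dim_le σ t) fun h => ht ?_
  obtain ⟨k, i, f, t', hi, hf, ht', hy, hit, hft, he⟩ := isNormalForm σ t
  have h1 := Fintype.card_le_of_injective _ hi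
  have h2 := Fintype.card_le_of_surjective _ hf
  simp at h1 h2
  obtain rfl : k = n := by omega
  rw [← hit]
  exact ht'.map (Finite.surjective_of_injective hi)

/-- The cell structure on the realization of a simplicial set with an action of `M` that
preserves the nondegenerate simplices. -/
noncomputable def mcwComplex {M : Type v} [Monoid M] [MulAction M (SSet.toTop.obj X)]
    (act : M → (X ⟶ X)) (h1 : act 1 = 𝟙 X) (hmul : ∀ m n, act (m * n) = act n ≫ act m)
    (hnd : ∀ m (n : ℕ), ∀ σ ∈ X.nonDegenerate n, (act m).app (op ⦋n⦌) σ ∈ X.nonDegenerate n)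
    (hact : ∀ m (x : SSet.toTop.obj X), m • x = SSet.toTop.map (act m) x) :
    MCWComplex M (SSet.toTop.obj X) where
  cell n := X.nonDegenerate n
  cellAction := nonDegenerateAction act h1 hmul hnd
  skel n := {x | (normalForm x).1 < n}
  char n p y := simplexMap p.1 (ballHomeo n y)
  continuous_char n p := (simplexMap p.1).continuous.comp (ballHomeo n).continuous
  char_smul n m p y := by
    rw [hact, toTop_map_simplexMap]
    rfl
  skel_zero := by simp
  skel_succ n := by
    ext x
    simp only [Set.mem_union, Set.mem_iUnion, Set.mem_range, Set.mem_ofPred_eq]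
    constructor
    · intro hx
      rcases Nat.lt_succ_iff_lt_or_eq.1 hx with h | h
      · exact Or.inl h
      · subst h
        refine Or.inr ⟨⟨_, normalForm_mem_nonDegenerate x⟩, (ballHomeo _).symm (normalForm x).2.2, ?_⟩
        rw [Homeomorph.apply_symm_apply]
        exact simplexMap_normalForm x
    · rintro (h | ⟨p, y, rfl⟩)
      · exact h.trans (Nat.lt_succ_self n)
      · exact Nat.lt_succ_of_le (normalForm_dim_le _ _)
  char_sphere n p y hy := normalForm_dim_lt (by rw [← norm_lt_one_iff, hy]; exact lt_irrefl _)
  char_interior n p y hy := by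
    rw [norm_lt_one_iff] at hy
    simp [normalForm_simplexMap p.2 hy]
  char_injective n p p' y y' hy hy' h := by
    rw [norm_lt_one_iff] at hy hy'
    have := congrArg normalForm h
    rw [normalForm_simplexMap p.2 hy, normalForm_simplexMap p'.2 hy'] at this
    simp only [Sigma.mk.injEq, heq_eq_eq, Prod.mk.injEq, true_and] at this
    exact ⟨Subtype.ext this.1, (ballHomeo n).injective this.2⟩
  isClosed_skel_succ n K hK := by
    refine ⟨fun h => ⟨h.inter (isClosed_normalForm_dim_lt X n), fun p => h.preimage
      ((simplexMap p.1).continuous.comp (ballHomeo n).continuous)⟩, fun ⟨h, h'⟩ => ?_⟩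
    refine isClosed_of_nonDegenerate (n := n + 1) hK fun m hm σ hσ => ?_
    rcases Nat.lt_succ_iff_lt_or_eq.1 hm with hm | rfl
    · convert h.preimage (simplexMap σ).continuous using 1
      ext t
      simpa using fun _ => (normalForm_dim_le σ t).trans_lt hm
    · have := h' ⟨σ, hσ⟩
      have h2 := this.preimage (ballHomeo m).symm.continuous
      convert h2 using 1
      ext t
      simp
  iUnion_skel := by
    ext x
    simpa using ⟨_, Nat.lt_succ_self _⟩
  isClosed_iff K := by
    refine ⟨fun h n => h.inter (isClosed_normalForm_dim_lt X n), fun h => isClosed_iff_simplexMap.2 fun n σ => ?_⟩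
    convert (h (n + 1)).preimage (simplexMap σ).continuous using 1
    ext t
    simpa using fun _ => Nat.lt_succ_of_le (normalForm_dim_le σ t)

end SSet

/-! ### The complex `|EM|`: free cells, quotient `|BM|`, contractibility -/

namespace RightCayley

open Simplicial Opposite

variable {M : Type u} [Monoid M]

/-- The functor from the right Cayley graph category that forgets the objects. -/
def proj (M : Type u) [Monoid M] : RightCayley M ⥤ SingleObj Mᵐᵒᵖ where
  obj _ := SingleObj.star _
  map f := MulOpposite.op f.1
  map_id _ := rfl
  map_comp _ _ := rfl

/-- The projection from `EM` to `BM`. -/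
def projNerve (M : Type u) [Monoid M] : EM M ⟶ BM M where
  app _ := TypeCat.ofHom fun σ : ComposableArrows (RightCayley M) _ => σ ⋙ proj M
  naturality _ _ _ := rfl

/-- The label of the arrow from the vertex `i` to the vertex `j` of a simplex of `BM`. -/
def label {n : ℕ} (τ : BM M _⦋n⦌) {i j : Fin (n + 1)} (h : i ≤ j) : M :=
  MulOpposite.unop (τ.map (homOfLE h))

theorem label_comp {n : ℕ} (τ : BM M _⦋n⦌) {i j k : Fin (n + 1)} (h : i ≤ j) (h' : j ≤ k) :
    label τ h * label τ h' = label τ (h.trans h') :=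
  (congrArg MulOpposite.unop (τ.map_comp (homOfLE h) (homOfLE h'))).symm

theorem label_of_eq {n : ℕ} (τ : BM M _⦋n⦌) {i j : Fin (n + 1)} (h : i ≤ j) (e : i = j) :
    label τ h = 1 := by
  subst e
  exact congrArg MulOpposite.unop (τ.map_id i)

theorem label_map {n m : ℕ} (f : ⦋n⦌ ⟶ ⦋m⦌) (τ : BM M _⦋m⦌) {i j : Fin (n + 1)} (h : i ≤ j) :
    label ((BM M).map f.op τ) h = label τ (f.toOrderHom.monotone h) := rfl

theorem ext_label {n : ℕ} {τ τ' : BM M _⦋n⦌}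
    (h : ∀ (i j : Fin (n + 1)) (hij : i ≤ j), label τ hij = label τ' hij) : τ = τ' := by
  refine CategoryTheory.Functor.hext (fun _ => rfl) fun i j f => heq_of_eq ?_
  exact MulOpposite.unop_injective (h i j (leOfHom f))

theorem obj_mul_label {n : ℕ} (σ : EM M _⦋n⦌) {i j : Fin (n + 1)} (h : i ≤ j) :
    (σ.obj i).val * label ((projNerve M).app _ σ) h = (σ.obj j).val :=
  (σ.map (homOfLE h)).2

/-- Every vertex of a simplex is its first vertex times the label of an edge. -/
theorem ext_projNerve {n : ℕ} {σ σ' : EM M _⦋n⦌} (h : (σ.obj 0).val = (σ'.obj 0).val)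
    (h' : (projNerve M).app _ σ = (projNerve M).app _ σ') : σ = σ' := by
  have hobj : ∀ i, σ.obj i = σ'.obj i := fun i => by
    apply RightCayley.ext
    rw [← obj_mul_label σ (Fin.zero_le i), ← obj_mul_label σ' (Fin.zero_le i), h, h']
  refine CategoryTheory.Functor.hext hobj fun i j f => ?_
  have hm : (σ.map f).1 = (σ'.map f).1 := by
    have := congrArg (fun τ : BM M _⦋n⦌ => label τ (leOfHom f)) h'
    exact this
  exact (Subtype.heq_iff_coe_eq fun m => by rw [hobj i, hobj j]).2 hm

/-- The simplex of `EM` with first vertex `x` and the given labels. -/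
def liftSimplex {n : ℕ} (x : M) (τ : BM M _⦋n⦌) : EM M _⦋n⦌ where
  obj i := ⟨x * label τ (Fin.zero_le i)⟩
  map {i j} f := ⟨label τ (leOfHom f), by
    dsimp only
    rw [mul_assoc, label_comp]⟩
  map_id i := Subtype.ext (label_of_eq τ _ rfl)
  map_comp f g := Subtype.ext (label_comp τ _ _).symm

theorem liftSimplex_obj_zero {n : ℕ} (x : M) (τ : BM M _⦋n⦌) :
    ((liftSimplex x τ).obj 0).val = x := by
  change x * label τ _ = x
  rw [label_of_eq τ _ rfl, mul_one]

theorem projNerve_liftSimplex {n : ℕ} (x : M) (τ : BM M _⦋n⦌) :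
    (projNerve M).app _ (liftSimplex x τ) = τ := ext_label fun _ _ _ => rfl

/-- The action of `M` on `EM`. -/
def leftMulNerve (m : M) : EM M ⟶ EM M := nerveMap (leftMul m)

theorem leftMulNerve_liftSimplex {n : ℕ} (σ : EM M _⦋n⦌) :
    (leftMulNerve (σ.obj 0).val).app _ (liftSimplex 1 ((projNerve M).app _ σ)) = σ := by
  refine ext_projNerve ?_ ?_
  · change (σ.obj 0).val * ((liftSimplex 1 ((projNerve M).app _ σ)).obj 0).val = _
    rw [liftSimplex_obj_zero, mul_one]
  · exact projNerve_liftSimplex (1 : M) _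

/-- Degeneracy is visible in the labels alone. Since left multiplication keeps the labels, it
preserves nondegenerate simplices even when it is not injective on `M`. -/
theorem projNerve_mem_degenerate_iff {n : ℕ} (σ : EM M _⦋n⦌) :
    (projNerve M).app _ σ ∈ (BM M).degenerate n ↔ σ ∈ (EM M).degenerate n := by
  refine ⟨fun h => ?_, fun h => SSet.degenerate_app_apply h _⟩
  obtain ⟨k, f, hf, τ, hτ⟩ := (BM M).exists_nonDegenerate ((projNerve M).app _ σ)
  have hk : k < n := by
    refine lt_of_le_of_ne (SimplexCategory.len_le_of_epi f) ?_
    rintro rfl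
    have : f = 𝟙 _ := SimplexCategory.eq_id_of_epi f
    subst this
    rw [op_id, (BM M).map_id] at hτ
    have := τ.2
    rw [SSet.mem_nonDegenerate_iff_notMem_degenerate] at this
    rw [hτ] at h
    exact this h
  -- If the labels factor through `f`, then `σ` is recovered from its face along a section `d` of
  -- `f`. The first vertices agree because `0` and `d (f 0)` have the same image under `f`, so the
  -- label between them is `1`.
  obtain ⟨⟨d, hd⟩⟩ := isSplitEpi_of_epi f
  refine ⟨k, hk, f, (EM M).map d.op σ, ?_⟩
  have hnat : (projNerve M).app _ ((EM M).map f.op ((EM M).map d.op σ)) =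
      (BM M).map f.op ((BM M).map d.op ((projNerve M).app _ σ)) := rfl
  refine ext_projNerve ?_ ?_
  · change (σ.obj (d (f 0))).val = _
    rw [← obj_mul_label σ (Fin.zero_le (d (f 0))), hτ, label_map, label_of_eq, mul_one]
    exact (SimplexCategory.congr_toOrderHom_apply hd (f 0)).symm
  · rw [hnat, hτ]
    have : d ≫ f = 𝟙 _ := hd
    simp only [← Functor.map_comp_apply, ← op_comp]
    rw [this, Category.comp_id]

/-- The free cell structure on `|EM|`. -/
noncomputable def mcwComplex (M : Type u) [Monoid M] : MCWComplex M (EMSpace M) :=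
  SSet.mcwComplex leftMulNerve (by rw [leftMulNerve, leftMul_one]; rfl)
    (fun m n => by rw [leftMulNerve, leftMul_mul]; rfl)
    (fun m n σ hσ => by
      rw [SSet.mem_nonDegenerate_iff_notMem_degenerate, ← projNerve_mem_degenerate_iff] at hσ ⊢
      exact hσ)
    (fun m x => rfl)

theorem isFree_mcwComplex (M : Type u) [Monoid M] : (mcwComplex M).IsFree := by
  intro n
  refine ⟨{σ | (σ.1.obj 0).val = 1}, ?_, ?_⟩
  · rintro ⟨m, σ, hσ⟩ ⟨m', σ', hσ'⟩ h
    have hσ1 : (σ.1.obj 0).val = 1 := hσ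
    have hσ1' : (σ'.1.obj 0).val = 1 := hσ'
    have h' : (leftMulNerve m).app _ σ.1 = (leftMulNerve m').app _ σ'.1 := congrArg Subtype.val h
    have h1 : m * (σ.1.obj 0).val = m' * (σ'.1.obj 0).val :=
      congrArg (fun ρ : EM M _⦋n⦌ => (ρ.obj 0).val) h'
    rw [hσ1, hσ1', mul_one, mul_one] at h1
    have h2 : (projNerve M).app _ ((leftMulNerve m).app _ σ.1) =
      (projNerve M).app _ ((leftMulNerve m').app _ σ'.1) := by rw [h']
    have h3 : σ = σ' := Subtype.ext (ext_projNerve (hσ1.trans hσ1'.symm) h2)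
    subst h1 h3
    rfl
  · intro σ
    refine ⟨⟨(σ.1.obj 0).val, ⟨liftSimplex 1 ((projNerve M).app _ σ.1), ?_⟩,
      liftSimplex_obj_zero 1 _⟩, Subtype.ext (leftMulNerve_liftSimplex σ.1)⟩
    have := σ.2
    rw [SSet.mem_nonDegenerate_iff_notMem_degenerate, ← projNerve_mem_degenerate_iff] at this ⊢
    rwa [projNerve_liftSimplex]

theorem smul_simplexMap (m : M) {n : ℕ} (σ : EM M _⦋n⦌) (t : TopSimplex n) :
    m • (SSet.simplexMap σ t : EMSpace M) = SSet.simplexMap ((leftMulNerve m).app _ σ) t :=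
  SSet.toTop_map_simplexMap (leftMulNerve m) σ t

/-- The quotient of `|EM|` by `M` is `|BM|`. -/
theorem nonempty_weakOrbits_homeomorph (M : Type u) [Monoid M] :
    Nonempty (WeakOrbits M (EMSpace M) ≃ₜ BMSpace M) := by
  let a : C(WeakOrbits M (EMSpace M), BMSpace M) :=
    WeakOrbits.lift (SSet.toTop.map (projNerve M)).hom fun m x => by
      obtain ⟨n, σ, t, rfl⟩ := SSet.exists_simplexMap x
      rw [smul_simplexMap]
      exact (SSet.toTop_map_simplexMap (projNerve M) _ t).trans
        (SSet.toTop_map_simplexMap (projNerve M) σ t).symm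
  have ha {n : ℕ} (σ : EM M _⦋n⦌) (t : TopSimplex n) :
      a (WeakOrbits.mk M (SSet.simplexMap σ t)) =
        SSet.simplexMap ((projNerve M).app _ σ) t := SSet.toTop_map_simplexMap (projNerve M) _ t
  have hlift {n : ℕ} (σ : EM M _⦋n⦌) (t : TopSimplex n) :
      WeakOrbits.mk M (SSet.simplexMap (liftSimplex 1 ((projNerve M).app _ σ)) t : EMSpace M) =
        WeakOrbits.mk M (SSet.simplexMap σ t) := by
    conv_rhs => rw [← leftMulNerve_liftSimplex σ, ← smul_simplexMap, WeakOrbits.mk_smul]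
  -- Lifting simplices of `BM` to start at `1` is not simplicial, since a face may have another
  -- first vertex. The discrepancy is a left multiplication, which disappears in the quotient.
  obtain ⟨b, hb, -⟩ := SSet.existsUnique_desc (X := BM M) (WeakOrbits M (EMSpace M))
    (fun n τ => ⟨fun t => WeakOrbits.mk M (SSet.simplexMap (liftSimplex 1 τ) t),
      WeakOrbits.continuous_mk.comp (SSet.simplexMap (liftSimplex (1 : M) τ)).continuous⟩)
    (fun f τ t => by
      have := hlift ((EM M).map f.op (liftSimplex 1 τ)) t
      rw [SSet.simplexMap_map] at this
      refine Eq.trans ?_ this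
      dsimp only [ContinuousMap.coe_mk]
      congr 4)
  refine ⟨⟨⟨a, b, fun q => ?_, fun x => ?_⟩, a.continuous, b.continuous⟩⟩
  · obtain ⟨x, rfl⟩ := WeakOrbits.mk_surjective q
    obtain ⟨n, σ, t, rfl⟩ := SSet.exists_simplexMap x
    rw [ha, hb]
    exact hlift σ t
  · obtain ⟨n, τ, t, rfl⟩ := SSet.exists_simplexMap x
    rw [hb]
    refine (ha _ t).trans ?_
    rw [projNerve_liftSimplex]

/-- The join of the vertex `1` with a simplex. -/
def cone {n : ℕ} (σ : EM M _⦋n⦌) : EM M _⦋n + 1⦌ :=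
  ComposableArrows.precomp σ (X := ⟨1⟩) ⟨σ.left.val, one_mul _⟩

theorem cone_obj_zero {n : ℕ} (σ : EM M _⦋n⦌) : ((cone σ).obj 0).val = 1 := rfl

/-- Extension of a monotone map by a least element. -/
def addBot {n m : ℕ} (f : ⦋n⦌ ⟶ ⦋m⦌) : ⦋n + 1⦌ ⟶ ⦋m + 1⦌ :=
  SimplexCategory.mkHom ⟨Fin.cases 0 fun i => (f i).succ, fun i j h => by
    induction i using Fin.cases with
    | zero => simp
    | succ i =>
      induction j using Fin.cases with
      | zero => simp at h
      | succ j => exact Fin.succ_le_succ_iff.2 (f.toOrderHom.monotone (Fin.succ_le_succ_iff.1 h))⟩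

/-- The two simplices have the same first vertex `1`, so an edge leaving it is labelled by its
endpoint; all other labels come from `σ`. -/
theorem cone_map {n m : ℕ} (f : ⦋n⦌ ⟶ ⦋m⦌) (σ : EM M _⦋m⦌) :
    cone ((EM M).map f.op σ) = (EM M).map (addBot f).op (cone σ) := by
  refine ext_projNerve rfl (ext_label fun i j h => ?_)
  induction i using Fin.cases with
  | zero =>
    induction j using Fin.cases with
    | zero => rfl
    | succ j =>
      have h1 := obj_mul_label (cone ((EM M).map f.op σ)) h
      have h2 := obj_mul_label ((EM M).map (addBot f).op (cone σ)) h
      rw [cone_obj_zero, one_mul] at h1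
      rw [show (((EM M).map (addBot f).op (cone σ)).obj 0).val = 1 from rfl, one_mul] at h2
      exact h1.trans h2.symm
  | succ i =>
    induction j using Fin.cases with
    | zero => simp at h
    | succ j => rfl

/-- The point dividing the segment from the vertex `0` to the point `t` of the opposite face. -/
noncomputable def conePoint {n : ℕ} (t : TopSimplex n) (s : unitInterval) : TopSimplex (n + 1) :=
  ⟨Fin.cons s.1 fun i => (1 - s.1) * t i, fun i => by
    refine Fin.cases ?_ (fun j => ?_) i
    · simpa using s.2.1
    · simpa using mul_nonneg (sub_nonneg.2 s.2.2) (stdSimplex.zero_le t j), by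
    simp [Fin.sum_univ_succ, ← Finset.mul_sum]⟩

theorem conePoint_apply_zero {n : ℕ} (t : TopSimplex n) (s : unitInterval) :
    conePoint t s 0 = s.1 := rfl

theorem conePoint_apply_succ {n : ℕ} (t : TopSimplex n) (s : unitInterval) (i : Fin (n + 1)) :
    conePoint t s i.succ = (1 - s.1) * t i := rfl

theorem continuous_conePoint (n : ℕ) :
    Continuous fun p : TopSimplex n × unitInterval => conePoint p.1 p.2 := by
  refine Continuous.subtype_mk (continuous_pi fun i => ?_) _
  refine Fin.cases ?_ (fun j => ?_) i
  · exact continuous_subtype_val.comp continuous_snd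
  · exact (continuous_const.sub (continuous_subtype_val.comp continuous_snd)).mul
      ((continuous_apply j).comp (continuous_subtype_val.comp continuous_fst))

theorem map_conePoint {n m : ℕ} (f : ⦋n⦌ ⟶ ⦋m⦌) (t : TopSimplex n) (s : unitInterval) :
    stdSimplex.map (addBot f) (conePoint t s) = conePoint (n := m) (stdSimplex.map f t) s := by
  apply stdSimplex.ext
  funext j
  change stdSimplex.map (addBot f) (conePoint t s) j = conePoint (n := m) (stdSimplex.map f t) s j
  have h0 : addBot f 0 = 0 := rfl
  have hs (i : Fin (n + 1)) : addBot f i.succ = (f i).succ := rfl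
  rw [TopSimplex.map_apply, Finset.sum_filter, Fin.sum_univ_succ, h0]
  simp only [hs]
  induction j using Fin.cases with
  | zero => simp [conePoint_apply_zero, Fin.succ_ne_zero]
  | succ j =>
    rw [conePoint_apply_succ, TopSimplex.map_apply, Finset.sum_filter, Finset.mul_sum]
    simp [(Fin.succ_ne_zero _).symm, conePoint_apply_succ]

/-- Each point is moved along the segment to the cone vertex `1`. The segments fit together by
`cone_map` and `map_conePoint`, and the homotopy is obtained as a map from the realization into the
path space. -/
theorem contractibleSpace (M : Type u) [Monoid M] : ContractibleSpace (EMSpace M) := by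
  let c (n : ℕ) (σ : EM M _⦋n⦌) : C(TopSimplex n × unitInterval, EMSpace M) :=
    (SSet.simplexMap (cone σ)).comp ⟨_, continuous_conePoint n⟩
  obtain ⟨F, hF, -⟩ := SSet.existsUnique_desc (X := EM M) C(unitInterval, EMSpace M)
    (fun n σ => (c n σ).curry) (fun f σ t => by
      ext s
      change SSet.simplexMap (cone _) (conePoint t s) = SSet.simplexMap _ (conePoint _ s)
      rw [cone_map, SSet.simplexMap_map, map_conePoint])
  let v : EM M _⦋0⦌ := ComposableArrows.mk₀ ⟨1⟩
  refine (contractible_iff_id_nullhomotopic _).2 ⟨SSet.simplexMap v default, ⟨?_⟩⟩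
  refine
    { toContinuousMap := F.uncurry.comp ⟨Prod.swap, continuous_swap⟩
      map_zero_left := fun x => ?_
      map_one_left := fun x => ?_ }
  · obtain ⟨n, σ, t, rfl⟩ := SSet.exists_simplexMap x
    change F (SSet.simplexMap σ t) 0 = SSet.simplexMap σ t
    rw [hF]
    change SSet.simplexMap (cone σ) (conePoint t 0) = _
    have h1 : (EM M).map (SimplexCategory.δ 0).op (cone σ) = σ :=
      ext_projNerve rfl (ext_label fun _ _ _ => rfl)
    rw [← h1, SSet.simplexMap_map, h1]
    congr 1
    apply stdSimplex.ext
    funext i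
    change conePoint t 0 i = stdSimplex.map (SimplexCategory.δ 0) t i
    have hd : ∀ j : Fin (n + 1), (SimplexCategory.δ (0 : Fin (n + 2))) j = j.succ := fun j => rfl
    induction i using Fin.cases with
    | zero =>
      rw [TopSimplex.map_apply_of_notMem]
      · rfl
      · rintro ⟨j, hj⟩
        exact Fin.succ_ne_zero j hj
    | succ i =>
      rw [← hd, TopSimplex.map_apply_of_injective
        (f := SimplexCategory.δ (0 : Fin (n + 2))) (fun i j h => Fin.succ_injective _ h), hd,
        conePoint_apply_succ]
      simp
  · obtain ⟨n, σ, t, rfl⟩ := SSet.exists_simplexMap x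
    change F (SSet.simplexMap σ t) 1 = SSet.simplexMap v default
    rw [hF]
    change SSet.simplexMap (cone σ) (conePoint t 1) = _
    let d : ⦋0⦌ ⟶ ⦋n + 1⦌ := SimplexCategory.const _ _ 0
    have h1 : (EM M).map d.op (cone σ) = v :=
      ext_projNerve rfl (ext_label fun i j h => by
        rw [label_of_eq _ _ (Subsingleton.elim (α := Fin 1) i j),
          label_of_eq _ _ (Subsingleton.elim (α := Fin 1) i j)])
    rw [← h1, SSet.simplexMap_map]
    congr 1
    apply stdSimplex.ext
    funext i
    change conePoint t 1 i = stdSimplex.map d default i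
    have hd : d 0 = 0 := rfl
    induction i using Fin.cases with
    | zero =>
      rw [← hd, TopSimplex.map_apply_of_injective 
        (fun a b _ => Subsingleton.elim (α := Fin 1) a b), hd, conePoint_apply_zero]
      exact (stdSimplex.eq_one_of_unique (X := Fin 1) default 0).symm
    | succ i =>
      rw [TopSimplex.map_apply_of_notMem, conePoint_apply_succ]
      · simp
      · rintro ⟨j, hj⟩
        exact Fin.succ_ne_zero i hj.symm

theorem isEquivariantClassifyingSpace (M : Type u) [Monoid M] :
    (mcwComplex M).IsEquivariantClassifyingSpace :=
  ⟨fun n => (isFree_mcwComplex M n).isProjectiveMSet, contractibleSpace M⟩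

end RightCayley

/-! ### Classical CW complexes and cell structures on coverings -/

namespace MCWComplex

open Metric Set

section Classical

variable {K : Type v} [TopologicalSpace K]

/-- The characteristic map of a cell of a CW complex, in Euclidean form. -/
noncomputable def cwChar [CWComplex (univ : Set K)] (n : ℕ)
    (c : RelCWComplex.cell (univ : Set K) n) (y : Ball n) : K :=
  RelCWComplex.map n c ((maxBallHomeo n).symm y).1

variable [CWComplex (univ : Set K)]

theorem norm_maxBallHomeo_symm_lt {n : ℕ} (y : Ball n) :
    ‖((maxBallHomeo n).symm y).1‖ < 1 ↔ ‖y.1‖ < 1 := by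
  rw [← norm_maxBallHomeo_lt, Homeomorph.apply_symm_apply]

theorem norm_maxBallHomeo_symm {n : ℕ} (y : Ball n) :
    ‖((maxBallHomeo n).symm y).1‖ = 1 ↔ ‖y.1‖ = 1 := by
  rw [← norm_maxBallHomeo, Homeomorph.apply_symm_apply]

theorem continuous_cwChar (n : ℕ) (c : RelCWComplex.cell (univ : Set K) n) :
    Continuous (cwChar n c) :=
  ((RelCWComplex.continuousOn n c).domRestrict).comp (maxBallHomeo n).symm.continuous

theorem range_cwChar (n : ℕ) (c : RelCWComplex.cell (univ : Set K) n) :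
    range (cwChar n c) = RelCWComplex.closedCell n c := by
  ext x
  constructor
  · rintro ⟨y, rfl⟩
    exact ⟨_, ((maxBallHomeo n).symm y).2, rfl⟩
  · rintro ⟨v, hv, rfl⟩
    exact ⟨maxBallHomeo n ⟨v, hv⟩, by rw [cwChar, Homeomorph.symm_apply_apply]⟩

theorem cwChar_mem_openCell {n : ℕ} (c : RelCWComplex.cell (univ : Set K) n) {y : Ball n}
    (hy : ‖y.1‖ < 1) : cwChar n c y ∈ RelCWComplex.openCell n c :=
  ⟨_, mem_ball_zero_iff.2 ((norm_maxBallHomeo_symm_lt y).2 hy), rfl⟩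

theorem image_cwChar_preimage {n : ℕ} (c : RelCWComplex.cell (univ : Set K) n) (A : Set K) :
    cwChar n c '' (cwChar n c ⁻¹' A) = A ∩ RelCWComplex.closedCell n c := by
  rw [image_preimage_eq_inter_range, range_cwChar]

/-- A CW complex as a complex with trivial action. -/
noncomputable def ofCWComplex [T2Space K] : @MCWComplex Unit _ K _ (unitAction K) :=
  letI := unitAction K
  { cell := RelCWComplex.cell (univ : Set K)
    cellAction := fun n => unitAction _
    skel := fun n => RelCWComplex.skeletonLT (univ : Set K) n
    char := cwChar
    continuous_char := continuous_cwChar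
    char_smul := fun _ _ _ _ => rfl
    skel_zero := by
      have := CWComplex.skeletonLT_zero_eq_empty (C := (univ : Set K))
      exact_mod_cast this
    skel_succ := fun n => by
      have := RelCWComplex.skeletonLT_union_iUnion_closedCell_eq_skeletonLT_succ
        (C := (univ : Set K)) n
      simp only [range_cwChar]
      rw [this]
      push_cast
      rfl
    char_sphere := fun n p y hy => RelCWComplex.cellFrontier_subset_skeletonLT n p
      ⟨_, mem_sphere_zero_iff_norm.2 ((norm_maxBallHomeo_symm y).2 hy), rfl⟩
    char_interior := fun n p y hy h => disjoint_left.1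
      (RelCWComplex.disjoint_skeletonLT_openCell le_rfl) h (cwChar_mem_openCell p hy)
    char_injective := fun n p p' y y' hy hy' h => by
      have hpp : p = p' := by
        by_contra hne
        refine disjoint_left.1 (RelCWComplex.disjoint_openCell_of_ne
          (n := n) (m := n) (i := p) (j := p') fun h' => hne ?_)
          (cwChar_mem_openCell p hy) (h ▸ cwChar_mem_openCell p' hy')
        simpa using h'
      subst hpp
      refine ⟨rfl, (maxBallHomeo n).symm.injective (Subtype.ext ?_)⟩
      refine (RelCWComplex.map n p).injOn ?_ ?_ h
      · rw [RelCWComplex.source_eq]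
        exact mem_ball_zero_iff.2 ((norm_maxBallHomeo_symm_lt y).2 hy)
      · rw [RelCWComplex.source_eq]
        exact mem_ball_zero_iff.2 ((norm_maxBallHomeo_symm_lt y').2 hy')
    isClosed_skel_succ := fun n A hA => by
      refine ⟨fun h => ⟨h.inter (RelCWComplex.skeletonLT (univ : Set K) n).closed,
        fun p => h.preimage (continuous_cwChar n p)⟩, fun ⟨h, h'⟩ => ?_⟩
      refine CWComplex.isClosed_of_disjoint_openCell_or_isClosed_inter_closedCell
        (C := (univ : Set K)) (subset_univ _) fun m _ c => ?_
      rcases lt_trichotomy m n with hm | rfl | hm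
      · right
        have hs : RelCWComplex.closedCell m c ⊆ RelCWComplex.skeletonLT (univ : Set K) n :=
          (RelCWComplex.closedCell_subset_skeletonLT m c).trans
            (RelCWComplex.skeletonLT_mono (by exact_mod_cast hm))
        have := h.inter (RelCWComplex.isClosed_closedCell (C := (univ : Set K)) (i := c))
        rwa [inter_assoc, inter_eq_self_of_subset_right hs] at this
      · right
        rw [← image_cwChar_preimage]
        exact ((h' c).isCompact.image (continuous_cwChar m c)).isClosed
      · left
        exact (RelCWComplex.disjoint_skeletonLT_openCell (by exact_mod_cast hm)).mono_left hA
    iUnion_skel := RelCWComplex.iUnion_skeletonLT_eq_complex (C := (univ : Set K))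
    isClosed_iff := fun A => by
      refine ⟨fun h n => h.inter (RelCWComplex.skeletonLT (univ : Set K) n).closed, fun h => ?_⟩
      rw [CWComplex.closed (univ : Set K) A (subset_univ _)]
      intro n c
      have hs := RelCWComplex.closedCell_subset_skeletonLT (C := (univ : Set K)) n c
      have := (h (n + 1)).inter (RelCWComplex.isClosed_closedCell (C := (univ : Set K)) (i := c))
      rwa [inter_assoc, inter_eq_self_of_subset_right (s := (RelCWComplex.skeletonLT (univ : Set K)
        ((n + 1 : ℕ) : ℕ∞) : Set K)) (by exact_mod_cast hs)] at this }

end Classical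

/-- A complex is a quotient of a disjoint union of balls, and local path connectedness passes to
quotients. -/
theorem locallyPathConnectedSpace {M : Type u} [Monoid M] {X : Type v} [TopologicalSpace X]
    [MulAction M X] (C : MCWComplex M X) : LocallyPathConnectedSpace X := by
  have h : IsQuotientMap (fun q : (Σ s : (Σ n, C.cell n), Ball s.1) => C.char q.1.1 q.1.2 q.2) := by
    refine isQuotientMap_iff_isClosed.2 ⟨fun x => ?_, fun A => ?_⟩
    · obtain ⟨n, p, y, -, rfl⟩ := C.exists_char x
      exact ⟨⟨⟨n, p⟩, y⟩, rfl⟩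
    · rw [C.isClosed_iff_char, isClosed_sigma_iff]
      exact ⟨fun h s => h s.1 s.2, fun h n p => h ⟨n, p⟩⟩
  exact h.locallyPathConnectedSpace

section Lift

variable {K : Type w} [TopologicalSpace K] [MulAction Unit K] (C : MCWComplex Unit K)
  {E : Type v} [TopologicalSpace E] {p : E → K} (hp : IsCoveringMap p)

/-- The centre of the ball. -/
def ballCentre (n : ℕ) : Ball n := ⟨0, by simp⟩

theorem norm_ballCentre (n : ℕ) : ‖(ballCentre n).1‖ < 1 := by simp [ballCentre]

include hp in
theorem existsUnique_lift_char {n : ℕ} (c : C.cell n) (y : Ball n) (e : E)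
    (he : p e = C.char n c y) :
    ∃! φ : C(Ball n, E), φ y = e ∧ ∀ z, p (φ z) = C.char n c z := by
  obtain ⟨φ, hφ, huniq⟩ := hp.existsUnique_continuousMap_lifts ⟨_, C.continuous_char n c⟩ y e he
  refine ⟨φ, ⟨hφ.1, fun z => congrFun hφ.2 z⟩, fun ψ hψ => huniq ψ ⟨hψ.1, funext hψ.2⟩⟩

/-- The cells of a covering space, represented by their centres. -/
def LiftCell (p : E → K) (n : ℕ) : Type v :=
  {e : E // ∃ c, p e = C.char n c (ballCentre n)}

variable {C}

/-- The cell below a cell of a covering space. -/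
noncomputable def LiftCell.base {n : ℕ} (e : C.LiftCell p n) : C.cell n := e.2.choose

omit [TopologicalSpace E] in
theorem LiftCell.base_spec {n : ℕ} (e : C.LiftCell p n) :
    p e.1 = C.char n e.base (ballCentre n) := e.2.choose_spec

omit [TopologicalSpace E] in
theorem LiftCell.base_eq {n : ℕ} (e : C.LiftCell p n) {c : C.cell n}
    (h : p e.1 = C.char n c (ballCentre n)) : e.base = c :=
  (C.char_injective n _ _ _ _ (norm_ballCentre n) (norm_ballCentre n)
    (e.base_spec.symm.trans h)).1

/-- The characteristic map of a cell of a covering space. -/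
noncomputable def liftChar (n : ℕ) (e : C.LiftCell p n) : C(Ball n, E) :=
  (C.existsUnique_lift_char hp e.base (ballCentre n) e.1 e.base_spec).choose

theorem liftChar_centre {n : ℕ} (e : C.LiftCell p n) : liftChar hp n e (ballCentre n) = e.1 :=
  (C.existsUnique_lift_char hp e.base (ballCentre n) e.1 e.base_spec).choose_spec.1.1

theorem map_liftChar {n : ℕ} (e : C.LiftCell p n) (y : Ball n) :
    p (liftChar hp n e y) = C.char n e.base y :=
  (C.existsUnique_lift_char hp e.base (ballCentre n) e.1 e.base_spec).choose_spec.1.2 y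

/-- Lifts of a characteristic map are determined by the image of the centre, because the ball is
connected. This makes deck transformations compatible with the lifted characteristic maps. -/
theorem eq_liftChar {n : ℕ} {c : C.cell n} {φ : C(Ball n, E)} (hφ : ∀ y, p (φ y) = C.char n c y)
    (e : C.LiftCell p n) (he : φ (ballCentre n) = e.1) : φ = liftChar hp n e := by
  have hc : e.base = c := e.base_eq (by rw [← he, hφ])
  refine (C.existsUnique_lift_char hp e.base (ballCentre n) e.1 e.base_spec).unique
    ⟨he, fun y => ?_⟩ ⟨liftChar_centre hp e, map_liftChar hp e⟩
  rw [hφ, hc]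

theorem exists_liftChar {n : ℕ} {c : C.cell n} {y : Ball n} {x : E} (h : p x = C.char n c y) :
    ∃ e : C.LiftCell p n, e.base = c ∧ liftChar hp n e y = x := by
  obtain ⟨φ, ⟨hφ, hφ'⟩, -⟩ := C.existsUnique_lift_char hp c y x h
  let e : C.LiftCell p n := ⟨φ (ballCentre n), c, hφ' _⟩
  refine ⟨e, e.base_eq (hφ' _), ?_⟩
  rw [← eq_liftChar hp hφ' e rfl, hφ]

/-- A point of `U \ A` over the cell `c` lies on a lift of that cell, and near it the lift stays in
`U \ A`. So closedness tested on lifted cells yields closedness tested on cells of `K`. -/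
theorem isClosed_preimage_compl_image {U A : Set E} (hU : IsOpen U) {n : ℕ}
    (hA : ∀ e : C.LiftCell p n, IsClosed (liftChar hp n e ⁻¹' A)) (c : C.cell n) :
    IsClosed (C.char n c ⁻¹' (p '' (U \ A))ᶜ) := by
  rw [preimage_compl, isClosed_compl_iff, isOpen_iff_mem_nhds]
  rintro y ⟨x, hx, hxy⟩
  obtain ⟨e, rfl, rfl⟩ := exists_liftChar hp hxy
  have hopen : IsOpen (liftChar hp n e ⁻¹' (U \ A)) := by
    rw [preimage_sdiff]
    exact (hU.preimage (liftChar hp n e).continuous).sdiff (hA e)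
  refine Filter.mem_of_superset (hopen.mem_nhds hx) fun z hz => ⟨_, hz, map_liftChar hp e z⟩

include hp in
theorem isClosed_skel_inter_compl_image {U A : Set E} (hU : IsOpen U) {n : ℕ}
    (hA : IsClosed (A ∩ p ⁻¹' C.skel n)) : IsClosed ((p '' (U \ A))ᶜ ∩ C.skel n) := by
  have h : (p '' (U \ A))ᶜ ∩ C.skel n = (p '' (U \ (A ∩ p ⁻¹' C.skel n)))ᶜ ∩ C.skel n := by
    ext z
    refine and_congr_left fun hz => not_congr ⟨?_, ?_⟩
    · rintro ⟨x, hx, rfl⟩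
      exact ⟨x, ⟨hx.1, fun h => hx.2 h.1⟩, rfl⟩
    · rintro ⟨x, hx, rfl⟩
      exact ⟨x, ⟨hx.1, fun h => hx.2 ⟨h, hz⟩⟩, rfl⟩
  rw [h]
  exact (hp.isOpenMap _ (hU.sdiff hA)).isClosed_compl.inter (C.isClosed_skel n)

-- On a neighbourhood where `p` is injective, a point lies outside `A` as soon as its image is in
-- the image of the complement of `A`. The topology of `E` is thereby tested in `K`, whose cell
-- structure is known.
omit [MulAction Unit K] in
include hp in
theorem isClosed_of_isOpen_image {A : Set E} (h : ∀ U : Set E, IsOpen U → IsOpen (p '' (U \ A))) :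
    IsClosed A := by
  rw [← isOpen_compl_iff, isOpen_iff_mem_nhds]
  intro x hx
  obtain ⟨φ, hφ, hpφ⟩ := hp.isLocalHomeomorph x
  refine Filter.mem_of_superset (((φ.open_source.inter ((h _ φ.open_source).preimage
    hp.continuous))).mem_nhds ⟨hφ, x, ⟨hφ, hx⟩, rfl⟩) ?_
  rintro y ⟨hy, x', hx', hxy⟩
  rw [hpφ] at hxy
  rw [← φ.injOn hx'.1 hy hxy]
  exact hx'.2

/-- The cell structure on a covering space, with an action of a group of deck transformations. -/
noncomputable def liftCover {G : Type u} [Group G] [MulAction G E] [ContinuousConstSMul G E]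
    (hG : ∀ (g : G) x, p (g • x) = p x) (C : MCWComplex Unit K) : MCWComplex G E where
  cell := C.LiftCell p
  cellAction n :=
    { smul := fun g e => ⟨g • e.1, by rw [hG]; exact e.2⟩
      one_smul := fun e => Subtype.ext (one_smul G e.1)
      mul_smul := fun g h e => Subtype.ext (mul_smul g h e.1) }
  skel n := p ⁻¹' C.skel n
  char n e := liftChar hp n e
  continuous_char n e := (liftChar hp n e).continuous
  char_smul n g e y := by
    let φ : C(Ball n, E) := ⟨fun z => g • liftChar hp n e z, by fun_prop⟩
    let e' : C.LiftCell p n := ⟨g • e.1, by rw [hG]; exact e.2⟩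
    have : φ = liftChar hp n e' := eq_liftChar hp (c := e.base)
      (fun y => by
        change p (g • _) = _
        rw [hG, map_liftChar hp]) e' (by
        change g • liftChar hp n e (ballCentre n) = g • e.1
        rw [liftChar_centre])
    exact (congrArg (fun ψ : C(Ball n, E) => ψ y) this).symm
  skel_zero := by rw [C.skel_zero, preimage_empty]
  skel_succ n := by
    rw [C.skel_succ]
    ext x
    simp only [mem_preimage, mem_union, mem_iUnion, mem_range]
    refine or_congr_right ⟨?_, ?_⟩
    · rintro ⟨c, y, h⟩
      obtain ⟨e, -, he⟩ := exists_liftChar hp h.symm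
      exact ⟨e, y, he⟩
    · rintro ⟨e, y, rfl⟩
      exact ⟨e.base, y, (map_liftChar hp e y).symm⟩
  char_sphere n e y hy := by
    rw [mem_preimage, map_liftChar hp]
    exact C.char_sphere n _ y hy
  char_interior n e y hy := by
    rw [mem_preimage, map_liftChar hp]
    exact C.char_interior n _ y hy
  char_injective n e e' y y' hy hy' h := by
    have h1 := congrArg p h
    rw [map_liftChar hp, map_liftChar hp] at h1
    obtain ⟨h2, rfl⟩ := C.char_injective n _ _ _ _ hy hy' h1
    refine ⟨Subtype.ext ?_, rfl⟩
    have h3 := (C.existsUnique_lift_char hp e.base y _ (map_liftChar hp e y)).unique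
      ⟨rfl, map_liftChar hp e⟩ ⟨h.symm, fun z => (map_liftChar hp e' z).trans (by rw [h2])⟩
    rw [← liftChar_centre hp e, h3, liftChar_centre hp e']
  isClosed_skel_succ n A hA := by
    refine ⟨fun h => ⟨h.inter ((C.isClosed_skel n).preimage hp.continuous),
      fun e => h.preimage (liftChar hp n e).continuous⟩, fun ⟨h, h'⟩ => ?_⟩
    refine isClosed_of_isOpen_image hp fun U hU => ?_
    have hD : IsClosed ((p '' (U \ A))ᶜ ∩ C.skel (n + 1)) := by
      refine (C.isClosed_skel_succ n _ inter_subset_right).2 ⟨?_, fun c => ?_⟩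
      · rw [inter_assoc, inter_eq_self_of_subset_right (C.skel_mono n.le_succ)]
        exact isClosed_skel_inter_compl_image hp hU h
      · rw [preimage_inter]
        exact (isClosed_preimage_compl_image hp hU h' c).inter
          ((C.isClosed_skel _).preimage (C.continuous_char n c))
    have he : p '' (U \ A) = p '' U \ ((p '' (U \ A))ᶜ ∩ C.skel (n + 1)) := by
      ext z
      constructor
      · intro hz
        exact ⟨image_mono sdiff_subset hz, fun h => h.1 hz⟩
      · rintro ⟨⟨x, hx, rfl⟩, hz⟩
        by_contra hx'
        exact hx' ⟨x, ⟨hx, fun hxA => hz ⟨hx', hA hxA⟩⟩, rfl⟩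
    rw [he]
    exact (hp.isOpenMap _ hU).sdiff hD
  iUnion_skel := by
    rw [← preimage_iUnion, C.iUnion_skel, preimage_univ]
  isClosed_iff A := by
    refine ⟨fun h n => h.inter ((C.isClosed_skel n).preimage hp.continuous), fun h => ?_⟩
    refine isClosed_of_isOpen_image hp fun U hU => ?_
    rw [← isClosed_compl_iff, C.isClosed_iff]
    exact fun n => isClosed_skel_inter_compl_image hp hU (h n)

end Lift

end MCWComplex

/-! ### Deck transformations of universal coverings -/

section Deck

variable {K : Type w} [TopologicalSpace K] {E : Type v} [TopologicalSpace E] {p : E → K}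

/-- The projection `p` is lifted through itself, once sending `x` to `y` and once sending `y` to
`x`; by uniqueness of lifts the two maps are mutually inverse. -/
theorem IsCoveringMap.exists_deck [SimplyConnectedSpace E] [LocallyPathConnectedSpace E]
    (hp : IsCoveringMap p) {x y : E} (hxy : p x = p y) :
    ∃ h : E ≃ₜ E, (∀ z, p (h z) = p z) ∧ h x = y := by
  obtain ⟨F, ⟨hF, hF'⟩, -⟩ := hp.existsUnique_continuousMap_lifts ⟨p, hp.continuous⟩ x y hxy.symm
  obtain ⟨H, ⟨hH, hH'⟩, -⟩ := hp.existsUnique_continuousMap_lifts ⟨p, hp.continuous⟩ y x hxy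
  have h1 : H ∘ F = id := hp.eq_of_comp_eq (H.continuous.comp F.continuous) continuous_id
    (by rw [← Function.comp_assoc, hH']; exact hF') x (by simp [hF, hH])
  have h2 : F ∘ H = id := hp.eq_of_comp_eq (F.continuous.comp H.continuous) continuous_id
    (by rw [← Function.comp_assoc, hF']; exact hH') y (by simp [hF, hH])
  exact ⟨⟨⟨F, H, congrFun h1, congrFun h2⟩, F.continuous, H.continuous⟩, congrFun hF', hF⟩

theorem IsCoveringMap.deck_eq [PreconnectedSpace E] (hp : IsCoveringMap p) {f g : E → E}
    (hf : Continuous f) (hg : Continuous g) (hfp : ∀ z, p (f z) = p z) (hgp : ∀ z, p (g z) = p z)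
    {x : E} (h : f x = g x) : f = g :=
  hp.eq_of_comp_eq hf hg (funext fun z => (hfp z).trans (hgp z).symm) x h

theorem IsDeckAction.eq_one {G : Type u} [Group G] [MulAction G E] [ContinuousConstSMul G E]
    [PreconnectedSpace E] (hp : IsCoveringMap p) (h : IsDeckAction G p) {g : G} {x : E}
    (hx : g • x = x) : g = 1 := by
  have hg : (fun z => g • z) = id := hp.deck_eq (continuous_const_smul g) continuous_id (h.1 g)
    (fun _ => rfl) hx
  exact (h.2 (Homeomorph.refl E) fun _ => rfl).unique (fun z => (congrFun hg z).symm)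
    fun z => (one_smul G z).symm

/-- The group of deck transformations. -/
def deckGroup (p : E → K) : Subgroup (E ≃ₜ E) where
  carrier := {h | ∀ z, p (h z) = p z}
  mul_mem' {a b} ha hb z := (ha (b z)).trans (hb z)
  one_mem' _ := rfl
  inv_mem' {a} ha z := by
    rw [← ha (a⁻¹ z)]
    exact congrArg p (a.apply_symm_apply z)

instance deckGroup.mulAction (p : E → K) : MulAction (deckGroup p) E where
  smul h x := h.1 x
  one_smul _ := rfl
  mul_smul _ _ _ := rfl

/-- Deck transformations act freely by uniqueness of lifts and transitively on fibres by
`IsCoveringMap.exists_deck`. -/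
theorem deckGroup.isQuotientCoveringMap [SimplyConnectedSpace E] [LocallyPathConnectedSpace E]
    (hp : IsCoveringMap p) (hs : Function.Surjective p) :
    IsQuotientCoveringMap p (deckGroup p) := by
  refine (isQuotientCoveringMap_iff_isCoveringMap_and _ _).2 ⟨hp, hs, ⟨fun h => h.1.continuous⟩,
    { right_cancel' := fun a b x h => ?_ }, fun {x y} => ⟨fun h => ?_, ?_⟩⟩
  · exact Subtype.ext (Homeomorph.ext (congrFun (hp.deck_eq a.1.continuous b.1.continuous a.2 b.2 h)))
  · obtain ⟨f, hf, hfy⟩ := hp.exists_deck h.symm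
    exact ⟨⟨f, hf⟩, hfy⟩
  · rintro ⟨f, rfl⟩
    exact f.2 y

theorem IsCoveringMap.surjective_of_pathConnectedSpace [PathConnectedSpace K] [Nonempty E]
    (hp : IsCoveringMap p) : Function.Surjective p := by
  intro k
  obtain ⟨e⟩ := ‹Nonempty E›
  let γ := PathConnectedSpace.somePath (p e) k
  obtain ⟨Γ, hΓ, -⟩ := hp.exists_path_lifts γ.toContinuousMap e γ.source
  exact ⟨Γ 1, (congrFun hΓ 1).trans γ.target⟩

theorem IsEilenbergMacLane.exists_isDeckAction {G : Type u} [Group G]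
    (hK : IsEilenbergMacLane G K) [SimplyConnectedSpace E] [LocallyPathConnectedSpace E]
    (hp : IsCoveringMap p) :
    ∃ _ : MulAction G E, ContinuousConstSMul G E ∧ IsDeckAction G p := by
  have := hK.pathConnectedSpace
  have hq := deckGroup.isQuotientCoveringMap hp hp.surjective_of_pathConnectedSpace
  obtain ⟨e⟩ : Nonempty E := inferInstance
  obtain ⟨φ⟩ := hK.fundamentalGroup (p e)
  -- The fundamental group of `K` is `G` by hypothesis and the opposite of the deck group by the
  -- covering; inversion removes the opposite.
  let θ : G ≃* deckGroup p :=
    (φ.symm.trans (hq.fundamentalGroupEquiv ⟨e, rfl⟩)).trans (MulEquiv.inv' (deckGroup p)).symm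
  let a : MulAction G E := MulAction.compHom E θ.toMonoidHom
  have hc : ContinuousConstSMul G E := ⟨fun g => (θ g).1.continuous⟩
  refine ⟨a, hc, fun g x => (θ g).2 x, fun h hh => ⟨θ.symm ⟨h, hh⟩, fun x => ?_, fun g hg => ?_⟩⟩
  · change h x = (θ (θ.symm ⟨h, hh⟩)).1 x
    rw [MulEquiv.apply_symm_apply]
  · rw [MulEquiv.eq_symm_apply]
    exact Subtype.ext (Homeomorph.ext fun x => (hg x).symm)

end Deck

/-- A choice of one representative in each orbit is a basis. -/
theorem IsFreeMSet.of_group {G : Type u} [Group G] {P : Type v} [MulAction G P]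
    (h : ∀ (g : G) (x : P), g • x = x → g = 1) : IsFreeMSet G P := by
  refine ⟨Set.range (Quotient.out : MulAction.orbitRel.Quotient G P → P), ?_, fun x => ?_⟩
  · rintro ⟨g, _, q, rfl⟩ ⟨g', _, q', rfl⟩ hgg
    have hgg' : g • q.out = g' • q'.out := hgg
    have hq : q = q' := by
      rw [← Quotient.out_eq q, ← Quotient.out_eq q']
      refine Quotient.sound ⟨g⁻¹ * g', ?_⟩
      change (g⁻¹ * g') • q'.out = q.out
      rw [mul_smul, ← hgg', inv_smul_smul]
    subst hq
    have := h (g'⁻¹ * g) q.out (by rw [mul_smul, hgg', inv_smul_smul])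
    rw [inv_mul_eq_one] at this
    subst this
    rfl
  · obtain ⟨g, hg⟩ := Quotient.exact (Quotient.out_eq (Quotient.mk (MulAction.orbitRel G P) x))
    refine ⟨⟨g⁻¹, ⟨_, Quotient.mk _ x, rfl⟩⟩, ?_⟩
    have hg' : g • x = (Quotient.mk (MulAction.orbitRel G P) x).out := hg
    change g⁻¹ • (Quotient.mk (MulAction.orbitRel G P) x).out = x
    rw [← hg', inv_smul_smul]

/-! ### Vanishing homotopy groups and contractibility -/

open Metric unitInterval

/-- The map from the ball to the sphere that collapses the boundary to a point. -/
noncomputable def ballCollapse (V : Type*) [NormedAddCommGroup V] [NormedSpace ℝ V] :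
    C(closedBall (0 : V) 1, sphere (0 : WithLp 2 (V × ℝ)) 1) where
  -- The centre goes to the south pole, radius `r` to height `2 * r ^ 2 - 1`, and the boundary to
  -- the north pole; the norm is one since `4 * (1 - r ^ 2) * r ^ 2 + (2 * r ^ 2 - 1) ^ 2 = 1`.
  toFun x := ⟨WithLp.toLp 2 ((2 * √(1 - ‖x.1‖ ^ 2)) • x.1, 2 * ‖x.1‖ ^ 2 - 1), by
    have h : ‖x.1‖ ≤ 1 := mem_closedBall_zero_iff.1 x.2
    have h0 : 0 ≤ 1 - ‖x.1‖ ^ 2 := by nlinarith [norm_nonneg x.1]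
    rw [mem_sphere_zero_iff_norm, ← sq_eq_sq₀ (norm_nonneg _) zero_le_one,
      WithLp.prod_norm_sq_eq_of_L2]
    simp only [WithLp.toLp_fst, WithLp.toLp_snd, norm_smul, Real.norm_eq_abs, mul_pow, sq_abs,
      Real.sq_sqrt h0]
    ring⟩
  continuous_toFun := by
    refine Continuous.subtype_mk ((WithLp.prod_continuous_toLp 2 V ℝ).comp ?_) _
    fun_prop

theorem ballCollapse_eq {V : Type*} [NormedAddCommGroup V] [NormedSpace ℝ V]
    {x y : closedBall (0 : V) 1} (h : ballCollapse V x = ballCollapse V y) :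
    x = y ∨ ‖x.1‖ = 1 ∧ ‖y.1‖ = 1 := by
  have h1 : (2 * √(1 - ‖x.1‖ ^ 2)) • x.1 = (2 * √(1 - ‖y.1‖ ^ 2)) • y.1 :=
    congrArg (fun z : sphere (0 : WithLp 2 (V × ℝ)) 1 => z.1.fst) h
  have h2 : 2 * ‖x.1‖ ^ 2 - 1 = 2 * ‖y.1‖ ^ 2 - 1 :=
    congrArg (fun z : sphere (0 : WithLp 2 (V × ℝ)) 1 => z.1.snd) h
  have h3 : ‖x.1‖ = ‖y.1‖ := by
    rw [← sq_eq_sq₀ (norm_nonneg _) (norm_nonneg _)]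
    linarith
  have hx : ‖x.1‖ ≤ 1 := mem_closedBall_zero_iff.1 x.2
  rcases hx.eq_or_lt with hx | hx
  · exact Or.inr ⟨hx, h3 ▸ hx⟩
  · left
    rw [← h3] at h1
    have h0 : 0 < 1 - ‖x.1‖ ^ 2 := by nlinarith [norm_nonneg x.1]
    have : 2 * √(1 - ‖x.1‖ ^ 2) ≠ 0 := by positivity
    exact Subtype.ext (smul_right_injective V this h1)

theorem ballCollapse_of_norm_eq_one {V : Type*} [NormedAddCommGroup V] [NormedSpace ℝ V]
    {x y : closedBall (0 : V) 1} (hx : ‖x.1‖ = 1) (hy : ‖y.1‖ = 1) :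
    ballCollapse V x = ballCollapse V y := by
  apply Subtype.ext
  simp [ballCollapse, hx, hy]

theorem ballCollapse_surjective (V : Type*) [NormedAddCommGroup V] [NormedSpace ℝ V]
    [Nontrivial V] : Function.Surjective (ballCollapse V) := by
  rintro ⟨z, hz⟩
  have hz1 : ‖z.fst‖ ^ 2 + z.snd ^ 2 = 1 := by
    have := WithLp.prod_norm_sq_eq_of_L2 z
    rw [mem_sphere_zero_iff_norm.1 hz, Real.norm_eq_abs, sq_abs] at this
    linarith
  rcases eq_or_ne z.snd 1 with h1 | h1
  · obtain ⟨v, hv⟩ := exists_norm_eq V zero_le_one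
    refine ⟨⟨v, mem_closedBall_zero_iff.2 hv.le⟩, Subtype.ext ?_⟩
    have hz0 : z.fst = 0 := by
      rw [h1] at hz1
      have : ‖z.fst‖ ^ 2 = 0 := by linarith
      simpa using this
    apply WithLp.ofLp_injective 2
    refine Prod.ext ?_ ?_
    · change (2 * √(1 - ‖v‖ ^ 2)) • v = z.fst
      rw [hv, hz0]
      simp
    · change 2 * ‖v‖ ^ 2 - 1 = z.snd
      rw [hv, h1]
      norm_num
  · have hs : z.snd < 1 := lt_of_le_of_ne (by nlinarith [sq_nonneg ‖z.fst‖]) h1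
    have hs' : -1 ≤ z.snd := by nlinarith [sq_nonneg ‖z.fst‖]
    set r := (1 - z.snd) / 2 with hr
    have hr0 : 0 < r := by linarith
    have hn : ‖(2 * √r)⁻¹ • z.fst‖ ^ 2 = 1 - r := by
      rw [norm_smul, mul_pow, norm_inv, Real.norm_eq_abs, inv_pow, sq_abs, mul_pow,
        Real.sq_sqrt hr0.le]
      have : ‖z.fst‖ ^ 2 = 4 * r * (1 - r) := by rw [hr]; nlinarith
      rw [this]
      field_simp
      norm_num
    refine ⟨⟨(2 * √r)⁻¹ • z.fst, mem_closedBall_zero_iff.2 ?_⟩, Subtype.ext ?_⟩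
    · rw [← sq_le_one_iff₀ (norm_nonneg _), hn]
      linarith
    · apply WithLp.ofLp_injective 2
      refine Prod.ext ?_ ?_
      · change (2 * √(1 - ‖(2 * √r)⁻¹ • z.fst‖ ^ 2)) • (2 * √r)⁻¹ • z.fst = z.fst
        rw [hn, sub_sub_cancel, smul_inv_smul₀]
        positivity
      · change 2 * ‖(2 * √r)⁻¹ • z.fst‖ ^ 2 - 1 = z.snd
        rw [hn, hr]
        ring

/-- The sphere is the cube with its boundary collapsed to a point. A map of the sphere is thus a
loop, and a nullhomotopy relative to the boundary descends to the sphere. The round norm serves for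
the collapse; the choice of norm does not affect the conclusion. -/
theorem SphereExtension.of_genLoop {n : ℕ} (hn : 1 ≤ n) {Y : Type*} [TopologicalSpace Y]
    [Nonempty Y] (h : ∀ (y : Y) (α : GenLoop (Fin n) Y y), GenLoop.Homotopic α GenLoop.const) :
    SphereExtension (EuclideanSpace ℝ (Fin n) × ℝ) Y := by
  let V := EuclideanSpace ℝ (Fin n)
  have : Nonempty (Fin n) := ⟨⟨0, hn⟩⟩
  refine SphereExtension.congr (V := WithLp 2 (V × ℝ)) ?_
    (LinearEquiv.finrank_eq (WithLp.linearEquiv 2 ℝ (V × ℝ)))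
  refine SphereExtension.of_nullhomotopic fun φ => ?_
  let Q : C(Fin n → I, sphere (0 : WithLp 2 (V × ℝ)) 1) := (ballCollapse V).comp
    ⟨fun y => MCWComplex.maxBallHomeo n (cubeHomeo n y),
      (MCWComplex.maxBallHomeo n).continuous.comp (cubeHomeo n).continuous⟩
  have hnorm (y : Fin n → I) :
      ‖(MCWComplex.maxBallHomeo n (cubeHomeo n y)).1‖ = 1 ↔ y ∈ Cube.boundary (Fin n) := by
    rw [MCWComplex.norm_maxBallHomeo, norm_cubeHomeo]
  have hb0 : (0 : Fin n → I) ∈ Cube.boundary (Fin n) := ⟨⟨0, hn⟩, Or.inl rfl⟩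
  have hQb (y : Fin n → I) (hy : y ∈ Cube.boundary (Fin n)) : Q y = Q 0 :=
    ballCollapse_of_norm_eq_one ((hnorm y).2 hy) ((hnorm 0).2 hb0)
  have hQs : Function.Surjective Q := (ballCollapse_surjective V).comp
    ((MCWComplex.maxBallHomeo n).surjective.comp (cubeHomeo n).surjective)
  have hQe {y y' : Fin n → I} (he : Q y = Q y') :
      y = y' ∨ y ∈ Cube.boundary (Fin n) ∧ y' ∈ Cube.boundary (Fin n) := by
    rw [← hnorm, ← hnorm]
    refine (ballCollapse_eq he).imp_left fun h => ?_
    exact (cubeHomeo n).injective ((MCWComplex.maxBallHomeo n).injective h)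
  let α : GenLoop (Fin n) Y (φ (Q 0)) := ⟨φ.comp Q, fun y hy => congrArg φ (hQb y hy)⟩
  obtain ⟨H⟩ := h _ α
  let P : C(I × (Fin n → I), I × sphere (0 : WithLp 2 (V × ℝ)) 1) :=
    (ContinuousMap.id I).prodMap Q
  have hP : IsQuotientMap P := IsQuotientMap.of_surjective_continuous
    (Function.surjective_id.prodMap hQs) P.continuous
  have hfac : Function.FactorsThrough H.toContinuousMap P := by
    rintro ⟨t, y⟩ ⟨t', y'⟩ he
    obtain rfl : t = t' := congrArg Prod.fst he
    rcases hQe (congrArg Prod.snd he) with rfl | ⟨hy, hy'⟩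
    · rfl
    · exact ((H.prop t y hy).trans (α.2 y hy)).trans ((H.prop t y' hy').trans (α.2 y' hy')).symm
  have hlift (t : I) (y : Fin n → I) : hP.lift H.toContinuousMap hfac (t, Q y) = H (t, y) :=
    congrArg (fun f : C(I × (Fin n → I), Y) => f (t, y)) (hP.lift_comp H.toContinuousMap hfac)
  refine ⟨φ (Q 0), ⟨hP.lift H.toContinuousMap hfac, fun s => ?_, fun s => ?_⟩⟩
  · obtain ⟨y, rfl⟩ := hQs s
    exact (hlift 0 y).trans (H.apply_zero y)
  · obtain ⟨y, rfl⟩ := hQs s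
    exact (hlift 1 y).trans (H.apply_one y)

theorem SphereExtension.of_pathConnectedSpace (Y : Type*) [TopologicalSpace Y]
    [PathConnectedSpace Y] : SphereExtension ℝ Y := by
  intro φ
  let γ := PathConnectedSpace.somePath (φ ⟨-1, by simp⟩) (φ ⟨1, by simp⟩)
  refine ⟨⟨fun x => γ.extend ((x.1 + 1) / 2), γ.continuous_extend.comp (by fun_prop)⟩, fun x => ?_⟩
  have hx : |x.1| = 1 := mem_sphere_zero_iff_norm.1 x.2
  change γ.extend ((x.1 + 1) / 2) = φ x
  rcases (abs_eq zero_le_one).1 hx with h | h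
  · rw [h]
    norm_num
    congr 1
    exact Subtype.ext h.symm
  · rw [h]
    norm_num
    congr 1
    exact Subtype.ext h.symm

/-- Homotopies relative to the boundary lift along coverings, so a loop upstairs is trivial if its
projection is. -/
theorem IsCoveringMap.genLoop_homotopic_const {K : Type w} [TopologicalSpace K] {E : Type v}
    [TopologicalSpace E] {p : E → K} (hp : IsCoveringMap p) {n : ℕ} (hn : 1 ≤ n) (e : E)
    [Subsingleton (HomotopyGroup.Pi n K (p e))] (α : GenLoop (Fin n) E e) :
    GenLoop.Homotopic α GenLoop.const := by
  have hb0 : (0 : Fin n → I) ∈ Cube.boundary (Fin n) := ⟨⟨0, hn⟩, Or.inl rfl⟩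
  refine (hp.homotopicRel_iff_comp ⟨0, hb0, α.2 0 hb0⟩).2 ?_
  let β : GenLoop (Fin n) K (p e) :=
    ⟨ContinuousMap.comp ⟨p, hp.continuous⟩ α.1, fun y hy => congrArg p (α.2 y hy)⟩
  exact Quotient.exact (Subsingleton.elim (α := HomotopyGroup.Pi n K (p e))
    (Quotient.mk _ β) (Quotient.mk _ GenLoop.const))

/-- The sphere of `ℝ^n × ℝ` has dimension `n`: dimension zero is path connectedness of `E`,
dimension one is simple connectedness, and higher dimensions come from the asphericity of `K`. -/
theorem IsEilenbergMacLane.sphereExtension {G : Type u} [Group G] {K : Type w} [TopologicalSpace K]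
    (hK : IsEilenbergMacLane G K) {E : Type v} [TopologicalSpace E] [SimplyConnectedSpace E]
    {p : E → K} (hp : IsCoveringMap p) (n : ℕ) :
    SphereExtension (EuclideanSpace ℝ (Fin n) × ℝ) E := by
  rcases Nat.lt_or_ge n 2 with hn | hn
  · interval_cases n
    · exact (SphereExtension.of_pathConnectedSpace E).congr (by simp)
    · refine SphereExtension.of_genLoop le_rfl fun e α => ?_
      have : Subsingleton (FundamentalGroup E e) := inferInstance
      have : Subsingleton (HomotopyGroup.Pi 1 E e) :=
        (HomotopyGroup.pi1EquivFundamentalGroup (X := E) (x := e)).subsingleton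
      exact Quotient.exact (Subsingleton.elim (α := HomotopyGroup.Pi 1 E e)
        (Quotient.mk _ α) (Quotient.mk _ GenLoop.const))
  · refine SphereExtension.of_genLoop (by omega) fun e α => ?_
    have := hK.aspherical n hn (p e)
    exact hp.genLoop_homotopic_const (by omega) e α

/-- The identity is deformed cell by cell to a constant map. The action is forgotten first, since a
constant map need not be equivariant. -/
theorem MCWComplex.contractibleSpace_of_sphereExtension {M : Type u} [Monoid M] {X : Type v}
    [TopologicalSpace X] [MulAction M X] (C : MCWComplex M X) [Nonempty X]
    (h : ∀ n, SphereExtension (EuclideanSpace ℝ (Fin n) × ℝ) X) : ContractibleSpace X := by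
  obtain ⟨x₀⟩ := ‹Nonempty X›
  let _ := unitAction X
  have : ContinuousConstSMul Unit X := ⟨fun _ => continuous_id⟩
  obtain ⟨H, -⟩ := C.forget.mHomotopic (fun n => @isProjectiveMSet_unit _ (C.forget.cellAction n)) h
    (ContinuousMap.id X) (ContinuousMap.const X x₀) (fun _ _ => rfl) (fun _ _ => rfl)
  exact (contractible_iff_id_nullhomotopic X).2 ⟨x₀, ⟨H⟩⟩

/-- The cells of `K` lift to `E`, with the trivial group acting. The property is what allows `p` to
be lifted over `E` in the construction of deck transformations. -/
theorem IsEilenbergMacLane.locallyPathConnectedSpace {G : Type u} [Group G] {K : Type w}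
    [TopologicalSpace K] (hK : IsEilenbergMacLane G K) {E : Type v} [TopologicalSpace E]
    {p : E → K} (hp : IsCoveringMap p) : LocallyPathConnectedSpace E := by
  have := hK.t2Space
  obtain ⟨_⟩ := hK.cwComplex
  let _ := unitAction K
  let _ := unitAction E
  have : ContinuousConstSMul Unit E := ⟨fun _ => continuous_id⟩
  exact (MCWComplex.liftCover hp (G := Unit) (fun _ _ => rfl)
    MCWComplex.ofCWComplex).locallyPathConnectedSpace

theorem IsEilenbergMacLane.exists_isEquivariantClassifyingSpace {G : Type u} [Group G] {K : Type w}
    [TopologicalSpace K] (hK : IsEilenbergMacLane G K) {E : Type v} [TopologicalSpace E]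
    [SimplyConnectedSpace E] {p : E → K} (hp : IsCoveringMap p) [MulAction G E]
    [ContinuousConstSMul G E] (hG : IsDeckAction G p) :
    ∃ C : MCWComplex G E, C.IsEquivariantClassifyingSpace := by
  have := hK.t2Space
  obtain ⟨_⟩ := hK.cwComplex
  let _ := unitAction K
  let C := MCWComplex.liftCover hp hG.1 MCWComplex.ofCWComplex
  -- A lifted cell is recorded by its centre, so a group element that fixes a cell fixes a point of
  -- `E` and is therefore trivial.
  refine ⟨C, fun n => IsFreeMSet.isProjectiveMSet (IsFreeMSet.of_group fun g e he => ?_),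
    C.contractibleSpace_of_sphereExtension fun n => hK.sphereExtension hp n⟩
  exact hG.eq_one hp (congrArg Subtype.val he)

theorem theoremt :
    -- The statements on a monoid `M`.
    (∀ (M : Type u) [Monoid M],
      -- There is a contractible free `M`-CW complex.
      (∃ (X : Type u) (_ : TopologicalSpace X) (_ : MulAction M X) (_ : ContinuousConstSMul M X)
        (C : MCWComplex M X), C.IsFree ∧ C.IsEquivariantClassifyingSpace) ∧
      -- `|EM|` is an example.
      (∃ C : MCWComplex M (EMSpace M), C.IsFree ∧ C.IsEquivariantClassifyingSpace) ∧
      -- Two equivariant classifying spaces are `M`-homotopy equivalent, by a cellular equivalence,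
      -- and their quotients by `M` are homotopy equivalent.
      (∀ (X : Type*) [TopologicalSpace X] [MulAction M X] [ContinuousConstSMul M X]
        (Y : Type*) [TopologicalSpace Y] [MulAction M Y] [ContinuousConstSMul M Y]
        (C : MCWComplex M X) (D : MCWComplex M Y),
        C.IsEquivariantClassifyingSpace → D.IsEquivariantClassifyingSpace →
        (∃ (f : C(X, Y)) (g : C(Y, X)), AreMHomotopyInverse M f g ∧
          C.IsCellular D f ∧ D.IsCellular C g) ∧
        Nonempty (ContinuousMap.HomotopyEquiv (WeakOrbits M X) (WeakOrbits M Y))) ∧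
      -- The quotient of an equivariant classifying space is homotopy equivalent to `|BM|`.
      (∀ (X : Type*) [TopologicalSpace X] [MulAction M X] [ContinuousConstSMul M X]
        (C : MCWComplex M X), C.IsEquivariantClassifyingSpace →
        Nonempty (ContinuousMap.HomotopyEquiv (WeakOrbits M X) (BMSpace M)))) ∧
    -- The statements on a group `G`.
    (∀ (G : Type*) [Group G],
      -- The quotient of an equivariant classifying space is an Eilenberg-Mac Lane space.
      (∀ (X : Type*) [TopologicalSpace X] [MulAction G X] [ContinuousConstSMul G X]
        (C : MCWComplex G X), C.IsEquivariantClassifyingSpace →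
        IsEilenbergMacLane G (WeakOrbits G X)) ∧
      -- The universal cover of an Eilenberg-Mac Lane space is an equivariant classifying space,
      -- where `G` acts by deck transformations.
      (∀ (K : Type*) [TopologicalSpace K], IsEilenbergMacLane G K →
        ∀ (E : Type*) [TopologicalSpace E] [SimplyConnectedSpace E] (p : E → K), IsCoveringMap p →
        (∃ (_ : MulAction G E), ContinuousConstSMul G E ∧ IsDeckAction G p) ∧
        (∀ [MulAction G E] [ContinuousConstSMul G E], IsDeckAction G p →
          ∃ C : MCWComplex G E, C.IsEquivariantClassifyingSpace))) := by
  refine ⟨fun M _ => ⟨?_, ?_, ?_, ?_⟩, fun G _ => ⟨?_, ?_⟩⟩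
  · exact ⟨EMSpace M, inferInstance, inferInstance, inferInstance, RightCayley.mcwComplex M,
      RightCayley.isFree_mcwComplex M, RightCayley.isEquivariantClassifyingSpace M⟩
  · exact ⟨RightCayley.mcwComplex M, RightCayley.isFree_mcwComplex M,
      RightCayley.isEquivariantClassifyingSpace M⟩
  · intro X _ _ _ Y _ _ _ C D hC hD
    obtain ⟨f, g, h, hf, hg⟩ := hC.exists_equivalence hD
    exact ⟨⟨f, g, h, hf, hg⟩, WeakOrbits.nonempty_homotopyEquiv h⟩
  · intro X _ _ _ C hC
    obtain ⟨f, g, h, -⟩ := hC.exists_equivalence (RightCayley.isEquivariantClassifyingSpace M)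
    obtain ⟨a⟩ := WeakOrbits.nonempty_homotopyEquiv h
    obtain ⟨b⟩ := RightCayley.nonempty_weakOrbits_homeomorph M
    exact ⟨a.trans b.toHomotopyEquiv⟩
  · intro X _ _ _ C hC
    exact hC.isEilenbergMacLane
  · intro K _ hK E _ _ p hp
    have := hK.locallyPathConnectedSpace hp
    exact ⟨hK.exists_isDeckAction hp, fun h => hK.exists_isEquivariantClassifyingSpace hp h⟩
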